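/- Let $A$ be a commutative Noetherian ring, $r\ge 0$, $S=A[s_0,\dots,s_r]$ with its standard grading, and $\pi\colon\mathbb P^r_A=\operatorname{Proj}S\to\operatorname{Spec}A$ the projection. For a graded $S$-module $M$ let $\tilde M$ be the associated sheaf on $\mathbb P^r_A$, and for an integer $d\ge 0$ let $\check C^\bullet_{\le d}(M)$ be the truncated Čech complex of graded $S$-modules $$\check C^p_{\le d}(M)=\bigoplus_{0\le i_0<\dots<i_p\le r} M\otimes_S S\cdot\frac1{(s_{i_0}\cdots s_{i_p})^d}\qquad(0\le p\le r),$$ where $S\cdot\frac1{(s_{i_0}\cdots s_{i_p})^d}\subset S[(s_{i_0}\cdots s_{i_p})^{-1}]$ is the free graded $S$-module generated in degree $-d(p+1)$ (so each summand is isomorphic to the twist $M(d(p+1))$), with the differential sending $\left(\frac{a_{i_0,\dots,i_p}}{(s_{i_0}\cdots s_{i_p})^d}\right)$ to the element whose $(j_0,\dots,j_{p+1})$-component is $$\frac1{(s_{j_0}\cdots s_{j_{p+1}})^d}\sum_{k=0}^{p+1}(-1)^k s_{j_k}^d\,a_{j_0,\dots,\hat{j_k},\dots,j_{p+1}}.$$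 Let $M^\bullet$ be a bounded complex of finitely generated graded $S$-modules and, for every $q$, let $K^{\bullet,q}\to M^q$ be a graded free resolution with $$K^{-p,q}=\bigoplus_{i=1}^{\beta_{-p,q}}S(-w_{-p,q,i}),\qquad p\ge 0,\quad \beta_{-p,q}<\infty.$$ Let $d\ge 0$ be an integer with $$d\ \ge\ w_{-p,q,i}-r\quad\text{for all } q \text{ with } M^q\ne 0,\ \text{all } 0\le p\le r+1\ \text{ and all } 1\le i\le\beta_{-p,q}.$$ Then $\mathbb R\pi_*(\tilde M^\bullet)$ is quasi-isomorphic to the degree-zero part of the total complex of the double complex $C^{p,q}_{\le d}=\check C^p_{\le d}(M^q)$: $$\mathbb R\pi_*(\tilde M^\bullet)\ \cong\ \operatorname{Tot}\bigl(\check C^\bullet_{\le d}(M^\bullet)\bigr)_0$$ in the derived category of sheaves of modules on $\operatorname{Spec}A$, where the complex of $A$-modules on the right is regarded as the associated complex of sheaves on $\operatorname{Spec}A$. -/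

import Mathlib

open CategoryTheory Limits AlgebraicGeometry

universe u w₁ w₂

/-! ### Sheaves of modules on a scheme have enough injectives -/

namespace PresheafOfModules
variable {C : Type u} [SmallCategory C] (R : Cᵒᵖ ⥤ RingCat.{u})
instance ab5 : AB5OfSize.{u,u} (PresheafOfModules.{u} R) where
  ofShape J _ _ := HasExactColimitsOfShape.domain_of_functor J (PresheafOfModules.toPresheaf.{u} R)
end PresheafOfModules

namespace AlgebraicGeometry.Scheme.Modules
variable (X : Scheme.{u})

instance ab5 : AB5OfSize.{u,u} X.Modules where
  ofShape J _ _ :=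
    let adj := PresheafOfModules.sheafificationAdjunction (𝟙 X.ringCatSheaf.obj)
    have : HasExactColimitsOfShape J (SheafOfModules.{u} X.ringCatSheaf) :=
      adj.hasExactColimitsOfShape J
    inferInstanceAs (HasExactColimitsOfShape J (SheafOfModules.{u} X.ringCatSheaf))

instance hasSeparator : HasSeparator X.Modules where
  hasSeparator := by
    let adj := PresheafOfModules.sheafificationAdjunction (𝟙 X.ringCatSheaf.obj)
    let F : X.Opens → SheafOfModules.{u} X.ringCatSheaf := fun U ↦
      (PresheafOfModules.sheafification (𝟙 X.ringCatSheaf.obj)).obj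
        ((PresheafOfModules.free X.ringCatSheaf.obj).obj (yoneda.obj U))
    have hF : ObjectProperty.IsSeparating (.ofObj F) := by
      intro M N f g h
      apply (SheafOfModules.forget X.ringCatSheaf ⋙
        PresheafOfModules.restrictScalars (𝟙 X.ringCatSheaf.obj)).map_injective
      apply PresheafOfModules.freeYoneda.isSeparating X.ringCatSheaf.obj
      rintro _ ⟨U⟩ k
      have := h (F U) ⟨U⟩ ((adj.homEquiv _ _).symm k)
      rw [← adj.homEquiv_naturality_right_symm, ← adj.homEquiv_naturality_right_symm] at this
      exact (adj.homEquiv _ _).symm.injective this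
    exact ⟨_, hF.isSeparator_coproduct⟩

instance isGrothendieckAbelian : IsGrothendieckAbelian.{u} X.Modules where

end AlgebraicGeometry.Scheme.Modules

noncomputable section

namespace GrMod

/-- A criterion for a family of subgroups to be a direct sum decomposition. -/
lemma isInternal_of {G : Type u} [AddCommGroup G] (B : ℤ → AddSubgroup G)
    (h₁ : ∀ m : G, ∃ x : ℤ →₀ G, (∀ n, x n ∈ B n) ∧ (x.sum fun _ y ↦ y) = m)
    (h₂ : ∀ x : ℤ →₀ G, (∀ n, x n ∈ B n) → (x.sum fun _ y ↦ y) = 0 → x = 0) :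
    DirectSum.IsInternal B := by
  classical
  refine ⟨(injective_iff_map_eq_zero _).2 fun z hz ↦ ?_, fun m ↦ ?_⟩
  · have hs : z.support.sum (fun n ↦ (z n : G)) = 0 := by
      rw [← hz]
      exact (DirectSum.coeAddMonoidHom_eq_dfinsuppSum B z).symm
    let x : ℤ →₀ G := Finsupp.onFinset z.support (fun n ↦ (z n : G)) (by simp)
    have hx : x = 0 := h₂ x (fun n ↦ (z n).2) (by
      rw [Finsupp.onFinset_sum _ (by simp)]; exact hs)
    ext n
    exact congr($hx n)
  · obtain ⟨x, hx, rfl⟩ := h₁ m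
    refine ⟨x.support.sum fun n ↦ DirectSum.of (fun n ↦ B n) n ⟨x n, hx n⟩, ?_⟩
    rw [map_sum]
    simp [Finsupp.sum]

lemma exists_of_isInternal {G : Type u} [AddCommGroup G] {B : ℤ → AddSubgroup G}
    (h : DirectSum.IsInternal B) :
    (∀ m : G, ∃ x : ℤ →₀ G, (∀ n, x n ∈ B n) ∧ (x.sum fun _ y ↦ y) = m) ∧
    (∀ x : ℤ →₀ G, (∀ n, x n ∈ B n) → (x.sum fun _ y ↦ y) = 0 → x = 0) := by
  classical
  refine ⟨fun m ↦ ?_, fun x hx h0 ↦ ?_⟩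
  · obtain ⟨z, rfl⟩ := h.2 m
    refine ⟨Finsupp.onFinset z.support (fun n ↦ (z n : G)) (by simp), fun n ↦ (z n).2, ?_⟩
    rw [Finsupp.onFinset_sum _ (by simp)]
    exact (DirectSum.coeAddMonoidHom_eq_dfinsuppSum B z).symm
  · have := h.1 (a₁ := x.support.sum fun n ↦ DirectSum.of (fun n ↦ B n) n ⟨x n, hx n⟩) (a₂ := 0)
      (by rw [map_sum, map_zero, ← h0]; simp [Finsupp.sum])
    ext n
    have h2 := congr(($this n : G))
    rw [DFinsupp.finsetSum_apply] at h2
    by_cases hn : x n = 0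
    · exact hn
    · rw [Finset.sum_eq_single n] at h2
      · simpa using h2
      · intro b _ hb
        exact DirectSum.of_eq_of_ne _ _ _ (by simpa using hb.symm)
      · intro hn'; simp at hn'; exact absurd hn' hn

/-- A finite product of twisted direct sum decompositions is a direct sum decomposition. -/
lemma isInternal_pi {ι : Type} [Finite ι] {G : ι → Type u} [∀ i, AddCommGroup (G i)]
    (B : ∀ i, ℤ → AddSubgroup (G i)) (k : ι → ℤ) (h : ∀ i, DirectSum.IsInternal (B i)) :
    DirectSum.IsInternal fun n ↦ AddSubgroup.pi Set.univ fun i ↦ B i (n + k i) := by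
  classical
  have := Fintype.ofFinite ι
  apply isInternal_of
  · intro m
    choose x hx hm using fun i ↦ (exists_of_isInternal (h i)).1 (m i)
    let s : Finset ℤ := Finset.univ.biUnion fun i ↦ (x i).support.image (· - k i)
    have hs : ∀ n, (fun i ↦ x i (n + k i)) ≠ 0 → n ∈ s := by
      intro n hn
      obtain ⟨i, hi⟩ := Function.ne_iff.1 hn
      exact Finset.mem_biUnion.2 ⟨i, Finset.mem_univ _, Finset.mem_image.2
        ⟨n + k i, by simpa using hi, by simp⟩⟩
    refine ⟨Finsupp.onFinset s (fun n i ↦ x i (n + k i)) hs, fun n i _ ↦ hx i _, ?_⟩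
    rw [Finsupp.onFinset_sum _ (by simp)]
    ext i
    rw [Finset.sum_apply, ← hm i, Finsupp.sum]
    rw [← Finset.sum_image (s := s) (g := (· + k i)) (f := x i) (by intro a _ b _ h; simpa using h)]
    symm
    apply Finset.sum_subset
    · intro n hn
      exact Finset.mem_image.2 ⟨n - k i, Finset.mem_biUnion.2
        ⟨i, Finset.mem_univ _, Finset.mem_image.2 ⟨n, hn, rfl⟩⟩, by simp⟩
    · intro n _ hn; simpa using hn
  · intro x hx h0
    ext n i
    let y : ℤ →₀ G i := Finsupp.onFinset (x.support.image (· + k i)) (fun n ↦ x (n - k i) i) (by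
      intro n hn
      refine Finset.mem_image.2 ⟨n - k i, ?_, by simp⟩
      rw [Finsupp.mem_support_iff]
      intro h; exact hn (by rw [h]; rfl))
    have hy : y = 0 := by
      apply (exists_of_isInternal (h i)).2 y
      · intro n
        have := hx (n - k i) i (Set.mem_univ _)
        change x (n - k i) i ∈ B i n
        simpa using this
      · rw [Finsupp.onFinset_sum _ (by simp), Finset.sum_image (by intro a _ b _ h; simpa using h)]
        have := congr_fun h0 i
        rw [Finsupp.sum, Finset.sum_apply] at this
        simpa using this
    have := congr($hy (n + k i))
    simpa [y] using this

section
variable {σ : Type} {A : Type u} [CommRing A]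
/-- The polynomials all of whose monomials have total degree the integer `n`. -/
def polyDeg (n : ℤ) : AddSubgroup (MvPolynomial σ A) :=
    { carrier := {f | ∀ v ∈ f.support, (v.degree : ℤ) = n}
      zero_mem' := by simp
      add_mem' := by
        classical
        intro f g hf hg v hv
        rcases Finset.mem_union.1 (MvPolynomial.support_add hv) with h | h
        exacts [hf v h, hg v h]
      neg_mem' := by intro f hf v hv; exact hf v (by simpa using hv) }

lemma polyDeg_isInternal : DirectSum.IsInternal (polyDeg (σ := σ) (A := A)) := by
  classical
  apply isInternal_of
  · intro f
    refine ⟨f.support.sum fun v ↦ Finsupp.single (v.degree : ℤ)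
      (MvPolynomial.monomial v (f.coeff v)), fun n ↦ ?_, ?_⟩
    · rw [Finsupp.finsetSum_apply]
      refine AddSubgroup.sum_mem _ fun v _ ↦ ?_
      rw [Finsupp.single_apply]
      split_ifs with h
      · intro w hw
        rw [Finset.mem_singleton.1 (MvPolynomial.support_monomial_subset hw), h]
      · exact AddSubgroup.zero_mem _
    · have : ∀ x : ℤ →₀ MvPolynomial σ A,
          (x.sum fun _ y ↦ y) = Finsupp.liftAddHom (fun _ ↦ AddMonoidHom.id _) x := fun x ↦ rfl
      rw [this, map_sum]
      simp only [Finsupp.liftAddHom_apply_single, AddMonoidHom.id_apply]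
      exact f.support_sum_monomial_coeff
  · intro x hx h0
    ext n v
    by_contra hne
    have hv : (v.degree : ℤ) = n := hx n v (by simpa using hne)
    have := congr(MvPolynomial.coeff v $h0)
    rw [Finsupp.sum, MvPolynomial.coeff_sum, Finset.sum_eq_single n] at this
    · exact hne (by simpa using this)
    · intro b _ hb
      by_contra h
      exact hb ((hx b v (by simpa using h)).symm.trans hv)
    · intro h
      simp at h
      simp [h]

lemma polyDeg_mul {n : ℕ} {j : ℤ} {f m : MvPolynomial σ A} (hf : f.IsHomogeneous n)
    (hm : m ∈ polyDeg (σ := σ) (A := A) j) : f * m ∈ polyDeg (σ := σ) (A := A) (n + j) := by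
  classical
  intro v hv
  obtain ⟨a, ha, b, hb, rfl⟩ := Finset.mem_add.1 (MvPolynomial.support_mul _ _ hv)
  have h1 := hm b hb
  have h2 : a.degree = n := by
    have := hf (by simpa using ha)
    rw [Finsupp.degree_eq_weight_one]; exact this
  rw [map_add]
  push_cast
  rw [h1, h2]
end

end GrMod

/-- The polynomial ring `S = A[s₀, …, s_r]`. -/
abbrev PolyRing (A : Type u) [CommRing A] (r : ℕ) : Type u := MvPolynomial (Fin (r + 1)) A

/-- The standard grading of `S = A[s₀, …, s_r]` by total degree. -/
abbrev stdGrading (A : Type u) [CommRing A] (r : ℕ) : ℕ → Submodule A (PolyRing A r) :=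
  MvPolynomial.homogeneousSubmodule (Fin (r + 1)) A

/-- A `ℤ`-graded module over the standard graded ring `S = A[s₀, …, s_r]`. -/
structure GrMod (A : Type u) [CommRing A] (r : ℕ) where
  carrier : Type u
  [isAddCommGroup : AddCommGroup carrier]
  [isModule : Module (PolyRing A r) carrier]
  deg : ℤ → AddSubgroup carrier
  isInternal : DirectSum.IsInternal deg
  smul_mem : ∀ {n : ℕ} {j : ℤ} {f : PolyRing A r} {m : carrier},
    f ∈ stdGrading A r n → m ∈ deg j → f • m ∈ deg (n + j)

attribute [instance] GrMod.isAddCommGroup GrMod.isModule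

namespace GrMod

variable {A : Type u} [CommRing A] {r : ℕ}

instance : CoeSort (GrMod A r) (Type u) := ⟨GrMod.carrier⟩

/-- Morphisms of graded modules: `S`-linear maps of degree zero. -/
@[ext]
structure Hom (M N : GrMod A r) where
  toLin : M →ₗ[PolyRing A r] N
  map_deg : ∀ (n : ℤ) (m : M), m ∈ M.deg n → toLin m ∈ N.deg n

instance : Category (GrMod A r) where
  Hom := Hom
  id M := ⟨LinearMap.id, fun _ _ h ↦ h⟩
  comp f g := ⟨g.toLin.comp f.toLin, fun n m h ↦ g.map_deg n _ (f.map_deg n m h)⟩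

/-- The underlying linear map of a morphism. -/
abbrev lin {M N : GrMod A r} (f : M ⟶ N) : M →ₗ[PolyRing A r] N := Hom.toLin f

@[ext]
lemma hom_ext {M N : GrMod A r} {f g : M ⟶ N} (h : ∀ m, lin f m = lin g m) : f = g :=
  Hom.ext (LinearMap.ext h)

lemma lin_deg {M N : GrMod A r} (f : M ⟶ N) {n : ℤ} {m : M} (h : m ∈ M.deg n) :
    lin f m ∈ N.deg n := Hom.map_deg f n m h

@[simp] lemma id_lin (M : GrMod A r) : lin (𝟙 M) = LinearMap.id := rfl
@[simp] lemma comp_lin {M N P : GrMod A r} (f : M ⟶ N) (g : N ⟶ P) :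
    lin (f ≫ g) = (lin g).comp (lin f) := rfl

section
variable {M N : GrMod A r}
instance : Zero (M ⟶ N) := ⟨⟨0, fun n _ _ ↦ (N.deg n).zero_mem⟩⟩
instance : Add (M ⟶ N) :=
  ⟨fun f g ↦ ⟨lin f + lin g, fun n _ h ↦ (N.deg n).add_mem (lin_deg f h) (lin_deg g h)⟩⟩
instance : Neg (M ⟶ N) := ⟨fun f ↦ ⟨-lin f, fun n _ h ↦ (N.deg n).neg_mem (lin_deg f h)⟩⟩
instance : Sub (M ⟶ N) :=
  ⟨fun f g ↦ ⟨lin f - lin g, fun n _ h ↦ (N.deg n).sub_mem (lin_deg f h) (lin_deg g h)⟩⟩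
instance : SMul ℕ (M ⟶ N) :=
  ⟨fun k f ↦ ⟨k • lin f, fun n _ h ↦ (N.deg n).nsmul_mem (lin_deg f h) k⟩⟩
instance : SMul ℤ (M ⟶ N) :=
  ⟨fun k f ↦ ⟨k • lin f, fun n _ h ↦ (N.deg n).zsmul_mem (lin_deg f h) k⟩⟩

@[simp] lemma zero_lin : lin (0 : M ⟶ N) = 0 := rfl
@[simp] lemma add_lin (f g : M ⟶ N) : lin (f + g) = lin f + lin g := rfl

instance : AddCommGroup (M ⟶ N) :=
  Function.Injective.addCommGroup (fun f : M ⟶ N ↦ lin f) (fun _ _ h ↦ Hom.ext h)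
    rfl (fun _ _ ↦ rfl) (fun _ ↦ rfl) (fun _ _ ↦ rfl) (fun _ _ ↦ rfl) (fun _ _ ↦ rfl)
end

instance : Preadditive (GrMod A r) where
  add_comp _ _ _ f g h := by ext m; simp
  comp_add _ _ _ f g h := by ext m; simp

/-- For a finite family of graded modules `M i` and integers `k i`, the graded module
`⨁ i, M i (k i)`; here `M (k)` is the twist with `M (k)_n = M_{n + k}`. -/
def sumTwist {ι : Type} [Finite ι] (M : ι → GrMod A r) (k : ι → ℤ) : GrMod A r where
  carrier := ∀ i, M i
  deg n := AddSubgroup.pi Set.univ fun i ↦ (M i).deg (n + k i)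
  isInternal := isInternal_pi (fun i ↦ (M i).deg) k fun i ↦ (M i).isInternal
  smul_mem := by
    intro n j f m hf hm i hi
    have := (M i).smul_mem hf (hm i hi)
    rwa [← add_assoc] at this

/-- The ring `S`, as a graded module over itself. -/
def self (A : Type u) [CommRing A] (r : ℕ) : GrMod A r where
  carrier := PolyRing A r
  deg n := polyDeg n
  isInternal := polyDeg_isInternal
  smul_mem hf hm := polyDeg_mul ((MvPolynomial.mem_homogeneousSubmodule _ _).1 hf) hm

/-- The graded free module `⨁ i, S(-w i)` with finitely many generators, of degrees `w i`. -/
def free (A : Type u) [CommRing A] (r : ℕ) {β : ℕ} (w : Fin β → ℤ) : GrMod A r :=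
  sumTwist (fun _ ↦ self A r) fun i ↦ -w i

/-- A graded free resolution
`⋯ ⟶ ⨁ i, S(-w 1 i) ⟶ ⨁ i, S(-w 0 i) ⟶ M ⟶ 0` by modules of finite rank. -/
structure FreeResolution (M : GrMod A r) where
  /-- the ranks -/
  β : ℕ → ℕ
  /-- the degrees of the generators -/
  w : ∀ p, Fin (β p) → ℤ
  /-- the differentials -/
  d : ∀ p, free A r (w (p + 1)) ⟶ free A r (w p)
  /-- the augmentation -/
  ε : free A r (w 0) ⟶ M
  exact : ∀ p, Function.Exact (lin (d (p + 1))) (lin (d p))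
  exact_zero : Function.Exact (lin (d 0)) (lin ε)
  surjective : Function.Surjective (lin ε)

/-! ### The truncated Čech complex -/

/-- The face of `j₀ < ⋯ < j_{p+1}` obtained by omitting `j_k`. -/
def face {p : ℕ} (J : Fin (p + 2) ↪o Fin (r + 1)) (k : Fin (p + 2)) : Fin (p + 1) ↪o Fin (r + 1) :=
  (Fin.succAboveOrderEmb k).trans J

/-- The graded module `⨁_{i₀ < ⋯ < i_p} M ⊗ S · 1 / (s_{i₀} ⋯ s_{i_p}) ^ d`.
As `S · 1 / (s_{i₀} ⋯ s_{i_p}) ^ d` is a free graded module, with one generator of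
degree `-d * (p + 1)`, each summand is the twist `M (d * (p + 1))`:
the element `m ∈ M` of this twist stands for `m ⊗ 1 / (s_{i₀} ⋯ s_{i_p}) ^ d`. -/
def cechObj (d : ℕ) (M : GrMod A r) (p : ℕ) : GrMod A r :=
  sumTwist (fun _ : Fin (p + 1) ↪o Fin (r + 1) ↦ M) fun _ ↦ d * (p + 1)

/-- The linear map underlying the Čech differential: the numerator of the `J`-component of
`δ a` is the alternating sum of the `s_{J k} ^ d • a (J without J k)`. -/
def cechLin (d : ℕ) (M : GrMod A r) (p : ℕ) :
    ((Fin (p + 1) ↪o Fin (r + 1)) → M) →ₗ[PolyRing A r] ((Fin (p + 2) ↪o Fin (r + 1)) → M) :=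
  LinearMap.pi fun J ↦ ∑ k : Fin (p + 2),
    ((-1) ^ (k : ℕ) * MvPolynomial.X (J k) ^ d : PolyRing A r) • LinearMap.proj (face J k)

lemma cechLin_apply (d : ℕ) (M : GrMod A r) (p : ℕ) (a : (Fin (p + 1) ↪o Fin (r + 1)) → M)
    (J : Fin (p + 2) ↪o Fin (r + 1)) :
    cechLin d M p a J = ∑ k : Fin (p + 2),
      ((-1) ^ (k : ℕ) * MvPolynomial.X (J k) ^ d : PolyRing A r) • a (face J k) := by
  simp [cechLin]

lemma cechLin_mem (d : ℕ) (M : GrMod A r) (p : ℕ) (n : ℤ)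
    (a : (Fin (p + 1) ↪o Fin (r + 1)) → M) (ha : ∀ I, a I ∈ M.deg (n + d * (p + 1)))
    (J : Fin (p + 2) ↪o Fin (r + 1)) :
    cechLin d M p a J ∈ M.deg (n + d * ((p + 1 : ℕ) + 1)) := by
  rw [cechLin_apply]
  refine AddSubgroup.sum_mem _ fun k _ ↦ ?_
  have hX : ((-1) ^ (k : ℕ) * MvPolynomial.X (J k) ^ d : PolyRing A r) ∈ stdGrading A r d := by
    rw [MvPolynomial.mem_homogeneousSubmodule]
    have h1 := (MvPolynomial.isHomogeneous_C (Fin (r + 1)) ((-1 : A) ^ (k : ℕ))).mul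
      ((MvPolynomial.isHomogeneous_X A (J k)).pow d)
    simpa using h1
  have := M.smul_mem hX (ha (face J k))
  convert this using 2
  push_cast
  ring

lemma cechLin_comp (d : ℕ) (M : GrMod A r) (p : ℕ) (a : (Fin (p + 1) ↪o Fin (r + 1)) → M)
    (L : Fin (p + 3) ↪o Fin (r + 1)) : cechLin d M (p + 1) (cechLin d M p a) L = 0 := by
  rw [cechLin_apply]
  simp only [cechLin_apply, Finset.smul_sum, smul_smul]
  rw [← Finset.sum_product']
  refine Finset.sum_involution (fun x _ ↦ (x.1.succAbove x.2, x.2.predAbove x.1)) ?_ ?_ ?_ ?_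
  · rintro ⟨k, l⟩ -
    have h1 : face (face L (k.succAbove l)) (l.predAbove k) = face (face L k) l := by
      ext i
      exact congr(((L $(Fin.succAbove_succAbove_succAbove_predAbove k l i) : Fin (r + 1)) : ℕ))
    have h2 : face L (k.succAbove l) (l.predAbove k) = L k :=
      congr(L $(Fin.succAbove_succAbove_predAbove k l))
    have h3 : face L k l = L (k.succAbove l) := rfl
    dsimp only
    rw [h1, h2, h3, ← add_smul]
    have h4 := Fin.neg_one_pow_succAbove_add_predAbove (R := PolyRing A r) k l
    rw [pow_add, pow_add] at h4
    have h5 : ((-1) ^ (k : ℕ) * MvPolynomial.X (L k) ^ d *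
        ((-1) ^ (l : ℕ) * MvPolynomial.X (L (k.succAbove l)) ^ d) +
        (-1) ^ (k.succAbove l : ℕ) * MvPolynomial.X (L (k.succAbove l)) ^ d *
        ((-1) ^ (l.predAbove k : ℕ) * MvPolynomial.X (L k) ^ d) : PolyRing A r) = 0 := by
      linear_combination (MvPolynomial.X (L k) ^ d * MvPolynomial.X (L (k.succAbove l)) ^ d) * h4
    rw [h5, zero_smul]
  · rintro ⟨k, l⟩ - - h
    exact Fin.succAbove_ne k l congr(($h).1)
  · intros; exact Finset.mem_univ _
  · rintro ⟨k, l⟩ -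
    exact Prod.ext (Fin.succAbove_succAbove_predAbove k l) (Fin.predAbove_predAbove_succAbove k l)

/-- The Čech differential. -/
def cechD (d : ℕ) (M : GrMod A r) (p : ℕ) : cechObj d M p ⟶ cechObj d M (p + 1) where
  toLin := cechLin d M p
  map_deg n a ha J _ := cechLin_mem d M p n a (fun I ↦ ha I (Set.mem_univ I)) J

lemma cechD_comp (d : ℕ) (M : GrMod A r) (p : ℕ) : cechD d M p ≫ cechD d M (p + 1) = 0 :=
  hom_ext fun a ↦ funext fun L ↦ cechLin_comp d M p a L

/-- The map on truncated Čech cochains induced by a morphism of graded modules. -/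
def cechMap (d : ℕ) {M N : GrMod A r} (f : M ⟶ N) (p : ℕ) : cechObj d M p ⟶ cechObj d N p where
  toLin := LinearMap.pi fun J ↦ (lin f).comp (LinearMap.proj J)
  map_deg _ _ ha J hJ := lin_deg f (ha J hJ)

lemma cechLin_map (d : ℕ) {M N : GrMod A r} (f : M →ₗ[PolyRing A r] N) (p : ℕ)
    (a : (Fin (p + 1) ↪o Fin (r + 1)) → M) (J : Fin (p + 2) ↪o Fin (r + 1)) :
    cechLin d N p (fun I ↦ f (a I)) J = f (cechLin d M p a J) := by
  simp only [cechLin_apply, map_sum, map_smul]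

/-- The truncated Čech complex of a graded module, as a functor to complexes of graded modules. -/
def cech (A : Type u) [CommRing A] (r d : ℕ) : GrMod A r ⥤ CochainComplex (GrMod A r) ℕ where
  obj M := CochainComplex.of (cechObj d M) (cechD d M) (cechD_comp d M)
  map {M N} f := CochainComplex.ofHom (fun p ↦ cechMap d f p) (fun p ↦ by
      dsimp only [CochainComplex.of]
      rw [CochainComplex.of_d, CochainComplex.of_d]
      exact hom_ext fun a ↦ funext fun J ↦ cechLin_map d (lin f) p a J)
  map_id M := HomologicalComplex.hom_ext _ _ fun _ ↦ rfl
  map_comp f g := HomologicalComplex.hom_ext _ _ fun _ ↦ rfl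

instance (d : ℕ) : (cech A r d).PreservesZeroMorphisms where
  map_zero _ _ := HomologicalComplex.hom_ext _ _ fun _ ↦ rfl

/-! ### Degree zero parts and the total complex -/

instance (M : GrMod A r) : Module A (M.deg 0) where
  smul a m := ⟨MvPolynomial.C a • m.1, by
    simpa using M.smul_mem (n := 0) (MvPolynomial.isHomogeneous_C _ a) m.2⟩
  one_smul m := Subtype.ext (by change MvPolynomial.C 1 • m.1 = m.1; simp)
  mul_smul a b m := Subtype.ext (by
    change MvPolynomial.C (a * b) • m.1 = MvPolynomial.C a • MvPolynomial.C b • m.1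
    rw [map_mul, mul_smul])
  smul_zero a := Subtype.ext (smul_zero (MvPolynomial.C a : PolyRing A r))
  smul_add a m n := Subtype.ext (smul_add (MvPolynomial.C a : PolyRing A r) m.1 n.1)
  add_smul a b m := Subtype.ext (by
    change MvPolynomial.C (a + b) • m.1 = MvPolynomial.C a • m.1 + MvPolynomial.C b • m.1
    rw [map_add, add_smul])
  zero_smul m := Subtype.ext (by change MvPolynomial.C 0 • m.1 = 0; simp)

/-- The functor sending a graded module to its degree zero part, a module over `A`. -/
def degreeZero (A : Type u) [CommRing A] (r : ℕ) : GrMod A r ⥤ ModuleCat.{u} A where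
  obj M := ModuleCat.of A (M.deg 0)
  map {M N} f := ModuleCat.ofHom
    { toFun := fun m ↦ ⟨lin f m.1, lin_deg f m.2⟩
      map_add' := fun m n ↦ Subtype.ext (map_add (lin f) m.1 n.1)
      map_smul' := fun a m ↦ Subtype.ext (map_smul (lin f) (MvPolynomial.C a) m.1) }

instance : (degreeZero A r).PreservesZeroMorphisms where
  map_zero _ _ := rfl

end GrMod

/-- Sign conventions for total complexes of double complexes `C^{p,q}` with `p : ℕ`, `q : ℤ`:
the term of degree `n` is `⨁_{p + q = n} C^{p,q}`, the first differential
has sign `1` and the second one has sign `(-1) ^ p`. -/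
instance totalShape : TotalComplexShape (ComplexShape.up ℕ) (ComplexShape.up ℤ) (ComplexShape.up ℤ) where
  π i := i.1 + i.2
  ε₁ _ := 1
  ε₂ i := (-1) ^ i.1
  rel₁ {p p'} h q := by
    have : p + 1 = p' := h
    simp [← this]; ring
  rel₂ p {q q'} h := by
    have : q + 1 = q' := h
    simp [← this]; ring
  ε₂_ε₁ {p p' q q'} h _ := by
    have : p + 1 = p' := h
    simp [← this, pow_succ]

namespace GrMod
variable {A : Type u} [CommRing A] {r : ℕ}

/-- The double complex `C^{p,q} = Č^p_{≤ d}(M^q)` of graded modules. -/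
def cechBicomplex (d : ℕ) (M : CochainComplex (GrMod A r) ℤ) :
    HomologicalComplex₂ (GrMod A r) (ComplexShape.up ℕ) (ComplexShape.up ℤ) :=
  HomologicalComplex₂.flip (((cech A r d).mapHomologicalComplex (ComplexShape.up ℤ)).obj M)

/-- The degree zero part of a double complex of graded modules. -/
def bicomplexDegreeZero (C : HomologicalComplex₂ (GrMod A r) (ComplexShape.up ℕ) (ComplexShape.up ℤ)) :
    HomologicalComplex₂ (ModuleCat.{u} A) (ComplexShape.up ℕ) (ComplexShape.up ℤ) :=
  (((degreeZero A r).mapHomologicalComplex (ComplexShape.up ℤ)).mapHomologicalComplex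
    (ComplexShape.up ℕ)).obj C

/-- The degree zero part of the total complex of the double complex `Č^p_{≤ d}(M^q)`.
(Passing to the degree zero part commutes with the direct sums in the total complex, so
that it may be done first.) -/
def totCech (d : ℕ) (M : CochainComplex (GrMod A r) ℤ) : CochainComplex (ModuleCat.{u} A) ℤ :=
  (bicomplexDegreeZero (cechBicomplex d M)).total (ComplexShape.up ℤ)

end GrMod
/-! ### The sheaf associated with a graded module -/

instance stdGradedAlgebra (A : Type u) [CommRing A] (r : ℕ) : GradedAlgebra (stdGrading A r) :=
  MvPolynomial.gradedAlgebra

/-- Projective space `ℙ^r_A = Proj A[s₀, …, s_r]`. -/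
abbrev projSpace (A : Type u) [CommRing A] (r : ℕ) : Scheme.{u} := Proj (stdGrading A r)

/-- The projection `π : ℙ^r_A ⟶ Spec A`. -/
def projSpaceToSpec (A : Type u) [CommRing A] (r : ℕ) : projSpace A r ⟶ Spec (CommRingCat.of A) :=
  Proj.toSpecZero (stdGrading A r) ≫
    Spec.map (CommRingCat.ofHom (algebraMap A (stdGrading A r 0)))

namespace GrMod

open TopologicalSpace TopCat Opposite

variable {A : Type u} [CommRing A] {r : ℕ}

instance (x : ProjectiveSpectrum.top (stdGrading A r)) : x.asHomogeneousIdeal.toIdeal.IsPrime :=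
  x.isPrime

/-- The localization `M_𝔭` of a graded module at a homogeneous prime ideal `𝔭`. -/
abbrev locAt (M : GrMod A r) (x : ProjectiveSpectrum.top (stdGrading A r)) : Type u :=
  LocalizedModule x.asHomogeneousIdeal.toIdeal.primeCompl M

/-- A family of elements of the localizations `M_𝔭` is a (homogeneous) fraction if it is given by
`m / s` with `m ∈ M` and `s ∈ S` homogeneous of the same degree. -/
def IsFraction (M : GrMod A r) {U : Opens (ProjectiveSpectrum.top (stdGrading A r))}
    (f : ∀ x : U, M.locAt x.1) : Prop :=
  ∃ (n : ℕ) (m : M) (s : PolyRing A r), m ∈ M.deg n ∧ s ∈ stdGrading A r n ∧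
    ∀ x : U, ∃ hs : s ∉ x.1.asHomogeneousIdeal.toIdeal, f x = LocalizedModule.mk m ⟨s, hs⟩

/-- Families that are locally homogeneous fractions. -/
def isLocallyFraction (M : GrMod A r) : LocalPredicate M.locAt :=
  PrelocalPredicate.sheafify
    { pred := M.IsFraction
      res := by
        rintro U V i f ⟨n, m, s, hm, hs, h⟩
        exact ⟨n, m, s, hm, hs, fun x ↦ h (i x)⟩ }

/-- The scalar multiplication of `S_(𝔭)` on `M_𝔭`. -/
instance (M : GrMod A r) (x : ProjectiveSpectrum.top (stdGrading A r)) :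
    Module (HomogeneousLocalization.AtPrime (stdGrading A r) x.asHomogeneousIdeal.toIdeal)
      (M.locAt x) :=
  Module.compHom _ (algebraMap
    (HomogeneousLocalization.AtPrime (stdGrading A r) x.asHomogeneousIdeal.toIdeal)
    (Localization x.asHomogeneousIdeal.toIdeal.primeCompl))

lemma isLocallyFraction_add (M : GrMod A r) {U : Opens (ProjectiveSpectrum.top (stdGrading A r))}
    {f g : ∀ x : U, M.locAt x.1} (hf : M.isLocallyFraction.pred f)
    (hg : M.isLocallyFraction.pred g) : M.isLocallyFraction.pred (f + g) := by
  intro x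
  obtain ⟨V, hV, i, n, m, s, hm, hs, h⟩ := hf x
  obtain ⟨V', hV', i', n', m', s', hm', hs', h'⟩ := hg x
  refine ⟨V ⊓ V', ⟨hV, hV'⟩, Opens.infLELeft _ _ ≫ i, n + n', s' • m + s • m', s * s', ?_,
    SetLike.mul_mem_graded hs hs', fun y ↦ ?_⟩
  · refine AddSubgroup.add_mem _ ?_ ?_
    · have := M.smul_mem hs' hm
      convert this using 2
      push_cast; ring
    · have := M.smul_mem hs hm'
      convert this using 2
      push_cast; ring
  · obtain ⟨h1, e1⟩ := h ⟨y.1, y.2.1⟩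
    obtain ⟨h2, e2⟩ := h' ⟨y.1, y.2.2⟩
    exact ⟨y.1.asHomogeneousIdeal.toIdeal.primeCompl.mul_mem h1 h2,
      congr($e1 + $e2).trans (LocalizedModule.mk_add_mk ..)⟩

lemma isLocallyFraction_zero (M : GrMod A r)
    {U : Opens (ProjectiveSpectrum.top (stdGrading A r))} :
    M.isLocallyFraction.pred (0 : ∀ x : U, M.locAt x.1) := fun x ↦
  ⟨U, x.2, 𝟙 _, 0, 0, 1, AddSubgroup.zero_mem _, SetLike.one_mem_graded _, fun y ↦
    ⟨y.1.asHomogeneousIdeal.toIdeal.primeCompl.one_mem, (LocalizedModule.zero_mk _).symm⟩⟩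

lemma isLocallyFraction_neg (M : GrMod A r) {U : Opens (ProjectiveSpectrum.top (stdGrading A r))}
    {f : ∀ x : U, M.locAt x.1} (hf : M.isLocallyFraction.pred f) :
    M.isLocallyFraction.pred (-f) := by
  intro x
  obtain ⟨V, hV, i, n, m, s, hm, hs, h⟩ := hf x
  refine ⟨V, hV, i, n, -m, s, AddSubgroup.neg_mem _ hm, hs, fun y ↦ ?_⟩
  obtain ⟨h1, e1⟩ := h y
  exact ⟨h1, congr(-$e1).trans LocalizedModule.mk_neg.symm⟩

lemma isLocallyFraction_smul (M : GrMod A r) {U : Opens (ProjectiveSpectrum.top (stdGrading A r))}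
    (t : ∀ x : U, HomogeneousLocalization.AtPrime (stdGrading A r) x.1.asHomogeneousIdeal.toIdeal)
    (ht : (ProjectiveSpectrum.StructureSheaf.isLocallyFraction (stdGrading A r)).pred t)
    {f : ∀ x : U, M.locAt x.1} (hf : M.isLocallyFraction.pred f) :
    M.isLocallyFraction.pred (fun x ↦ t x • f x) := by
  intro x
  obtain ⟨V, hV, i, n, m, s, hm, hs, h⟩ := hf x
  obtain ⟨V', hV', i', n', a, b, hb, h'⟩ := ht x
  refine ⟨V ⊓ V', ⟨hV, hV'⟩, Opens.infLELeft _ _ ≫ i, n' + n, a.1 • m, b.1 * s, ?_,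
    SetLike.mul_mem_graded b.2 hs, fun y ↦ ?_⟩
  · have := M.smul_mem a.2 hm
    convert this using 2
    push_cast; ring
  · obtain ⟨h1, e1⟩ := h ⟨y.1, y.2.1⟩
    have e2 := h' ⟨y.1, y.2.2⟩
    exact ⟨y.1.asHomogeneousIdeal.toIdeal.primeCompl.mul_mem (hb ⟨y.1, y.2.2⟩) h1,
      congr($e2 • $e1).trans (LocalizedModule.mk_smul_mk ..)⟩

/-- The sections of the sheaf associated with `M` over an open subset. -/
def sections (M : GrMod A r) (U : Opens (ProjectiveSpectrum.top (stdGrading A r))) :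
    AddSubgroup (∀ x : U, M.locAt x.1) where
  carrier := {f | M.isLocallyFraction.pred f}
  zero_mem' := M.isLocallyFraction_zero
  add_mem' := M.isLocallyFraction_add
  neg_mem' := M.isLocallyFraction_neg

/-- The underlying abelian presheaf of the sheaf associated with `M`. -/
def tildeAb (M : GrMod A r) : TopCat.Presheaf Ab.{u} (ProjectiveSpectrum.top (stdGrading A r)) where
  obj U := AddCommGrpCat.of (M.sections U.unop)
  map {U V} i := AddCommGrpCat.ofHom
    { toFun := fun f ↦ ⟨fun x ↦ f.1 (i.unop x), M.isLocallyFraction.res i.unop f.1 f.2⟩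
      map_zero' := rfl
      map_add' := fun _ _ ↦ rfl }

/-- The action of the sections of the structure sheaf on the sections of the sheaf associated
with `M`. -/
instance sectionsModule (M : GrMod A r) (U : Opens (ProjectiveSpectrum.top (stdGrading A r))) :
    Module (ProjectiveSpectrum.StructureSheaf.sectionsSubring (𝒜 := stdGrading A r) (.op U))
      (M.sections U) where
  smul t f := ⟨fun x ↦ t.1 x • f.1 x, M.isLocallyFraction_smul t.1 t.2 f.2⟩
  one_smul f := Subtype.ext (funext fun x ↦ one_smul _ (f.1 x))
  mul_smul s t f := Subtype.ext (funext fun x ↦ mul_smul (s.1 x) (t.1 x) (f.1 x))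
  smul_zero t := Subtype.ext (funext fun x ↦ smul_zero (t.1 x))
  smul_add t f g := Subtype.ext (funext fun x ↦ smul_add (t.1 x) (f.1 x) (g.1 x))
  add_smul s t f := Subtype.ext (funext fun x ↦ add_smul (s.1 x) (t.1 x) (f.1 x))
  zero_smul f := Subtype.ext (funext fun x ↦ by
    with_unfolding_all exact zero_smul (HomogeneousLocalization.AtPrime (stdGrading A r)
      x.1.asHomogeneousIdeal.toIdeal) (f.1 x))

instance tildeAbModule (M : GrMod A r) (U : (projSpace A r).Opensᵒᵖ) :
    Module ((projSpace A r).ringCatSheaf.obj.obj U) (M.tildeAb.obj U) :=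
  M.sectionsModule U.unop

/-- The sheaf of modules on `ℙ^r_A` associated with a graded module `M`. -/
def tildeObj (M : GrMod A r) : (projSpace A r).Modules where
  val := PresheafOfModules.ofPresheaf (R := (projSpace A r).ringCatSheaf.obj) M.tildeAb
    fun U V i (t : (projSpace A r).ringCatSheaf.obj.obj U) (f : M.sections U.unop) ↦ by
      with_unfolding_all rfl
  isSheaf := (TopCat.Presheaf.isSheaf_iff_isSheaf_comp (forget Ab.{u}) _).2
    (subsheafToTypes M.isLocallyFraction).2

lemma isLocallyFraction_map {M N : GrMod A r} (φ : M ⟶ N)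
    {U : Opens (ProjectiveSpectrum.top (stdGrading A r))}
    {f : ∀ x : U, M.locAt x.1} (hf : M.isLocallyFraction.pred f) :
    N.isLocallyFraction.pred (fun x ↦ LocalizedModule.map _ (lin φ) (f x)) := by
  intro x
  obtain ⟨V, hV, i, n, m, s, hm, hs, h⟩ := hf x
  refine ⟨V, hV, i, n, lin φ m, s, lin_deg φ hm, hs, fun y ↦ ?_⟩
  obtain ⟨h1, e1⟩ := h y
  exact ⟨h1, congr(LocalizedModule.map _ (lin φ) $e1).trans (LocalizedModule.map_mk ..)⟩

/-- The map on sections of associated sheaves induced by a morphism of graded modules. -/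
def sectionsMap {M N : GrMod A r} (φ : M ⟶ N)
    (U : Opens (ProjectiveSpectrum.top (stdGrading A r))) : M.sections U →+ N.sections U where
  toFun f := ⟨fun x ↦ LocalizedModule.map _ (lin φ) (f.1 x), isLocallyFraction_map φ f.2⟩
  map_zero' := Subtype.ext (funext fun _ ↦ map_zero (LocalizedModule.map _ (lin φ)))
  map_add' f g := Subtype.ext (funext fun x ↦
    map_add (LocalizedModule.map _ (lin φ)) (f.1 x) (g.1 x))

lemma sectionsMap_smul {M N : GrMod A r} (φ : M ⟶ N)
    (U : Opens (ProjectiveSpectrum.top (stdGrading A r)))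
    (t : ProjectiveSpectrum.StructureSheaf.sectionsSubring (𝒜 := stdGrading A r) (.op U))
    (f : M.sections U) : sectionsMap φ U (t • f) = t • sectionsMap φ U f :=
  Subtype.ext (funext fun x ↦ by
    have := map_smul (LocalizedModule.map x.1.asHomogeneousIdeal.toIdeal.primeCompl (lin φ))
      (algebraMap (HomogeneousLocalization.AtPrime (stdGrading A r)
        x.1.asHomogeneousIdeal.toIdeal) (Localization _) (t.1 x)) (f.1 x)
    with_unfolding_all exact this)

/-- The map of abelian presheaves induced by a morphism of graded modules. -/
def tildeAbMap {M N : GrMod A r} (φ : M ⟶ N) : M.tildeAb ⟶ N.tildeAb where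
  app U := AddCommGrpCat.ofHom (sectionsMap φ U.unop)
  naturality _ _ _ := rfl

/-- The morphism of sheaves associated with a morphism of graded modules. -/
def tildeMap {M N : GrMod A r} (φ : M ⟶ N) : M.tildeObj ⟶ N.tildeObj where
  val := PresheafOfModules.homMk (M₁ := M.tildeObj.val) (M₂ := N.tildeObj.val) (tildeAbMap φ)
    fun U t f ↦ sectionsMap_smul φ U.unop t f

lemma sectionsMap_id (M : GrMod A r) (U : Opens (ProjectiveSpectrum.top (stdGrading A r)))
    (f : M.sections U) : sectionsMap (𝟙 M) U f = f :=
  Subtype.ext (funext fun _ ↦ DFunLike.congr_fun (LocalizedModule.map_id _) _)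

lemma sectionsMap_comp {M N P : GrMod A r} (φ : M ⟶ N) (ψ : N ⟶ P)
    (U : Opens (ProjectiveSpectrum.top (stdGrading A r))) (f : M.sections U) :
    sectionsMap (φ ≫ ψ) U f = sectionsMap ψ U (sectionsMap φ U f) :=
  Subtype.ext (funext fun x ↦ DFunLike.congr_fun
    (IsLocalizedModule.map_comp' x.1.asHomogeneousIdeal.toIdeal.primeCompl
      (LocalizedModule.mkLinearMap x.1.asHomogeneousIdeal.toIdeal.primeCompl M)
      (LocalizedModule.mkLinearMap x.1.asHomogeneousIdeal.toIdeal.primeCompl N)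
      (LocalizedModule.mkLinearMap x.1.asHomogeneousIdeal.toIdeal.primeCompl P) _ _) _)

lemma sectionsMap_zero (M N : GrMod A r) (U : Opens (ProjectiveSpectrum.top (stdGrading A r)))
    (f : M.sections U) : sectionsMap (0 : M ⟶ N) U f = 0 :=
  Subtype.ext (funext fun x ↦ DFunLike.congr_fun
    ((LocalizedModule.map x.1.asHomogeneousIdeal.toIdeal.primeCompl).map_zero) _)

/-- The functor `M ↦ M~` from graded `S`-modules to sheaves of modules on `ℙ^r_A`. -/
def tilde (A : Type u) [CommRing A] (r : ℕ) : GrMod A r ⥤ (projSpace A r).Modules where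
  obj M := M.tildeObj
  map φ := tildeMap φ
  map_id M := by
    ext U f
    exact sectionsMap_id M U f
  map_comp φ ψ := by
    ext U f
    exact sectionsMap_comp φ ψ U f

instance : (tilde A r).PreservesZeroMorphisms where
  map_zero M N := by
    ext U f
    exact sectionsMap_zero M N U f

end GrMod

/-- The functor sending an `A`-module to its associated sheaf of modules on `Spec A`. -/
def specTilde (A : Type u) [CommRing A] : ModuleCat.{u} A ⥤ (Spec (CommRingCat.of A)).Modules :=
  AlgebraicGeometry.tilde.functor (CommRingCat.of A)

instance specTilde_additive (A : Type u) [CommRing A] : (specTilde A).Additive := by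
  have h := fun R : CommRingCat.{u} ↦
    (inferInstance : (AlgebraicGeometry.tilde.functor R).Additive)
  exact h (CommRingCat.of A)

end

/-! Let 𝒞^p(F) be the sheaf U ↦ ∏_J F(U ∩ D₊(s_J)), where J runs over the increasing (p+1)-tuples of
indices. Augmented by F, the complex 𝒞^•(F) is exact, because over an open set inside D₊(s_i) the
insertion of the index i contracts it (`exists_cechDiff_eq`, `exists_cechAug_eq`). Hence M~^• is
quasi-isomorphic to the total complex of the bicomplex 𝒞^p(M~^q) (`quasiIso_toTotal`).

The sheaves 𝒞^p(M~^q) have no higher cohomology on the preimages of the basic open subsets of Spec A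
(`acyclicOn_fam_tilde`). Cohomology is Ext out of the extension by zero of the structure sheaf of an
open set. Classes of positive degree die locally, and Mayer–Vietoris together with an explicit
partition of unity (`exists_res_sub_res`) spreads the vanishing: the homogeneous h for which a class
dies on D₊(gh) are stable under homogeneous sums and multiples, hence include a power of g. Sheaves
with this vanishing form a class adapted to π_* (`isAdaptedTo_pushforward`), so Rπ_*(M~^•) is π_*
applied to the total complex.

Each π_* 𝒞^p(M~) is the sheaf associated with its global sections (`isLocalizing_pushforward_fam`),
and M ↦ M~ is exact on Spec A. What remains is algebra: the degree zero part of the truncated Čech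
complex must be compared with the complex of global sections, whose elements are families of
fractions of degree zero with powers of the s_J as denominators. The latter complex is the colimit
of the truncated ones, with transition maps multiplying numerators by s_J^e. So it is enough that
these transition maps are quasi-isomorphisms from level d on (`quasiIso_cechFrac`).

For S(-w) the Čech complex splits according to the exponent v ∈ ℤ^{r+1} of Laurent monomials, with ∑
v_j = -w. The truncation at d keeps the v with all v_j ≥ -d. If some v_j < -d and every entry were
negative, the sum would be at most -d-1-r < -w. So a discarded v has an entry v_i ≥ 0, and inserting
i contracts its part of the complex (`quasiIso_cechZeroTransition_free`). For general M, the five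
lemma is applied along 0 → ker ε → F → M → 0 for successive syzygies (`HasFreeSteps.epi_mono`). The
complexes vanish above degree r and each step gains one degree, so r+2 steps, that is the generators
in homological degrees 0, …, r+1, cover all degrees.

The case of a complex M^• follows because a map of bicomplexes with finitely many columns that is a
quasi-isomorphism for every fixed q is one on total complexes (`quasiIso_total_map`), and because
additive functors commute with such totals (`isIso_totalComparison`). -/

noncomputable section

/-! ### Total complexes of bicomplexes with finitely many columns -/

namespace HomologicalComplex₂

variable {C : Type*} [Category* C] [Preadditive C]
  (K L : HomologicalComplex₂ C (ComplexShape.up ℕ) (ComplexShape.up ℤ))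
  [K.HasTotal (ComplexShape.up ℤ)] [L.HasTotal (ComplexShape.up ℤ)]

lemma π_up (p : ℕ) (q : ℤ) :
    ComplexShape.π (ComplexShape.up ℕ) (ComplexShape.up ℤ) (ComplexShape.up ℤ) (p, q) = p + q := rfl

/-- The inclusion of the summand `(p, q)` in the total complex. -/
def inc (p : ℕ) (q n : ℤ) (h : p + q = n) :
    (K.X p).X q ⟶ (K.total (ComplexShape.up ℤ)).X n :=
  K.ιTotal (ComplexShape.up ℤ) p q n h

/-- The projection of the total complex to the summand `(p, q)`. -/
def proj (p : ℕ) (q n : ℤ) (h : p + q = n) :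
    (K.total (ComplexShape.up ℤ)).X n ⟶ (K.X p).X q :=
  K.totalDesc fun p' q' h' ↦ if hp : p' = p then
    (K.XXIsoOfEq _ _ _ hp (by rw [π_up] at h'; subst hp; omega)).hom else 0

@[simp]
lemma inc_proj_self (p : ℕ) (q n : ℤ) (h : p + q = n) : K.inc p q n h ≫ K.proj p q n h = 𝟙 _ := by
  simp [inc, proj]

@[simp]
lemma inc_proj_self_assoc (p : ℕ) (q n : ℤ) (h : p + q = n) {Z : C} (f : (K.X p).X q ⟶ Z) :
    K.inc p q n h ≫ K.proj p q n h ≫ f = f := by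
  rw [← Category.assoc, inc_proj_self, Category.id_comp]

lemma inc_proj_of_ne {p p' : ℕ} {q q' n : ℤ} (h : p + q = n) (h' : p' + q' = n) (hp : p ≠ p') :
    K.inc p q n h ≫ K.proj p' q' n h' = 0 := by
  simp [inc, proj, hp]

lemma inc_proj_of_ne_assoc {p p' : ℕ} {q q' n : ℤ} (h : p + q = n) (h' : p' + q' = n)
    (hp : p ≠ p') {Z : C} (f : (K.X p').X q' ⟶ Z) :
    K.inc p q n h ≫ K.proj p' q' n h' ≫ f = 0 ≫ f := by
  rw [← Category.assoc, K.inc_proj_of_ne h h' hp]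

variable {K} in
lemma total_hom_ext {A : C} {n : ℤ} {f g : (K.total (ComplexShape.up ℤ)).X n ⟶ A}
    (h : ∀ p q h, K.inc p q n h ≫ f = K.inc p q n h ≫ g) : f = g :=
  by
  apply total.hom_ext
  exact fun p q hi ↦ h p q hi

lemma inc_d (p : ℕ) (q n n' : ℤ) (h : p + q = n) (h' : n + 1 = n') :
    K.inc p q n h ≫ (K.total (ComplexShape.up ℤ)).d n n' =
      (K.d p (p + 1)).f q ≫ K.inc (p + 1) q n' (by push_cast; omega) +
      ((-1) ^ p : ℤˣ) • ((K.X p).d q (q + 1) ≫ K.inc p (q + 1) n' (by omega)) := by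
  rw [total_d, Preadditive.comp_add, inc, ι_D₁, ι_D₂,
    K.d₁_eq (ComplexShape.up ℤ) (show (ComplexShape.up ℕ).Rel p (p + 1) from rfl) q n'
      (by rw [π_up]; push_cast; omega),
    K.d₂_eq (ComplexShape.up ℤ) p (show (ComplexShape.up ℤ).Rel q (q + 1) from rfl) n'
      (by rw [π_up]; omega)]
  congr 1
  exact one_smul _ _

/-- The bicomplex vanishes in the columns `p > r`. -/
def BddBy (r : ℕ) : Prop := ∀ p, r < p → ∀ q, IsZero ((K.X p).X q)

variable {K}

/-- The total complex is a coproduct over all columns, which only controls morphisms out of it.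
Since only the columns 0, …, r are nonzero, each term is in fact a finite biproduct, and this
identity expresses it; morphisms into the total complex can then be tested on components as well. -/
lemma sum_proj_inc {r : ℕ} (hK : K.BddBy r) (n : ℤ) :
    ∑ p ∈ Finset.range (r + 1), K.proj p (n - p) n (by omega) ≫ K.inc p (n - p) n (by omega) =
      𝟙 _ := by
  refine total_hom_ext fun p q h ↦ ?_
  obtain rfl : q = n - p := by omega
  rw [Preadditive.comp_sum, Category.comp_id]
  by_cases hp : p < r + 1
  · rw [Finset.sum_eq_single p]
    · simp
    · intro p' _ hp'
      rw [inc_proj_of_ne_assoc _ _ _ hp'.symm, zero_comp]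
    · intro h'; exact absurd (Finset.mem_range.2 hp) h'
  · exact (hK p (by omega) _).eq_of_src _ _

lemma total_hom_ext' {r : ℕ} (hK : K.BddBy r) {A : C} {n : ℤ}
    {f g : A ⟶ (K.total (ComplexShape.up ℤ)).X n}
    (h : ∀ p q h, f ≫ K.proj p q n h = g ≫ K.proj p q n h) : f = g := by
  rw [← Category.comp_id f, ← Category.comp_id g, ← sum_proj_inc hK, Preadditive.comp_sum,
    Preadditive.comp_sum]
  exact Finset.sum_congr rfl fun p _ ↦ by rw [reassoc_of% h]

lemma d_proj_zero (q n n' : ℤ) (h : n + 1 = n') (hq : q + 1 = n') :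
    (K.total (ComplexShape.up ℤ)).d n n' ≫ K.proj 0 (q + 1) n' (by simpa using hq) =
      K.proj 0 q n (by push_cast; omega) ≫ (K.X 0).d q (q + 1) := by
  refine total_hom_ext fun p q' h' ↦ ?_
  rw [← Category.assoc, inc_d _ _ _ _ n' h' h, Preadditive.add_comp, Category.assoc,
    inc_proj_of_ne _ _ _ (by omega), comp_zero, zero_add]
  by_cases hp : p = 0
  · subst hp
    obtain rfl : q' = q := by push_cast at h'; omega
    simp
  · rw [inc_proj_of_ne_assoc _ _ _ hp, zero_comp, Linear.units_smul_comp, Category.assoc,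
      inc_proj_of_ne _ _ _ hp, comp_zero, smul_zero]

lemma d_proj_succ (p : ℕ) (q n n' : ℤ) (h : n + 1 = n') (hq : (p + 1 : ℕ) + (q + 1) = n') :
    (K.total (ComplexShape.up ℤ)).d n n' ≫ K.proj (p + 1) (q + 1) n' hq =
      K.proj p (q + 1) n (by push_cast at hq; omega) ≫ (K.d p (p + 1)).f (q + 1) +
      ((-1) ^ (p + 1) : ℤˣ) • (K.proj (p + 1) q n (by omega) ≫ (K.X (p + 1)).d q (q + 1)) := by
  refine total_hom_ext fun p' q' h' ↦ ?_
  rw [← Category.assoc, inc_d _ _ _ _ n' h' h, Preadditive.add_comp, Preadditive.comp_add,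
    Category.assoc, Linear.units_smul_comp, Linear.comp_units_smul, Category.assoc]
  congr 1
  · by_cases hp : p' = p
    · subst hp
      obtain rfl : q' = q + 1 := by push_cast at hq; omega
      simp
    · rw [inc_proj_of_ne _ _ _ (by omega), comp_zero, inc_proj_of_ne_assoc _ _ _ hp, zero_comp]
  · by_cases hp : p' = p + 1
    · subst hp
      obtain rfl : q' = q := by push_cast at hq h'; omega
      simp
    · rw [inc_proj_of_ne _ _ _ hp, comp_zero, inc_proj_of_ne_assoc _ _ _ hp, zero_comp, smul_zero,
        smul_zero]

variable {L}

lemma inc_map (φ : K ⟶ L) (p : ℕ) (q n : ℤ) (h : p + q = n) :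
    K.inc p q n h ≫ (total.map φ (ComplexShape.up ℤ)).f n = (φ.f p).f q ≫ L.inc p q n h :=
  by apply ιTotal_map

lemma inc_map_assoc (φ : K ⟶ L) (p : ℕ) (q n : ℤ) (h : p + q = n) {Z : C}
    (f : (L.total (ComplexShape.up ℤ)).X n ⟶ Z) :
    K.inc p q n h ≫ (total.map φ (ComplexShape.up ℤ)).f n ≫ f =
      (φ.f p).f q ≫ L.inc p q n h ≫ f := by
  rw [← Category.assoc, inc_map, Category.assoc]

lemma map_proj (φ : K ⟶ L) (p : ℕ) (q n : ℤ) (h : p + q = n) :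
    (total.map φ (ComplexShape.up ℤ)).f n ≫ L.proj p q n h = K.proj p q n h ≫ (φ.f p).f q := by
  refine total_hom_ext fun p' q' h' ↦ ?_
  rw [inc_map_assoc]
  by_cases hp : p' = p
  · subst hp
    obtain rfl : q' = q := by omega
    simp
  · rw [inc_proj_of_ne _ _ _ hp, comp_zero, inc_proj_of_ne_assoc _ _ _ hp, zero_comp]

end HomologicalComplex₂

/-! ### Additive functors and total complexes -/

namespace HomologicalComplex₂

variable {C D : Type*} [Category* C] [Preadditive C] [Category* D] [Preadditive D]
  (F : C ⥤ D) [F.Additive]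
  (K : HomologicalComplex₂ C (ComplexShape.up ℕ) (ComplexShape.up ℤ))

/-- The application of an additive functor to a bicomplex. -/
abbrev mapBicomplex : HomologicalComplex₂ D (ComplexShape.up ℕ) (ComplexShape.up ℤ) :=
  ((F.mapHomologicalComplex (ComplexShape.up ℤ)).mapHomologicalComplex (ComplexShape.up ℕ)).obj K

variable [K.HasTotal (ComplexShape.up ℤ)]

/-- The image of the inclusion of the summand `(p, q)`. -/
def mapInc (p : ℕ) (q n : ℤ) (h : p + q = n) : ((mapBicomplex F K).X p).X q ⟶
    ((F.mapHomologicalComplex (ComplexShape.up ℤ)).obj (K.total (ComplexShape.up ℤ))).X n :=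
  F.map (K.inc p q n h)

/-- The image of the projection to the summand `(p, q)`. -/
def mapProj (p : ℕ) (q n : ℤ) (h : p + q = n) :
    ((F.mapHomologicalComplex (ComplexShape.up ℤ)).obj (K.total (ComplexShape.up ℤ))).X n ⟶
    ((mapBicomplex F K).X p).X q :=
  F.map (K.proj p q n h)

lemma mapInc_mapProj (p : ℕ) (q n : ℤ) (h : p + q = n) :
    mapInc F K p q n h ≫ mapProj F K p q n h = 𝟙 _ :=
  (F.map_comp _ _).symm.trans ((congr_arg F.map (inc_proj_self _ _ _ _ _)).trans (F.map_id _))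

lemma mapInc_mapProj_assoc (p : ℕ) (q n : ℤ) (h : p + q = n) {Z : D}
    (f : ((mapBicomplex F K).X p).X q ⟶ Z) :
    mapInc F K p q n h ≫ mapProj F K p q n h ≫ f = f := by
  rw [← Category.assoc, mapInc_mapProj, Category.id_comp]

lemma mapInc_mapProj_of_ne {p p' : ℕ} {q q' n : ℤ} (h : p + q = n) (h' : p' + q' = n)
    (hp : p ≠ p') : mapInc F K p q n h ≫ mapProj F K p' q' n h' = 0 :=
  (F.map_comp _ _).symm.trans ((congr_arg F.map (inc_proj_of_ne _ _ _ hp)).trans (F.map_zero _ _))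

lemma mapInc_mapProj_of_ne_assoc {p p' : ℕ} {q q' n : ℤ} (h : p + q = n) (h' : p' + q' = n)
    (hp : p ≠ p') {Z : D} (f : ((mapBicomplex F K).X p').X q' ⟶ Z) :
    mapInc F K p q n h ≫ mapProj F K p' q' n h' ≫ f = 0 ≫ f := by
  rw [← Category.assoc, mapInc_mapProj_of_ne F K h h' hp]

lemma sum_mapProj_mapInc {r : ℕ} (hK : K.BddBy r) (n : ℤ) :
    ∑ p ∈ Finset.range (r + 1), mapProj F K p (n - p) n (by omega) ≫
      mapInc F K p (n - p) n (by omega) = 𝟙 _ := by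
  have := congr(F.map $(sum_proj_inc hK n))
  rw [F.map_sum, F.map_id] at this
  refine Eq.trans (Finset.sum_congr rfl fun p _ ↦ ?_) this
  exact (F.map_comp _ _).symm

lemma mapInc_d (p : ℕ) (q n n' : ℤ) (h : p + q = n) (h' : n + 1 = n') :
    mapInc F K p q n h ≫
      ((F.mapHomologicalComplex (ComplexShape.up ℤ)).obj (K.total (ComplexShape.up ℤ))).d n n' =
      ((mapBicomplex F K).d p (p + 1)).f q ≫ mapInc F K (p + 1) q n' (by push_cast; omega) +
      ((-1) ^ p : ℤˣ) • (((mapBicomplex F K).X p).d q (q + 1) ≫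
        mapInc F K p (q + 1) n' (by omega)) := by
  refine (F.map_comp _ _).symm.trans ((congr_arg F.map (inc_d K p q n n' h h')).trans ?_)
  rw [F.map_add, F.map_comp, F.map_units_smul, F.map_comp]
  rfl

variable [(mapBicomplex F K).HasTotal (ComplexShape.up ℤ)]

/-- The comparison morphism in a given degree. -/
def totalComparisonApp (n : ℤ) : ((mapBicomplex F K).total (ComplexShape.up ℤ)).X n ⟶
    ((F.mapHomologicalComplex (ComplexShape.up ℤ)).obj (K.total (ComplexShape.up ℤ))).X n :=
  (mapBicomplex F K).totalDesc fun p q h ↦ mapInc F K p q n h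

lemma inc_totalComparisonApp (p : ℕ) (q n : ℤ) (h : p + q = n) :
    (mapBicomplex F K).inc p q n h ≫ totalComparisonApp F K n = mapInc F K p q n h := by
  apply ι_totalDesc

lemma inc_totalComparisonApp_assoc (p : ℕ) (q n : ℤ) (h : p + q = n) {Z : D}
    (f : ((F.mapHomologicalComplex (ComplexShape.up ℤ)).obj
      (K.total (ComplexShape.up ℤ))).X n ⟶ Z) :
    (mapBicomplex F K).inc p q n h ≫ totalComparisonApp F K n ≫ f = mapInc F K p q n h ≫ f := by
  rw [← Category.assoc, inc_totalComparisonApp]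

/-- The canonical morphism comparing the total complex of the image of a bicomplex with the image
of the total complex. -/
def totalComparison : (mapBicomplex F K).total (ComplexShape.up ℤ) ⟶
    (F.mapHomologicalComplex (ComplexShape.up ℤ)).obj (K.total (ComplexShape.up ℤ)) where
  f n := totalComparisonApp F K n
  comm' n n' h := by
    refine total_hom_ext fun p q hpq ↦ ?_
    rw [← Category.assoc, ← Category.assoc, inc_totalComparisonApp, inc_d _ _ _ _ _ hpq h,
      Preadditive.add_comp, Category.assoc, Linear.units_smul_comp, Category.assoc,
      inc_totalComparisonApp, inc_totalComparisonApp, mapInc_d _ _ _ _ _ _ _ h]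

/-- An additive functor need not preserve the coproducts in a total complex, but it preserves the
identities between inclusions and projections of a finite biproduct. The bound on the columns
provides such identities, and the inverse is the sum of projections followed by inclusions. -/
lemma isIso_totalComparison {r : ℕ} (hK : K.BddBy r) : IsIso (totalComparison F K) := by
  have : ∀ n, IsIso ((totalComparison F K).f n) := fun n ↦ by
    refine ⟨∑ p ∈ Finset.range (r + 1), mapProj F K p (n - p) n (by omega) ≫
      (mapBicomplex F K).inc p (n - p) n (by omega), ?_, ?_⟩
    · change totalComparisonApp F K n ≫ _ = _
      refine total_hom_ext fun p q h ↦ ?_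
      obtain rfl : q = n - p := by omega
      rw [Preadditive.comp_sum, Preadditive.comp_sum, Category.comp_id]
      simp only [inc_totalComparisonApp_assoc]
      by_cases hp : p < r + 1
      · rw [Finset.sum_eq_single p]
        · rw [mapInc_mapProj_assoc]
        · intro p' _ hp'
          rw [mapInc_mapProj_of_ne_assoc _ _ _ _ hp'.symm, zero_comp]
        · intro h'; exact absurd (Finset.mem_range.2 hp) h'
      · exact (F.map_isZero (hK p (by omega) (n - p))).eq_of_src _ _
    · change _ ≫ totalComparisonApp F K n = _
      rw [Preadditive.sum_comp]
      simp only [Category.assoc, inc_totalComparisonApp]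
      exact sum_mapProj_mapInc F K hK n
  exact HomologicalComplex.Hom.isIso_of_components _

end HomologicalComplex₂

/-! ### Quasi-isomorphisms of total complexes -/

namespace HomologicalComplex₂

section single
variable {C : Type*} [Category* C] [Preadditive C] [HasZeroObject C]
  (F : CochainComplex C ℤ)

/-- A complex, as a bicomplex concentrated in the column `0`. -/
abbrev single₀ : HomologicalComplex₂ C (ComplexShape.up ℕ) (ComplexShape.up ℤ) :=
  (HomologicalComplex.single (CochainComplex C ℤ) (ComplexShape.up ℕ) 0).obj F

lemma single₀_bddBy : (single₀ F).BddBy 0 := fun p hp q ↦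
  (HomologicalComplex.eval C (ComplexShape.up ℤ) q).map_isZero
    (HomologicalComplex.isZero_single_obj_X (ComplexShape.up ℕ) 0 F p (by omega))

variable [(single₀ F).HasTotal (ComplexShape.up ℤ)]

/-- The isomorphism of a complex with the total complex of the associated bicomplex. -/
def toTotalSingle₀ : F ⟶ (single₀ F).total (ComplexShape.up ℤ) where
  f n := ((HomologicalComplex.singleObjXSelf (ComplexShape.up ℕ) 0 F).inv.f n) ≫
    (single₀ F).inc 0 n n (by simp)
  comm' n n' h := by
    obtain rfl : n + 1 = n' := h
    rw [Category.assoc, inc_d _ _ _ _ _ _ rfl, HomologicalComplex.single_obj_d,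
      HomologicalComplex.zero_f, zero_comp, zero_add, pow_zero, one_smul,
      HomologicalComplex.Hom.comm_assoc]

instance : IsIso (toTotalSingle₀ F) := by
  have : ∀ n, IsIso ((toTotalSingle₀ F).f n) := fun n ↦ by
    have : IsIso ((single₀ F).inc 0 n n (by simp)) := by
      refine ⟨(single₀ F).proj 0 n n (by simp), inc_proj_self _ _ _ _ _, ?_⟩
      have := sum_proj_inc (single₀_bddBy F) n
      rw [zero_add, Finset.sum_range_one] at this
      have h : ∀ m (h : (0 : ℕ) + m = n), m = n → (single₀ F).proj 0 m n h ≫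
          (single₀ F).inc 0 m n h = (single₀ F).proj 0 n n (by simp) ≫
          (single₀ F).inc 0 n n (by simp) := by rintro m h rfl; rfl
      rw [← h (n - (0 : ℕ)) (by simp) (by simp), this]
    dsimp only [toTotalSingle₀]
    infer_instance
  exact HomologicalComplex.Hom.isIso_of_components _

end single

section quasiIso
variable {C : Type*} [Category* C] [Abelian C]

/-- Injectivity on H^{p+1} and surjectivity on H^p are used together: x becomes a boundary in L, so
after refinement it is the boundary of some x₁; then y - f(x₁) is a cocycle and is homologous to the
image of a cocycle of K. The index j is left free because p = 0 has no predecessor; the differential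
from j to p is zero in that case. -/
lemma _root_.CochainComplex.exists_lift_of_quasiIso {K L : CochainComplex C ℕ} (f : K ⟶ L)
    [QuasiIso f] (p : ℕ) {A : C} (x : A ⟶ K.X (p + 1)) (y : A ⟶ L.X p)
    (hx : x ≫ K.d (p + 1) (p + 2) = 0) (hxy : x ≫ f.f (p + 1) = y ≫ L.d p (p + 1)) :
    ∃ (A' : C) (π : A' ⟶ A) (_ : Epi π) (j : ℕ) (x' : A' ⟶ K.X p) (y' : A' ⟶ L.X j),
      π ≫ x = x' ≫ K.d p (p + 1) ∧ π ≫ y = x' ≫ f.f p + y' ≫ L.d j p := by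
  have h1 : Mono (HomologicalComplex.homologyMap f (p + 1)) := inferInstance
  have h2 : Epi (HomologicalComplex.homologyMap f p) := inferInstance
  rw [HomologicalComplex.mono_homologyMap_iff_up_to_refinements f p (p + 1) (p + 2)
    (by simp) (by simp)] at h1
  rw [HomologicalComplex.epi_homologyMap_iff_up_to_refinements f _ p (p + 1)
    rfl (by simp)] at h2
  obtain ⟨A₁, π₁, _, x₁, hx₁⟩ := h1 x hx y hxy
  obtain ⟨A₂, π₂, _, x₂, hx₂, y₂, hy₂⟩ := h2 (π₁ ≫ y - x₁ ≫ f.f p) (by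
    rw [Preadditive.sub_comp, Category.assoc, ← hxy, Category.assoc, f.comm, ← Category.assoc,
      ← Category.assoc, hx₁, sub_self])
  refine ⟨A₂, π₂ ≫ π₁, inferInstance, _, π₂ ≫ x₁ + x₂, y₂, ?_, ?_⟩
  · rw [Category.assoc, hx₁, Preadditive.add_comp, hx₂, add_zero, Category.assoc]
  · rw [Preadditive.comp_sub, sub_eq_iff_eq_add] at hy₂
    rw [Category.assoc, hy₂, Preadditive.add_comp, Category.assoc]
    abel

/-- There are no boundaries in degree 0, so injectivity on cohomology is injectivity on cocycles. -/
lemma _root_.CochainComplex.eq_zero_of_quasiIso {K L : CochainComplex C ℕ} (f : K ⟶ L)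
    [QuasiIso f] {A : C} (x : A ⟶ K.X 0)
    (hx : x ≫ K.d 0 1 = 0) (hxy : x ≫ f.f 0 = 0) : x = 0 := by
  have h1 : Mono (HomologicalComplex.homologyMap f 0) := inferInstance
  rw [HomologicalComplex.mono_homologyMap_iff_up_to_refinements f 0 0 1
    (by simp) (by simp)] at h1
  obtain ⟨A₁, π₁, _, x₁, hx₁⟩ := h1 x hx 0 (by simp [hxy])
  rw [K.shape 0 0 (by simp), comp_zero] at hx₁
  exact (cancel_epi π₁).1 (by rw [hx₁, comp_zero])

variable {K L : HomologicalComplex₂ C (ComplexShape.up ℕ) (ComplexShape.up ℤ)}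
  [K.HasTotal (ComplexShape.up ℤ)] [L.HasTotal (ComplexShape.up ℤ)]

/-- The map induced by a morphism of bicomplexes on the complexes with fixed second index. -/
abbrev colMap (φ : K ⟶ L) (q : ℤ) : K.flip.X q ⟶ L.flip.X q :=
  ((flipFunctor C (ComplexShape.up ℕ) (ComplexShape.up ℤ)).map φ).f q

/-- The preceding lifting property for fixed second index is propagated to the total complex by
removing errors column by column, from the right to the left. The rightmost nonzero component of the
error is a cocycle for the first differential, so it can be lifted inside its row, and the second
differential of the correction only disturbs columns further to the left. -/
lemma exists_lift_total {r : ℕ} (hK : K.BddBy r) (hL : L.BddBy r) (φ : K ⟶ L)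
    (hφ : ∀ q, QuasiIso (colMap φ q)) {n₀ n₁ n₂ n₃ : ℤ} (h₀ : n₀ + 1 = n₁) (h₁ : n₁ + 1 = n₂)
    (h₂ : n₂ + 1 = n₃) {A : C}
    (x : A ⟶ (K.total (ComplexShape.up ℤ)).X n₂) (y : A ⟶ (L.total (ComplexShape.up ℤ)).X n₁)
    (hx : x ≫ (K.total (ComplexShape.up ℤ)).d n₂ n₃ = 0)
    (hxy : x ≫ (total.map φ (ComplexShape.up ℤ)).f n₂ =
      y ≫ (L.total (ComplexShape.up ℤ)).d n₁ n₂) :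
    ∃ (A' : C) (π : A' ⟶ A) (_ : Epi π) (x' : A' ⟶ (K.total (ComplexShape.up ℤ)).X n₁)
      (y' : A' ⟶ (L.total (ComplexShape.up ℤ)).X n₀),
      π ≫ x = x' ≫ (K.total (ComplexShape.up ℤ)).d n₁ n₂ ∧
      π ≫ y = x' ≫ (total.map φ (ComplexShape.up ℤ)).f n₁ +
        y' ≫ (L.total (ComplexShape.up ℤ)).d n₀ n₁ := by
  -- Descending induction on P. The error of x vanishes in the columns ≥ P and that of y in the
  -- columns ≥ P - 1, one column further, since the lift of x in column P lies in column P - 1.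
  -- Starting at P = r + 2 makes both conditions concern only the zero columns > r.
  have key : ∀ k P : ℕ, k + P = r + 2 →
      ∃ (A' : C) (π : A' ⟶ A) (_ : Epi π) (x' : A' ⟶ (K.total (ComplexShape.up ℤ)).X n₁)
      (y' : A' ⟶ (L.total (ComplexShape.up ℤ)).X n₀),
      (∀ p q h, P ≤ p →
        (π ≫ x - x' ≫ (K.total (ComplexShape.up ℤ)).d n₁ n₂) ≫ K.proj p q n₂ h = 0) ∧
      (∀ p q h, P ≤ p + 1 → (π ≫ y - (x' ≫ (total.map φ (ComplexShape.up ℤ)).f n₁ +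
        y' ≫ (L.total (ComplexShape.up ℤ)).d n₀ n₁)) ≫ L.proj p q n₁ h = 0) := by
    intro k
    induction k with
    | zero =>
      intro P hP
      exact ⟨A, 𝟙 _, inferInstance, 0, 0, fun p q h hp ↦ (hK p (by omega) q).eq_of_tgt _ _,
        fun p q h hp ↦ (hL p (by omega) q).eq_of_tgt _ _⟩
    | succ k ih =>
      intro P hP
      obtain ⟨A', π, _, x', y', hx', hy'⟩ := ih (P + 1) (by omega)
      set X := π ≫ x - x' ≫ (K.total (ComplexShape.up ℤ)).d n₁ n₂ with hX
      set Y := π ≫ y - (x' ≫ (total.map φ (ComplexShape.up ℤ)).f n₁ +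
        y' ≫ (L.total (ComplexShape.up ℤ)).d n₀ n₁) with hY
      have hXd : X ≫ (K.total (ComplexShape.up ℤ)).d n₂ n₃ = 0 := by
        simp [hX, hx]
      have hXY : X ≫ (total.map φ (ComplexShape.up ℤ)).f n₂ =
          Y ≫ (L.total (ComplexShape.up ℤ)).d n₁ n₂ := by
        simp [hX, hY, hxy]
      -- the component of `X` in the column `P` is a cocycle
      have hc : ∀ q (h : (P : ℤ) + q = n₂), (X ≫ K.proj P q n₂ h) ≫ (K.d P (P + 1)).f q = 0 := by
        intro q h
        have := congr($hXd ≫ K.proj (P + 1) (q - 1 + 1) n₃ (by push_cast; omega))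
        rw [Category.assoc, d_proj_succ _ _ _ _ h₂, zero_comp, Preadditive.comp_add,
          Linear.comp_units_smul, ← Category.assoc X, ← Category.assoc X, hx' (P + 1) _ _ le_rfl,
          zero_comp, smul_zero, add_zero] at this
        have e : ∀ q' (h' : (P : ℤ) + q' = n₂), q' = q →
            (X ≫ K.proj P q' n₂ h') ≫ (K.d P (P + 1)).f q' = 0 →
            (X ≫ K.proj P q n₂ h) ≫ (K.d P (P + 1)).f q = 0 := by
          rintro q' h' rfl h; exact h
        exact e _ _ (by omega) this
      obtain _ | P := P
      · have h0 : ∀ q (h : ((0 : ℕ) : ℤ) + q = n₂), X ≫ K.proj 0 q n₂ h = 0 := by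
          intro q h
          have := hφ q
          refine CochainComplex.eq_zero_of_quasiIso (colMap φ q) (X ≫ K.proj 0 q n₂ h) (hc q h) ?_
          change (X ≫ K.proj 0 q n₂ h) ≫ (φ.f 0).f q = 0
          rw [Category.assoc, ← map_proj, reassoc_of% hXY]
          obtain ⟨q, rfl⟩ : ∃ q', q = q' + 1 := ⟨q - 1, by omega⟩
          rw [d_proj_zero _ _ _ h₁ (by simpa using h), ← Category.assoc, hy' 0 _ _ le_rfl,
            zero_comp]
        refine ⟨A', π, inferInstance, x', y', fun p q h _ ↦ ?_, fun p q h _ ↦ hy' p q h (by omega)⟩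
        obtain _ | p := p
        · exact h0 q h
        · exact hx' _ q h (by omega)
      · obtain ⟨q, hq⟩ : ∃ q, P + q = n₁ := ⟨n₁ - P, by omega⟩
        have hq' : (P + 1 : ℕ) + q = n₂ := by push_cast; omega
        have := hφ q
        obtain ⟨A₁, π₁, _, j, a, b, ha, hb⟩ : ∃ (A₁ : C) (π₁ : A₁ ⟶ A') (_ : Epi π₁) (j : ℕ)
            (a : A₁ ⟶ (K.X P).X q) (b : A₁ ⟶ (L.X j).X q),
            π₁ ≫ X ≫ K.proj (P + 1) q n₂ hq' = a ≫ (K.d P (P + 1)).f q ∧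
            π₁ ≫ Y ≫ L.proj P q n₁ hq = a ≫ (φ.f P).f q + b ≫ (L.d j P).f q :=
          CochainComplex.exists_lift_of_quasiIso (colMap φ q)
          P (X ≫ K.proj (P + 1) q n₂ hq') (Y ≫ L.proj P q n₁ hq) (hc q hq') (by
            change (X ≫ K.proj (P + 1) q n₂ hq') ≫ (φ.f (P + 1)).f q =
              (Y ≫ L.proj P q n₁ hq) ≫ (L.d P (P + 1)).f q
            rw [Category.assoc, ← map_proj, reassoc_of% hXY]
            obtain ⟨q, rfl⟩ : ∃ q', q = q' + 1 := ⟨q - 1, by omega⟩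
            rw [d_proj_succ _ _ _ _ h₁, Preadditive.comp_add, Linear.comp_units_smul,
              ← Category.assoc Y (L.proj (P + 1) _ _ _), hy' (P + 1) _ _ (by omega), zero_comp,
              smul_zero, add_zero, Category.assoc])
        -- only the term from the column before `P` matters
        obtain ⟨Y', hY'₁, hY'₂⟩ : ∃ Y' : A₁ ⟶ (L.total (ComplexShape.up ℤ)).X n₀,
            (∀ p q h, P + 1 ≤ p → (Y' ≫ (L.total (ComplexShape.up ℤ)).d n₀ n₁) ≫
              L.proj p q n₁ h = 0) ∧
            (Y' ≫ (L.total (ComplexShape.up ℤ)).d n₀ n₁) ≫ L.proj P q n₁ hq =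
              b ≫ (L.d j P).f q := by
          by_cases hj : j + 1 = P
          · subst hj
            refine ⟨b ≫ L.inc j q n₀ (by push_cast at hq; omega), fun p q' h' hp ↦ ?_, ?_⟩
            · rw [Category.assoc b, inc_d _ _ _ _ _ _ h₀, Category.assoc, Preadditive.add_comp,
                Category.assoc, inc_proj_of_ne _ _ _ (by omega), Linear.units_smul_comp,
                Category.assoc, inc_proj_of_ne _ _ _ (by omega)]
              simp
            · rw [Category.assoc b, inc_d _ _ _ _ _ _ h₀, Category.assoc, Preadditive.add_comp,
                Category.assoc, inc_proj_self, Linear.units_smul_comp,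
                Category.assoc, inc_proj_of_ne _ _ _ (by omega)]
              simp
          · refine ⟨0, by simp, ?_⟩
            rw [L.shape_f j P (by simpa using hj)]
            simp
        -- The total differential of the correction a in column P has components in the columns P
        -- and P + 1 only, so in the columns beyond P it is exactly the error to be removed.
        have hia : ∀ p q' h, P + 1 ≤ p → (a ≫ K.inc P q n₁ hq ≫
            (K.total (ComplexShape.up ℤ)).d n₁ n₂) ≫ K.proj p q' n₂ h =
            π₁ ≫ X ≫ K.proj p q' n₂ h := by
          intro p q' h hp
          rw [inc_d _ _ _ _ _ _ h₁, Category.assoc, Preadditive.add_comp,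
            Linear.units_smul_comp, Category.assoc, Category.assoc]
          obtain rfl | hp := hp.eq_or_lt
          · obtain rfl : q' = q := by push_cast at h; omega
            rw [inc_proj_of_ne (p := P) (p' := P + 1) _ _ _ (by omega)]
            simp [ha]
          · rw [inc_proj_of_ne _ _ _ (by omega), inc_proj_of_ne _ _ _ (by omega),
              hx' p _ _ hp]
            simp
        refine ⟨A₁, π₁ ≫ π, inferInstance, π₁ ≫ x' + a ≫ K.inc P q n₁ hq, π₁ ≫ y' + Y', ?_, ?_⟩
        · intro p q' h hp
          have e : (π₁ ≫ π) ≫ x - (π₁ ≫ x' + a ≫ K.inc P q n₁ hq) ≫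
              (K.total (ComplexShape.up ℤ)).d n₁ n₂ = π₁ ≫ X - a ≫ K.inc P q n₁ hq ≫
              (K.total (ComplexShape.up ℤ)).d n₁ n₂ := by
            simp only [hX, Preadditive.comp_sub, Preadditive.add_comp, Category.assoc]
            abel
          rw [e, Preadditive.sub_comp, hia p q' h hp, Category.assoc, sub_self]
        · intro p q' h hp
          have e : (π₁ ≫ π) ≫ y - ((π₁ ≫ x' + a ≫ K.inc P q n₁ hq) ≫
              (total.map φ (ComplexShape.up ℤ)).f n₁ +
              (π₁ ≫ y' + Y') ≫ (L.total (ComplexShape.up ℤ)).d n₀ n₁) =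
              π₁ ≫ Y - a ≫ (φ.f P).f q ≫ L.inc P q n₁ hq -
              Y' ≫ (L.total (ComplexShape.up ℤ)).d n₀ n₁ := by
            simp only [hY, Preadditive.comp_sub, Preadditive.comp_add, Preadditive.add_comp,
              Category.assoc, inc_map]
            abel
          rw [e, Preadditive.sub_comp, Preadditive.sub_comp]
          obtain rfl | hp' := (show P ≤ p by omega).eq_or_lt
          · obtain rfl : q' = q := by omega
            rw [hY'₂, Category.assoc, hb]
            simp
          · rw [hY'₁ p q' h (by omega), Category.assoc, hy' p q' h (by omega), Category.assoc,
              Category.assoc, inc_proj_of_ne _ _ _ (by omega)]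
            simp
  obtain ⟨A', π, _, x', y', hx', hy'⟩ := key (r + 2) 0 rfl
  refine ⟨A', π, inferInstance, x', y', ?_, ?_⟩
  · rw [← sub_eq_zero]
    exact total_hom_ext' hK fun p q h ↦ by rw [hx' p q h (by omega), zero_comp]
  · rw [← sub_eq_zero]
    exact total_hom_ext' hL fun p q h ↦ by rw [hy' p q h (by omega), zero_comp]

/-- A morphism of bicomplexes with finitely many columns which is a quasi-isomorphism for every
fixed second index induces a quasi-isomorphism of total complexes. -/
lemma quasiIso_total_map {r : ℕ} (hK : K.BddBy r) (hL : L.BddBy r) (φ : K ⟶ L)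
    (hφ : ∀ q, QuasiIso (colMap φ q)) : QuasiIso (total.map φ (ComplexShape.up ℤ)) := by
  rw [quasiIso_iff]
  intro n
  rw [quasiIsoAt_iff_isIso_homologyMap]
  have h1 : Mono (HomologicalComplex.homologyMap (total.map φ (ComplexShape.up ℤ)) n) := by
    rw [HomologicalComplex.mono_homologyMap_iff_up_to_refinements _ (n - 1) n (n + 1)
      (by simp) (by simp)]
    intro A x hx y hxy
    obtain ⟨A', π, hπ, x', y', h, -⟩ := exists_lift_total hK hL φ hφ (n₀ := n - 2) (by omega)
      (by omega) rfl x y hx hxy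
    exact ⟨A', π, hπ, x', h⟩
  have h2 : Epi (HomologicalComplex.homologyMap (total.map φ (ComplexShape.up ℤ)) n) := by
    rw [HomologicalComplex.epi_homologyMap_iff_up_to_refinements _ (n - 1) n (n + 1)
      (by simp) (by simp)]
    intro A y hy
    -- Surjectivity on cohomology is the case x = 0 of the lifting property, where y is an arbitrary
    -- cocycle.
    obtain ⟨A', π, hπ, x', y', h, h'⟩ := exists_lift_total hK hL φ hφ (n₀ := n - 1) (by omega)
      rfl (n₃ := n + 2) (by omega) 0 y (by simp) (by simp [hy])
    exact ⟨A', π, hπ, x', by simpa using h.symm, y', h'⟩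
  exact isIso_of_mono_of_epi _

end quasiIso

end HomologicalComplex₂
end

/-! ### Classes of objects adapted to a functor, and derived functors -/

noncomputable section

namespace HomologicalComplex

/-- The short complex `Z^n ⟶ K^n ⟶ Z^{n+1}`. -/
abbrev cyclesShortComplex {C : Type*} [Category* C] [Abelian C] (K : CochainComplex C ℤ) (n : ℤ) :
    ShortComplex C where
  f := K.iCycles n
  g := K.toCycles n (n + 1)
  zero := by simp [← cancel_mono (K.iCycles (n + 1))]

lemma cyclesShortComplex_shortExact {C : Type*} [Category* C] [Abelian C]
    (K : CochainComplex C ℤ) (n : ℤ) (hK : K.ExactAt (n + 1)) :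
    (cyclesShortComplex K n).ShortExact where
  exact := by
    rw [ShortComplex.exact_iff_exact_up_to_refinements]
    intro T x hx
    refine ⟨T, 𝟙 _, inferInstance, K.liftCycles x (n + 1) (by simp) ?_, ?_⟩
    · have := congr($hx ≫ K.iCycles (n + 1))
      simpa using this
    · simp
  mono_f := by dsimp; infer_instance
  epi_g := by
    rw [epi_iff_surjective_up_to_refinements]
    intro T (y : T ⟶ K.cycles (n + 1))
    have := K.exactAt_iff' n (n + 1) (n + 2) (by simp) (by simp; ring)
    rw [this, ShortComplex.exact_iff_exact_up_to_refinements] at hK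
    obtain ⟨T', π, hπ, x, hx⟩ := hK (y ≫ K.iCycles (n + 1))
      (show (y ≫ K.iCycles (n + 1)) ≫ K.d (n + 1) (n + 2) = 0 by
        rw [Category.assoc, K.iCycles_d, comp_zero])
    refine ⟨T', π, hπ, x, ?_⟩
    change T' ⟶ K.X n at x
    change π ≫ y = x ≫ K.toCycles n (n + 1)
    rw [← cancel_mono (K.iCycles (n + 1)), Category.assoc, Category.assoc, K.toCycles_i]
    exact hx

end HomologicalComplex

namespace CategoryTheory

/-- A class of objects with the formal properties of the acyclic objects for the
right derived functors of `F`. -/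
structure ObjectProperty.IsAdaptedTo {C D : Type*} [Category* C] [Category* D]
    [Abelian C] [Abelian D] (P : ObjectProperty C) (F : C ⥤ D) [F.Additive] : Prop where
  of_injective (I : C) [Injective I] : P I
  of_iso {X Y : C} (e : X ≅ Y) : P X → P Y
  biprod {X Y : C} : P X → P Y → P (X ⊞ Y)
  shortExact_map (S : ShortComplex C) : S.ShortExact → P S.X₁ → (S.map F).ShortExact
  of_shortExact (S : ShortComplex C) : S.ShortExact → P S.X₁ → P S.X₂ → P S.X₃

namespace ObjectProperty.IsAdaptedTo

variable {C D : Type*} [Category* C] [Category* D]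
    [Abelian C] [Abelian D] {P : ObjectProperty C} {F : C ⥤ D} [F.Additive]
    (hP : P.IsAdaptedTo F)
include hP

lemma of_isZero {X : C} (hX : IsZero X) : P X :=
  have : Injective X := ⟨fun _ _ _ ↦ ⟨0, hX.eq_of_tgt _ _⟩⟩
  hP.of_injective X

/-- An acyclic complex breaks up into the short exact sequences Z^n → K^n → Z^{n+1}. The cycles
vanish below a, so going upwards they all lie in P; therefore F keeps each of these sequences exact,
and the images splice to an exact complex. -/
lemma acyclic_map (K : CochainComplex C ℤ) (a : ℤ) [K.IsStrictlyGE a] (hK : K.Acyclic)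
    (hKP : ∀ n, P (K.X n)) : ((F.mapHomologicalComplex (ComplexShape.up ℤ)).obj K).Acyclic := by
  have hS (n : ℤ) := HomologicalComplex.cyclesShortComplex_shortExact K n (hK (n + 1))
  have hcyc (n : ℤ) : P (K.cycles n) := by
    by_cases hn : n < a
    · exact hP.of_isZero ((K.isZero_of_isStrictlyGE a n hn).of_mono (K.iCycles n))
    · push Not at hn
      induction n, hn using Int.le_induction with
      | base =>
        have := hP.of_shortExact _ (hS (a - 1))
          (hP.of_isZero ((K.isZero_of_isStrictlyGE a (a - 1) (by lia)).of_mono (K.iCycles _)))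
          (hKP _)
        simpa using this
      | succ n _ ih => exact hP.of_shortExact _ (hS n) ih (hKP _)
  have hFS (n : ℤ) := hP.shortExact_map _ (hS n) (hcyc n)
  intro n
  obtain ⟨n, rfl⟩ : ∃ m, n = m + 1 := ⟨n - 1, by simp⟩
  rw [HomologicalComplex.exactAt_iff' _ n (n + 1) (n + 1 + 1) (by simp) (by simp),
    ShortComplex.exact_iff_exact_up_to_refinements]
  intro T (x : T ⟶ F.obj (K.X (n + 1))) (hx : x ≫ F.map (K.d (n + 1) (n + 1 + 1)) = 0)
  have : Mono (F.map (K.iCycles (n + 1 + 1))) := (hFS (n + 1 + 1)).mono_f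
  have hx' : x ≫ F.map (K.toCycles (n + 1) (n + 1 + 1)) = 0 := by
    rw [← cancel_mono (F.map (K.iCycles (n + 1 + 1))), Category.assoc, ← F.map_comp,
      K.toCycles_i, hx, zero_comp]
  obtain ⟨T₁, π₁, _, y, hy⟩ := (hFS (n + 1)).exact.exact_up_to_refinements x hx'
  have hepi : Epi (F.map (K.toCycles n (n + 1))) := (hFS n).epi_g
  obtain ⟨T₂, π₂, _, z, hz⟩ := surjective_up_to_refinements_of_epi (F.map (K.toCycles n (n + 1))) y
  refine ⟨T₂, π₂ ≫ π₁, inferInstance, z, ?_⟩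
  change T₁ ⟶ F.obj (K.cycles (n + 1)) at y
  change π₁ ≫ x = y ≫ F.map (K.iCycles (n + 1)) at hy
  change (π₂ ≫ π₁) ≫ x = z ≫ F.map (K.d n (n + 1))
  have hz' := congr($hz ≫ F.map (K.iCycles (n + 1)))
  rw [Category.assoc, Category.assoc, ← F.map_comp, K.toCycles_i] at hz'
  rw [Category.assoc, hy, hz']

end ObjectProperty.IsAdaptedTo

end CategoryTheory

lemma CochainComplex.quasiIso_iff_acyclic_mappingCone {C : Type*} [Category* C] [Abelian C]
    {K L : CochainComplex C ℤ} (f : K ⟶ L) :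
    QuasiIso f ↔ (mappingCone f).Acyclic := by
  rw [← HomotopyCategory.quotient_obj_mem_subcategoryAcyclic_iff_acyclic,
    ← HomologicalComplex.mem_quasiIso_iff, ← HomotopyCategory.quotient_map_mem_quasiIso_iff,
    HomotopyCategory.quasiIso_eq_trW_subcategoryAcyclic]
  exact (HomotopyCategory.subcategoryAcyclic C).trW_iff_of_distinguished _
    (HomotopyCategory.mappingCone_triangleh_distinguished f)

namespace CategoryTheory.ObjectProperty.IsAdaptedTo
variable {C D : Type*} [Category* C] [Category* D]
    [Abelian C] [Abelian D] {P : ObjectProperty C} {F : C ⥤ D} [F.Additive]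
    (hP : P.IsAdaptedTo F)
include hP

/-- The mapping cone of f is acyclic and bounded below, its terms are biproducts of terms of K and
L, and F commutes with the formation of the cone. -/
lemma quasiIso_map {K L : CochainComplex C ℤ} (f : K ⟶ L) (a : ℤ) [K.IsStrictlyGE a]
    [L.IsStrictlyGE a] (hK : ∀ n, P (K.X n)) (hL : ∀ n, P (L.X n)) [QuasiIso f] :
    QuasiIso ((F.mapHomologicalComplex (ComplexShape.up ℤ)).map f) := by
  rw [CochainComplex.quasiIso_iff_acyclic_mappingCone]
  have := CochainComplex.isStrictlyGE_mappingCone f a a (a - 1)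
  have h := hP.acyclic_map (CochainComplex.mappingCone f) (a - 1)
    ((CochainComplex.quasiIso_iff_acyclic_mappingCone f).1 inferInstance)
    (fun n ↦ hP.of_iso (HomologicalComplex.homotopyCofiber.XIsoBiprod f n (n + 1) rfl).symm
      (hP.biprod (hK _) (hL _)))
  rw [← HomotopyCategory.quotient_obj_mem_subcategoryAcyclic_iff_acyclic] at h ⊢
  exact ObjectProperty.prop_of_iso _ ((HomotopyCategory.quotient _ _).mapIso
    (CochainComplex.mappingCone.mapHomologicalComplexIso f F)) h

end CategoryTheory.ObjectProperty.IsAdaptedTo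

section
variable {C : Type*} [Category* C] [Abelian C] [HasDerivedCategory C]

lemma DerivedCategory.Plus.isIso_Q_map {K L : CochainComplex.Plus C} (f : K ⟶ L)
    (hf : QuasiIso f.hom) : IsIso (DerivedCategory.Plus.Q.map f) := by
  refine Localization.inverts DerivedCategory.Plus.Qh (HomotopyCategory.Plus.quasiIso C)
    ((HomotopyCategory.Plus.quotient C).map f) ?_
  rw [HomotopyCategory.Plus.quasiIso_iff]
  exact (HomotopyCategory.quotient_map_mem_quasiIso_iff f.hom).2 hf

/-- Complexes of adapted objects compute the right derived functor. -/
lemma CategoryTheory.ObjectProperty.IsAdaptedTo.nonempty_rightDerivedFunctorPlus_iso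
    {D : Type*} [Category* D] [Abelian D] [HasDerivedCategory D] [EnoughInjectives C]
    {P : ObjectProperty C} {F : C ⥤ D} [F.Additive] (hP : P.IsAdaptedTo F)
    (L : CochainComplex.Plus C) (hL : ∀ n, P (L.obj.X n)) :
    Nonempty (F.rightDerivedFunctorPlus.obj (DerivedCategory.Plus.Q.obj L) ≅
      DerivedCategory.Plus.Q.obj (F.mapCochainComplexPlus.obj L)) := by
  obtain ⟨a, ha⟩ : ∃ a, L.obj.IsStrictlyGE a := L.property
  obtain ⟨I, hI, i, hi⟩ := CochainComplex.Plus.exists_quasiIso_injective L a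
  have hi' : QuasiIso i.hom := hi
  have h1 := DerivedCategory.Plus.isIso_Q_map i hi'
  let I' := (InjectiveObject.ι C).mapCochainComplexPlus.obj I
  have hI' : I'.obj.IsStrictlyGE a := by
    rw [CochainComplex.isStrictlyGE_iff] at hI ⊢
    intro j hj
    exact (InjectiveObject.ι C).map_isZero (hI j hj)
  -- Injective objects are adapted too, so F may be applied to the injective replacement of L
  -- without losing the quasi-isomorphism. On the injective complex the derived functor is F itself.
  have h2 : QuasiIso (F.mapCochainComplexPlus.map i).hom :=
    hP.quasiIso_map i.hom a hL
      (fun n ↦ have : Injective (I'.obj.X n) := (I.obj.X n).property; hP.of_injective _)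
  have h3 := DerivedCategory.Plus.isIso_Q_map _ h2
  exact ⟨F.rightDerivedFunctorPlus.mapIso (asIso (DerivedCategory.Plus.Q.map i)) ≪≫
    (asIso (F.rightDerivedFunctorPlusUnit.app
      ((HomotopyCategory.Plus.quotient C).obj I'))).symm ≪≫
    (asIso (DerivedCategory.Plus.Q.map (F.mapCochainComplexPlus.map i))).symm⟩

end
end

/-! ### Sections of sheaves of modules and local criteria -/

noncomputable section

namespace AlgebraicGeometry.Scheme.Modules

open TopologicalSpace Opposite

variable {X : Scheme.{u}}

/-- The underlying sheaf of abelian groups. -/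
def toAbSheaf (X : Scheme.{u}) : X.Modules ⥤ TopCat.Sheaf Ab.{u} X :=
  SheafOfModules.toSheaf X.ringCatSheaf

/-- Up to the counit isomorphisms, f' is the sheafification of a map g of presheaves. Factor g
through its image: the inclusion of the image becomes both mono and epi, hence invertible, after
sheafification. The other factor is an epimorphism of presheaves, and its sheafification can be
computed on the underlying abelian groups. -/
lemma epi_toSheaf_map {F G : SheafOfModules.{u} X.ringCatSheaf} (f' : F ⟶ G) [hf' : Epi f'] :
    Epi ((SheafOfModules.toSheaf X.ringCatSheaf).map f') := by
    let adj := PresheafOfModules.sheafificationAdjunction (𝟙 X.ringCatSheaf.obj)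
    let L := PresheafOfModules.sheafification (𝟙 X.ringCatSheaf.obj)
    let R : SheafOfModules.{u} X.ringCatSheaf ⥤ _root_.PresheafOfModules.{u} X.ringCatSheaf.obj :=
      SheafOfModules.forget X.ringCatSheaf ⋙ PresheafOfModules.restrictScalars (𝟙 _)
    have hc (H : SheafOfModules.{u} X.ringCatSheaf) : IsIso (adj.counit.app H) := by
      have : IsIso (PresheafOfModules.sheafificationAdjunction.{u}
        (𝟙 X.ringCatSheaf.obj)).counit := inferInstance
      exact inferInstanceAs (IsIso ((PresheafOfModules.sheafificationAdjunction.{u}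
        (𝟙 X.ringCatSheaf.obj)).counit.app H))
    let e (H : SheafOfModules.{u} X.ringCatSheaf) : L.obj (R.obj H) ≅ H :=
      @asIso _ _ _ _ (adj.counit.app H) (hc H)
    let g := R.map f'
    have key : Epi ((SheafOfModules.toSheaf X.ringCatSheaf).map (L.map g)) := by
      have e1 : L.map g = L.map (factorThruImage g) ≫ L.map (image.ι g) := by
        rw [← L.map_comp, image.fac]
      have h1 : Epi (L.map g) := by
        have : L.map g = (e F).hom ≫ f' ≫ (e G).inv := by
          rw [← Category.assoc, Iso.eq_comp_inv]
          exact adj.counit.naturality f'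
        rw [this]; infer_instance
      have h2 : Epi (L.map (image.ι g)) := by
        rw [e1] at h1; exact epi_of_epi (L.map (factorThruImage g)) _
      have h3 : IsIso (L.map (image.ι g)) := isIso_of_mono_of_epi _
      have h5 : Epi ((PresheafOfModules.toPresheaf X.ringCatSheaf.obj).map (factorThruImage g)) :=
        inferInstance
      have h6 : (presheafToSheaf (Opens.grothendieckTopology X) AddCommGrpCat.{u}).IsLeftAdjoint :=
        inferInstance
      have h4 : Epi ((SheafOfModules.toSheaf X.ringCatSheaf).map (L.map (factorThruImage g))) :=
        (presheafToSheaf (Opens.grothendieckTopology X) AddCommGrpCat.{u}).map_epi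
          ((PresheafOfModules.toPresheaf _).map (factorThruImage g))
      rw [e1, Functor.map_comp]
      infer_instance
    have he : f' = (e F).inv ≫ L.map g ≫ (e G).hom := by
      rw [Iso.eq_inv_comp]; exact (adj.counit.naturality f').symm
    rw [he, Functor.map_comp, Functor.map_comp]
    infer_instance

instance : (toAbSheaf X).PreservesEpimorphisms where
  preserves {F G} f hf := epi_toSheaf_map (F := F) (G := G) f (hf' := hf)

instance : (toAbSheaf X).Faithful :=
  inferInstanceAs (SheafOfModules.toSheaf X.ringCatSheaf).Faithful

/-- Restriction of sections. -/
def res (F : X.Modules) {U V : X.Opens} (h : V ≤ U) : Γ(F, U) →+ Γ(F, V) :=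
  (F.presheaf.map (homOfLE h).op).hom

lemma res_res (F : X.Modules) {U V W : X.Opens} (h : V ≤ U) (h' : W ≤ V) (s : Γ(F, U)) :
    F.res h' (F.res h s) = F.res (h'.trans h) s := by
  change (F.presheaf.map _ ≫ F.presheaf.map _).hom s = _
  rw [← F.presheaf.map_comp]; rfl

@[simp] lemma res_self (F : X.Modules) {U : X.Opens} (h : U ≤ U) (s : Γ(F, U)) :
    F.res h s = s := by
  change (F.presheaf.map (𝟙 _)).hom s = _
  rw [F.presheaf.map_id]; rfl

/-- The map on sections induced by a morphism. -/
def sec {F G : X.Modules} (f : F ⟶ G) (U : X.Opens) : Γ(F, U) →+ Γ(G, U) := (f.app U).hom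

lemma sec_comp {F G H : X.Modules} (f : F ⟶ G) (g : G ⟶ H) {U : X.Opens} (s : Γ(F, U)) :
    sec (f ≫ g) U s = sec g U (sec f U s) := rfl
@[simp] lemma sec_id {F : X.Modules} {U : X.Opens} (s : Γ(F, U)) :
    sec (𝟙 F) U s = s := rfl
@[simp] lemma sec_zero {F G : X.Modules} {U : X.Opens} (s : Γ(F, U)) :
    sec (0 : F ⟶ G) U s = 0 := rfl
lemma sec_add {F G : X.Modules} (f g : F ⟶ G) {U : X.Opens} (s : Γ(F, U)) :
    sec (f + g) U s = sec f U s + sec g U s := rfl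

lemma sec_res {F G : X.Modules} (f : F ⟶ G) {U V : X.Opens} (h : V ≤ U) (s : Γ(F, U)) :
    sec f V (F.res h s) = G.res h (sec f U s) :=
  ConcreteCategory.congr_hom (f.mapPresheaf.naturality (homOfLE h).op) s

lemma hom_ext_sec {F G : X.Modules} {f g : F ⟶ G} (h : ∀ U s, sec f U s = sec g U s) : f = g :=
  hom_ext _ _ fun U ↦ by ext s; exact h U s

/-- Passing to abelian sheaves preserves epimorphisms and, being faithful, reflects them; for
abelian sheaves they are the locally surjective maps. -/
lemma epi_iff_locally_surjective {F G : X.Modules} (f : F ⟶ G) :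
    Epi f ↔ ∀ (U : X.Opens) (s : Γ(G, U)), ∀ x ∈ U, ∃ (V : X.Opens) (hV : V ≤ U), x ∈ V ∧
      ∃ t : Γ(F, V), sec f V t = G.res hV s := by
  have : Epi f ↔ Epi ((toAbSheaf X).map f) :=
    ⟨fun _ ↦ inferInstance, fun h ↦ (toAbSheaf X).epi_of_epi_map h⟩
  rw [this, ← TopCat.Sheaf.isLocallySurjective_iff_epi, TopCat.Presheaf.isLocallySurjective_iff]
  constructor
  · intro h U s x hx
    obtain ⟨V, hV, ⟨t, ht⟩, hx⟩ := h U s x hx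
    exact ⟨V, hV, hx, t, ht⟩
  · intro h U s x hx
    obtain ⟨V, hV, hx, t, ht⟩ := h U s x hx
    exact ⟨V, hV, ⟨t, ht⟩, hx⟩

lemma eq_of_locally_eq (F : X.Modules) {U : X.Opens} (s t : Γ(F, U))
    (h : ∀ x ∈ U, ∃ (V : X.Opens) (hV : V ≤ U), x ∈ V ∧ F.res hV s = F.res hV t) : s = t := by
  choose V hV hx e using fun x : U ↦ h x.1 x.2
  refine TopCat.Sheaf.eq_of_locally_eq' ⟨F.presheaf, F.isSheaf⟩ V U (fun x ↦ homOfLE (hV x))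
    (fun x hx' ↦ Opens.mem_iSup.2 ⟨⟨x, hx'⟩, hx _⟩) s t e

lemma mono_iff_injective {F G : X.Modules} (f : F ⟶ G) :
    Mono f ↔ ∀ U, Function.Injective (sec f U) := by
  constructor
  · intro hf U
    have : Mono ((toPresheaf X).map f) := inferInstance
    have := (NatTrans.mono_iff_mono_app ((toPresheaf X).map f)).1 this (op U)
    exact (AddCommGrpCat.mono_iff_injective _).1 this
  · intro h
    have : Mono ((toPresheaf X).map f) := by
      rw [NatTrans.mono_iff_mono_app]
      exact fun U ↦ (AddCommGrpCat.mono_iff_injective _).2 (h U.unop)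
    exact (toPresheaf X).mono_of_mono_map this

lemma gluing (F : X.Modules) {U V : X.Opens} (s : Γ(F, U)) (t : Γ(F, V))
    (h : F.res (inf_le_left : U ⊓ V ≤ U) s = F.res inf_le_right t) :
    ∃ z : Γ(F, U ⊔ V), F.res le_sup_left z = s ∧ F.res le_sup_right z = t := by
  obtain ⟨z, hz, -⟩ := TopCat.Sheaf.existsUnique_gluing' ⟨F.presheaf, F.isSheaf⟩
    (fun b : ULift.{u} Bool ↦ if b.down then U else V) (U ⊔ V)
    (fun b ↦ homOfLE (by split_ifs; exacts [le_sup_left, le_sup_right]))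
    (by
      rw [sup_le_iff]
      exact ⟨le_iSup (fun b : ULift.{u} Bool ↦ if b.down then U else V) ⟨true⟩,
        le_iSup (fun b : ULift.{u} Bool ↦ if b.down then U else V) ⟨false⟩⟩)
    (fun b ↦ match b with
      | ⟨true⟩ => s
      | ⟨false⟩ => t)
    (by
      rintro ⟨_ | _⟩ ⟨_ | _⟩
      · rfl
      · have := congr(F.res (le_inf inf_le_right inf_le_left : V ⊓ U ≤ U ⊓ V) $h)
        rw [res_res, res_res] at this
        exact this.symm
      · exact h
      · rfl)
  exact ⟨z, hz ⟨true⟩, hz ⟨false⟩⟩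

lemma exact_of_locally (S : ShortComplex X.Modules)
    (h : ∀ (U : X.Opens) (s : Γ(S.X₂, U)), sec S.g U s = 0 → ∀ x ∈ U,
      ∃ (V : X.Opens) (hV : V ≤ U), x ∈ V ∧ ∃ t : Γ(S.X₁, V), sec S.f V t = S.X₂.res hV s) :
    S.Exact := by
  have : Epi (kernel.lift S.g S.f S.zero) := by
    rw [epi_iff_locally_surjective]
    intro U s x hx
    obtain ⟨V, hV, hx, t, ht⟩ := h U (sec (kernel.ι _) U s) (by
      rw [← sec_comp, kernel.condition]; rfl) x hx
    refine ⟨V, hV, hx, t, (mono_iff_injective (kernel.ι S.g)).1 inferInstance V ?_⟩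
    rw [← sec_comp, kernel.lift_ι, ht, sec_res]
  exact (S.exact_iff_epi_kernel_lift).2 this

end AlgebraicGeometry.Scheme.Modules
end

/-! ### Cohomology as Ext, and Mayer–Vietoris -/

noncomputable section

namespace AlgebraicGeometry.Scheme.Modules

open TopologicalSpace Opposite

variable {X : Scheme.{u}}

/-- The extension by zero of the structure sheaf of `U`: it corepresents the sections over `U`. -/
def extZero (X : Scheme.{u}) : X.Opens ⥤ X.Modules :=
  (yoneda ⋙ PresheafOfModules.free X.ringCatSheaf.obj ⋙
    PresheafOfModules.sheafification (𝟙 X.ringCatSheaf.obj) :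
      X.Opens ⥤ SheafOfModules.{u} X.ringCatSheaf)

/-- Morphisms out of `extZero X U` are the sections over `U`. -/
def extZeroEquiv (F : X.Modules) (U : X.Opens) : ((extZero X).obj U ⟶ F) ≃ Γ(F, U) :=
  ((PresheafOfModules.sheafificationAdjunction (𝟙 X.ringCatSheaf.obj)).homEquiv _ _).trans
    PresheafOfModules.freeYonedaEquiv

lemma extZeroEquiv_comp {F G : X.Modules} {U : X.Opens} (f : (extZero X).obj U ⟶ F) (g : F ⟶ G) :
    extZeroEquiv G U (f ≫ g) = sec g U (extZeroEquiv F U f) := rfl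

/-- The universal section of `extZero X U`. -/
def univSec (U : X.Opens) : Γ((extZero X).obj U, U) := extZeroEquiv _ U (𝟙 _)

lemma extZeroEquiv_eq {F : X.Modules} {U : X.Opens} (f : (extZero X).obj U ⟶ F) :
    extZeroEquiv F U f = sec f U (univSec U) := by
  rw [univSec, ← extZeroEquiv_comp, Category.id_comp]

/-- This is what makes `extZeroEquiv` natural in the open set. It is checked by following the
generator of the free presheaf on U through the unit of sheafification. -/
lemma sec_map_univSec {U V : X.Opens} (i : V ⟶ U) :
    sec ((extZero X).map i) V (univSec V) = ((extZero X).obj U).res i.le (univSec U) := by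
  rw [← extZeroEquiv_eq]
  let adj := PresheafOfModules.sheafificationAdjunction (𝟙 X.ringCatSheaf.obj)
  let P := yoneda ⋙ PresheafOfModules.free X.ringCatSheaf.obj
  have h1 : extZeroEquiv _ V ((extZero X).map i) =
    (PresheafOfModules.freeYonedaEquiv (P.map i ≫ adj.unit.app (P.obj U))) := by
    have : adj.homEquiv _ _ ((PresheafOfModules.sheafification _).map (P.map i)) =
      P.map i ≫ adj.unit.app (P.obj U) := by
      rw [adj.homEquiv_unit]; exact (adj.unit.naturality (P.map i)).symm
    exact congr(PresheafOfModules.freeYonedaEquiv $this)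
  have h2 : univSec U = PresheafOfModules.freeYonedaEquiv (adj.unit.app (P.obj U)) := by
    have : adj.homEquiv _ _ (𝟙 ((PresheafOfModules.sheafification _).obj (P.obj U))) =
      adj.unit.app (P.obj U) := by
      rw [adj.homEquiv_unit, CategoryTheory.Functor.map_id]; exact Category.comp_id _
    exact congr(PresheafOfModules.freeYonedaEquiv $this)
  rw [h1, h2]
  generalize hη : adj.unit.app (P.obj U) = η
  have e1 : PresheafOfModules.freeYonedaEquiv (P.map i ≫ η) =
      η.app (op V) ((P.map i).app (op V) (ModuleCat.freeMk (𝟙 V))) := by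
    rw [← PresheafOfModules.freeYonedaEquiv_symm_app _ _
      (PresheafOfModules.freeYonedaEquiv (P.map i ≫ η)), Equiv.symm_apply_apply]
    rfl
  have e2 : PresheafOfModules.freeYonedaEquiv η = η.app (op U) (ModuleCat.freeMk (𝟙 U)) := by
    rw [← PresheafOfModules.freeYonedaEquiv_symm_app _ _
      (PresheafOfModules.freeYonedaEquiv η), Equiv.symm_apply_apply]
  rw [e1, e2]
  have e3 := PresheafOfModules.naturality_apply η i.op (ModuleCat.freeMk (𝟙 U))
  refine Eq.trans ?_ e3
  congr 1
  refine (Finsupp.mapDomain_single).trans ?_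
  have e4 : (P.obj U).map i.op (ModuleCat.freeMk (𝟙 U)) =
      ModuleCat.freeMk ((yoneda.obj U).map i.op (𝟙 U)) :=
    ModuleCat.freeDesc_apply _ _
  refine Eq.trans ?_ e4.symm
  refine congrArg ModuleCat.freeMk ?_
  change (𝟙 V ≫ i : V ⟶ U) = i ≫ 𝟙 U
  exact Subsingleton.elim _ _

lemma extZeroEquiv_map {F : X.Modules} {U V : X.Opens} (i : V ⟶ U) (f : (extZero X).obj U ⟶ F) :
    extZeroEquiv F V ((extZero X).map i ≫ f) = F.res i.le (extZeroEquiv F U f) := by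
  rw [extZeroEquiv_eq, sec_comp, sec_map_univSec, sec_res, extZeroEquiv_eq]

lemma extZeroEquiv_add {F : X.Modules} {U : X.Opens} (f g : (extZero X).obj U ⟶ F) :
    extZeroEquiv F U (f + g) = extZeroEquiv F U f + extZeroEquiv F U g := by
  simp only [extZeroEquiv_eq, sec_add]

lemma extZeroEquiv_sub {F : X.Modules} {U : X.Opens} (f g : (extZero X).obj U ⟶ F) :
    extZeroEquiv F U (f - g) = extZeroEquiv F U f - extZeroEquiv F U g := by
  rw [eq_sub_iff_add_eq, ← extZeroEquiv_add, sub_add_cancel]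

instance {U V : X.Opens} (i : V ⟶ U) : Mono ((extZero X).map i) := by
  have h : Mono ((PresheafOfModules.free X.ringCatSheaf.obj).map (yoneda.map i)) := by
    apply PresheafOfModules.mono_of_injective
    intro W
    have : Function.Injective ((yoneda.map i).app W) := fun (a b : W.unop ⟶ V) _ ↦
      Subsingleton.elim a b
    exact Finsupp.mapDomain_injective this
  exact inferInstanceAs (Mono ((PresheafOfModules.sheafification (𝟙 X.ringCatSheaf.obj)).map
    ((PresheafOfModules.free X.ringCatSheaf.obj).map (yoneda.map i))))

/-- The map `O_{U ∩ V} ⟶ O_U ⊞ O_V`. -/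
def mvLeft (U V : X.Opens) :
    (extZero X).obj (U ⊓ V) ⟶ (extZero X).obj U ⊞ (extZero X).obj V :=
  biprod.lift ((extZero X).map (homOfLE inf_le_left)) (-(extZero X).map (homOfLE inf_le_right))

/-- The map `O_U ⊞ O_V ⟶ O_{U ∪ V}`. -/
def mvRight (U V : X.Opens) :
    (extZero X).obj U ⊞ (extZero X).obj V ⟶ (extZero X).obj (U ⊔ V) :=
  biprod.desc ((extZero X).map (homOfLE le_sup_left)) ((extZero X).map (homOfLE le_sup_right))

lemma mvLeft_comp {U V : X.Opens} {F : X.Modules}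
    (k : (extZero X).obj U ⊞ (extZero X).obj V ⟶ F) :
    mvLeft U V ≫ k = (extZero X).map (homOfLE inf_le_left) ≫ biprod.inl ≫ k -
      (extZero X).map (homOfLE inf_le_right) ≫ biprod.inr ≫ k := by
  rw [mvLeft, biprod.lift_eq]
  simp [sub_eq_add_neg]

lemma inl_mvRight_comp {U V : X.Opens} {F : X.Modules} (k : (extZero X).obj (U ⊔ V) ⟶ F) :
    biprod.inl ≫ mvRight U V ≫ k = (extZero X).map (homOfLE le_sup_left) ≫ k :=
  biprod.inl_desc_assoc _ _ _

lemma inr_mvRight_comp {U V : X.Opens} {F : X.Modules} (k : (extZero X).obj (U ⊔ V) ⟶ F) :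
    biprod.inr ≫ mvRight U V ≫ k = (extZero X).map (homOfLE le_sup_right) ≫ k :=
  biprod.inr_desc_assoc _ _ _

/-- The Mayer–Vietoris sequence `0 ⟶ O_{U ∩ V} ⟶ O_U ⊞ O_V ⟶ O_{U ∪ V} ⟶ 0`. -/
abbrev mayerVietoris (U V : X.Opens) : ShortComplex X.Modules :=
  ShortComplex.mk (mvLeft U V) (mvRight U V) (by
    rw [mvLeft, mvRight, biprod.lift_desc, Preadditive.neg_comp, ← Functor.map_comp,
      ← Functor.map_comp,
      Subsingleton.elim (homOfLE _ ≫ homOfLE _ : U ⊓ V ⟶ U ⊔ V), add_neg_cancel])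

/-- Morphisms out of the terms are sections over open sets. The right half of exactness is therefore
the sheaf property for two open sets: compatible sections glue, so every map killed by `mvLeft`
factors through `mvRight`, and they glue uniquely, so `mvRight` is epi. -/
lemma mayerVietoris_shortExact (U V : X.Opens) : (mayerVietoris U V).ShortExact := by
  have hm : Mono (mvLeft U V) := by
    have : Mono ((mvLeft U V) ≫ biprod.fst) := by
      dsimp [mvLeft]; rw [biprod.lift_fst]; infer_instance
    exact mono_of_mono _ biprod.fst
  have key (F : X.Modules) (k : (extZero X).obj U ⊞ (extZero X).obj V ⟶ F)
      (hk : mvLeft U V ≫ k = 0) : ∃ l : (extZero X).obj (U ⊔ V) ⟶ F, mvRight U V ≫ l = k := by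
    have h0 : (extZero X).map (homOfLE (inf_le_left : U ⊓ V ≤ U)) ≫ biprod.inl ≫ k =
        (extZero X).map (homOfLE (inf_le_right : U ⊓ V ≤ V)) ≫ biprod.inr ≫ k := by
      rwa [mvLeft_comp, sub_eq_zero] at hk
    have h1 := congr(extZeroEquiv F _ $h0)
    rw [extZeroEquiv_map, extZeroEquiv_map] at h1
    obtain ⟨z, hz₁, hz₂⟩ := gluing F _ _ h1
    refine ⟨(extZeroEquiv F _).symm z, ?_⟩
    apply biprod.hom_ext'
    · apply (extZeroEquiv F _).injective
      rw [inl_mvRight_comp, extZeroEquiv_map, Equiv.apply_symm_apply]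
      exact hz₁
    · apply (extZeroEquiv F _).injective
      rw [inr_mvRight_comp, extZeroEquiv_map, Equiv.apply_symm_apply]
      exact hz₂
  have hh : Epi (mvRight U V) := by
    refine ⟨fun {F} a b h ↦ (extZeroEquiv F _).injective (eq_of_locally_eq _ _ _ fun x hx ↦ ?_)⟩
    rcases hx with hx | hx
    · refine ⟨U, le_sup_left, hx, ?_⟩
      have := congr(extZeroEquiv F _ (biprod.inl ≫ $h))
      rwa [inl_mvRight_comp, inl_mvRight_comp, extZeroEquiv_map, extZeroEquiv_map] at this
    · refine ⟨V, le_sup_right, hx, ?_⟩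
      have := congr(extZeroEquiv F _ (biprod.inr ≫ $h))
      rwa [inr_mvRight_comp, inr_mvRight_comp, extZeroEquiv_map, extZeroEquiv_map] at this
  choose l hl using key
  exact ⟨ShortComplex.exact_of_g_is_cokernel _ (CokernelCofork.IsColimit.ofπ _ _
    (fun k hk ↦ l _ k hk) (fun k hk ↦ hl _ k hk)
    (fun k hk m hm ↦ by rw [← cancel_epi (mvRight U V), hm, hl]))⟩

open CategoryTheory.Abelian

/-- The cohomology `H^n(U, F)`. -/
abbrev H (F : X.Modules) (U : X.Opens) (n : ℕ) : Type u := Ext ((extZero X).obj U) F n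

/-- Restriction of cohomology classes. -/
def resH (F : X.Modules) {U V : X.Opens} (h : V ≤ U) {n : ℕ} (α : F.H U n) : F.H V n :=
  (Ext.mk₀ ((extZero X).map (homOfLE h))).comp α (zero_add n)

lemma resH_resH (F : X.Modules) {U V W : X.Opens} (h : V ≤ U) (h' : W ≤ V) {n : ℕ} (α : F.H U n) :
    F.resH h' (F.resH h α) = F.resH (h'.trans h) α := by
  unfold resH
  rw [Ext.mk₀_comp_mk₀_assoc, ← Functor.map_comp]; rfl

@[simp] lemma resH_self (F : X.Modules) {U : X.Opens} (h : U ≤ U) {n : ℕ} (α : F.H U n) :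
    F.resH h α = α := by
  unfold resH
  rw [Subsingleton.elim (homOfLE h) (𝟙 U), CategoryTheory.Functor.map_id, Ext.mk₀_id_comp]

@[simp] lemma resH_zero (F : X.Modules) {U V : X.Opens} (h : V ≤ U) {n : ℕ} :
    F.resH h (0 : F.H U n) = 0 := by
  simp [resH]

lemma resH_comp {F G : X.Modules} {U V : X.Opens} (h : V ≤ U) {n m k : ℕ} (α : F.H U n)
    (β : Ext F G m) (hk : n + m = k) :
    G.resH h (α.comp β hk) = (F.resH h α).comp β hk := by
  unfold resH
  rw [Ext.comp_assoc _ _ _ (zero_add n) hk (by lia)]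

/-- The class of degree zero attached to a section. -/
def secClass (F : X.Modules) {U : X.Opens} (s : Γ(F, U)) : F.H U 0 :=
  Ext.mk₀ ((extZeroEquiv F U).symm s)

lemma exists_secClass (F : X.Modules) {U : X.Opens} (α : F.H U 0) : ∃ s, α = F.secClass s := by
  obtain ⟨f, rfl⟩ := Ext.addEquiv₀.symm.surjective α
  exact ⟨extZeroEquiv F U f, by simp [secClass]⟩

lemma resH_secClass (F : X.Modules) {U V : X.Opens} (h : V ≤ U) (s : Γ(F, U)) :
    F.resH h (F.secClass s) = F.secClass (F.res h s) := by
  simp only [resH, secClass, Ext.mk₀_comp_mk₀]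
  congr 1
  apply (extZeroEquiv F V).injective
  rw [extZeroEquiv_map, Equiv.apply_symm_apply, Equiv.apply_symm_apply]

lemma secClass_comp {F G : X.Modules} (f : F ⟶ G) {U : X.Opens} (s : Γ(F, U)) :
    (F.secClass s).comp (Ext.mk₀ f) (add_zero 0) = G.secClass (sec f U s) := by
  simp only [secClass, Ext.mk₀_comp_mk₀]
  congr 1
  apply (extZeroEquiv G U).injective
  rw [extZeroEquiv_comp, Equiv.apply_symm_apply, Equiv.apply_symm_apply]

lemma secClass_injective (F : X.Modules) {U : X.Opens} :
    Function.Injective (F.secClass (U := U)) := fun s t h ↦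
  (extZeroEquiv F U).symm.injective (Ext.addEquiv₀.symm.injective h)

/-- By the Mayer–Vietoris sequence, a class dying on U and on V is the coboundary of a class of
degree n on U ∩ V. For n > 0 that class is assumed to vanish; for n = 0 it is a section, and a
difference of sections over U and V has zero coboundary. -/
lemma eq_zero_of_resH_eq_zero (F : X.Modules) {U V : X.Opens} {n : ℕ} (α : F.H (U ⊔ V) (n + 1))
    (hU : F.resH le_sup_left α = 0) (hV : F.resH le_sup_right α = 0)
    (h0 : n = 0 → ∀ s : Γ(F, U ⊓ V), ∃ (a : Γ(F, U)) (b : Γ(F, V)),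
      F.res inf_le_left a - F.res inf_le_right b = s)
    (h1 : n ≠ 0 → ∀ β : F.H (U ⊓ V) n, β = 0) : α = 0 := by
  have hS := mayerVietoris_shortExact U V
  have h : (Ext.mk₀ (mvRight U V)).comp α (zero_add _) = 0 := by
    have e : (mvRight U V) = biprod.fst ≫ (extZero X).map (homOfLE le_sup_left) +
      biprod.snd ≫ (extZero X).map (homOfLE le_sup_right) := biprod.desc_eq
    rw [e, Ext.mk₀_add, Ext.add_comp, ← Ext.mk₀_comp_mk₀_assoc, ← Ext.mk₀_comp_mk₀_assoc]
    change (Ext.mk₀ _).comp (F.resH le_sup_left α) _ + (Ext.mk₀ _).comp (F.resH le_sup_right α) _ = 0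
    rw [hU, hV]; simp
  obtain ⟨β, rfl⟩ := Ext.contravariant_sequence_exact₃ hS F α h (n₀ := n) (by lia)
  rcases eq_or_ne n 0 with rfl | hn
  · obtain ⟨s, rfl⟩ := exists_secClass F β
    obtain ⟨a, b, rfl⟩ := h0 rfl s
    have : F.secClass (F.res inf_le_left a - F.res inf_le_right b) =
        (Ext.mk₀ (mvLeft U V)).comp
          (Ext.mk₀ (biprod.desc ((extZeroEquiv F U).symm a) ((extZeroEquiv F V).symm b)))
          (zero_add 0) := by
      rw [Ext.mk₀_comp_mk₀, secClass]
      congr 1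
      apply (extZeroEquiv F _).injective
      rw [mvLeft_comp, biprod.inl_desc, biprod.inr_desc, extZeroEquiv_sub,
        extZeroEquiv_map, extZeroEquiv_map]
      simp only [Equiv.apply_symm_apply]
    rw [this]
    -- The class factors through the first map of the sequence, which the extension class
    -- annihilates.
    exact hS.extClass_comp_assoc _
  · rw [h1 hn β]; exact Ext.comp_zero hS.extClass _ _ _ _

/-- Cohomology classes of positive degree vanish locally. -/
lemma exists_resH_eq_zero (F : X.Modules) {U : X.Opens} {n : ℕ} (α : F.H U (n + 1)) (x : X)
    (hx : x ∈ U) : ∃ (V : X.Opens) (hV : V ≤ U), x ∈ V ∧ F.resH hV α = 0 := by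
  induction n generalizing F U with
  | zero =>
    -- With F embedded in an injective sheaf, a class of degree 1 is the coboundary of a section of
    -- the quotient, and it dies wherever this section lifts. In higher degrees the same sequence
    -- shifts the degree.
    let S := ShortComplex.mk _ _ (cokernel.condition (Injective.ι F))
    have hS : S.ShortExact := ⟨ShortComplex.exact_cokernel _⟩
    obtain ⟨β, rfl⟩ := Ext.covariant_sequence_exact₁ _ hS α (Ext.eq_zero_of_injective _) rfl
    obtain ⟨q, rfl⟩ := exists_secClass _ β
    obtain ⟨V, hV, hx, t, ht⟩ := (epi_iff_locally_surjective S.g).1 hS.epi_g U q x hx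
    refine ⟨V, hV, hx, ?_⟩
    rw [resH_comp, resH_secClass, ← ht, ← secClass_comp]
    rw [Ext.comp_assoc _ _ _ (add_zero 0) (zero_add 1) rfl]
    erw [hS.comp_extClass]
    simp
  | succ n ih =>
    let S := ShortComplex.mk _ _ (cokernel.condition (Injective.ι F))
    have hS : S.ShortExact := ⟨ShortComplex.exact_cokernel _⟩
    obtain ⟨β, rfl⟩ := Ext.covariant_sequence_exact₁ _ hS α (Ext.eq_zero_of_injective _) rfl
    obtain ⟨V, hV, hx, h⟩ := ih _ β hx
    exact ⟨V, hV, hx, by rw [resH_comp, h, Ext.zero_comp]⟩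

end AlgebraicGeometry.Scheme.Modules
end

/-! ### Combinatorics of alternating cochains -/

noncomputable section

namespace GrMod

/-! ### Insertion of an index -/

variable {r : ℕ}

lemma exists_insert {p : ℕ} (J : Fin (p + 1) ↪o Fin (r + 1)) (i : Fin (r + 1))
    (hi : i ∉ Set.range J) :
    ∃ (k : Fin (p + 2)) (L : Fin (p + 2) ↪o Fin (r + 1)), face L k = J ∧ L k = i := by
  classical
  let I := insert i (Finset.univ.image J)
  have hI : I.card = p + 2 := by
    rw [Finset.card_insert_of_notMem (by simpa using hi),
      Finset.card_image_of_injective _ J.injective]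
    simp
  obtain ⟨k, hk⟩ : i ∈ Set.range (I.orderEmbOfFin hI) := by simp [I]
  refine ⟨k, I.orderEmbOfFin hI, ?_, hk⟩
  apply DFunLike.coe_injective
  refine ((face _ k).strictMono.range_inj J.strictMono).1 ?_
  ext x
  constructor
  · rintro ⟨l, rfl⟩
    have h1 : I.orderEmbOfFin hI (k.succAbove l) ∈ I := Finset.orderEmbOfFin_mem _ _ _
    have h2 : I.orderEmbOfFin hI (k.succAbove l) ≠ i := fun h ↦
      Fin.succAbove_ne k l ((I.orderEmbOfFin hI).injective (h.trans hk.symm))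
    change I.orderEmbOfFin hI (k.succAbove l) ∈ _
    rcases Finset.mem_insert.1 h1 with h | h
    · exact absurd h h2
    · obtain ⟨m, -, hm⟩ := Finset.mem_image.1 h
      exact ⟨m, hm⟩
  · rintro ⟨l, rfl⟩
    obtain ⟨m, hm⟩ : J l ∈ Set.range (I.orderEmbOfFin hI) := by simp [I]
    have : m ≠ k := by
      rintro rfl
      exact hi ⟨l, hm.symm.trans hk⟩
    obtain ⟨n, rfl⟩ := Fin.exists_succAbove_eq this
    exact ⟨n, hm⟩

lemma insert_unique {p : ℕ} {k k' : Fin (p + 2)} {L L' : Fin (p + 2) ↪o Fin (r + 1)}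
    (h : face L k = face L' k') (h' : L k = L' k') : k = k' ∧ L = L' := by
  have : L = L' := by
    apply DFunLike.coe_injective
    refine (L.strictMono.range_inj L'.strictMono).1 ?_
    have key (M : Fin (p + 2) ↪o Fin (r + 1)) (m : Fin (p + 2)) :
        Set.range M = insert (M m) (Set.range (face M m)) := by
      ext x
      constructor
      · rintro ⟨l, rfl⟩
        rcases eq_or_ne l m with rfl | hl
        · exact Set.mem_insert _ _
        · obtain ⟨n, rfl⟩ := Fin.exists_succAbove_eq hl
          exact Or.inr ⟨n, rfl⟩
      · rintro (rfl | ⟨n, rfl⟩)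
        exacts [⟨m, rfl⟩, ⟨_, rfl⟩]
    rw [key L k, key L' k', h, h']
  subst this
  exact ⟨L.injective h', rfl⟩

open Classical in
/-- Contraction of a cochain `e` with the index `i`: the value on `J` is the signed value
of `e` on `J ∪ {i}`, or zero when `i ∈ J`. -/
def insertion {T : Type*} [AddCommGroup T] {p : ℕ} (i : Fin (r + 1))
    (e : (Fin (p + 2) ↪o Fin (r + 1)) → T) (J : Fin (p + 1) ↪o Fin (r + 1)) : T :=
  if hi : i ∉ Set.range J then
    (-1 : ℤ) ^ ((exists_insert J i hi).choose : ℕ) • e (exists_insert J i hi).choose_spec.choose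
  else 0

section
variable {T : Type*} [AddCommGroup T]

lemma insertion_face {p : ℕ} (e : (Fin (p + 2) ↪o Fin (r + 1)) → T) (L : Fin (p + 2) ↪o Fin (r + 1))
    (k : Fin (p + 2)) : insertion (L k) e (face L k) = (-1 : ℤ) ^ (k : ℕ) • e L := by
  have hi : L k ∉ Set.range (face L k) := by
    rintro ⟨l, hl⟩
    exact Fin.succAbove_ne k l (L.injective hl)
  rw [insertion, dif_pos hi]
  have h := (exists_insert (face L k) (L k) hi).choose_spec.choose_spec
  obtain ⟨h1, h2⟩ := insert_unique h.1 h.2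
  rw [h2, h1]

lemma insertion_of_mem {p : ℕ} (e : (Fin (p + 2) ↪o Fin (r + 1)) → T)
    {J : Fin (p + 1) ↪o Fin (r + 1)} {i : Fin (r + 1)} (hi : i ∈ Set.range J) :
    insertion i e J = 0 := by
  rw [insertion, dif_neg (by simpa using hi)]

/-- The alternating sum over the faces. -/
def altSum {p : ℕ} (e : (Fin (p + 1) ↪o Fin (r + 1)) → T) (L : Fin (p + 2) ↪o Fin (r + 1)) : T :=
  ∑ k : Fin (p + 2), (-1 : ℤ) ^ (k : ℕ) • e (face L k)

lemma face_face {p : ℕ} (L : Fin (p + 3) ↪o Fin (r + 1)) (k : Fin (p + 3)) (l : Fin (p + 2)) :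
    face (face L (k.succAbove l)) (l.predAbove k) = face (face L k) l := by
  ext i
  exact congr(((L $(Fin.succAbove_succAbove_succAbove_predAbove k l i) : Fin (r + 1)) : ℕ))

lemma altSum_altSum {p : ℕ} (e : (Fin (p + 1) ↪o Fin (r + 1)) → T) (L : Fin (p + 3) ↪o Fin (r + 1)) :
    altSum (altSum e) L = 0 := by
  simp only [altSum, Finset.smul_sum, smul_smul]
  rw [← Finset.sum_product']
  refine Finset.sum_involution (fun x _ ↦ (x.1.succAbove x.2, x.2.predAbove x.1)) ?_ ?_ ?_ ?_
  · rintro ⟨k, l⟩ -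
    dsimp only
    rw [face_face, ← add_smul]
    have h4 := Fin.neg_one_pow_succAbove_add_predAbove (R := ℤ) k l
    rw [pow_add, pow_add] at h4
    rw [h4, add_neg_cancel, zero_smul]
  · rintro ⟨k, l⟩ - - h
    exact Fin.succAbove_ne k l congr(($h).1)
  · intros; exact Finset.mem_univ _
  · rintro ⟨k, l⟩ -
    exact Prod.ext (Fin.succAbove_succAbove_predAbove k l) (Fin.predAbove_predAbove_succAbove k l)

/-- The insertion of an index is a contracting homotopy. -/
lemma altSum_insertion {p : ℕ} (i : Fin (r + 1)) (e : (Fin (p + 2) ↪o Fin (r + 1)) → T)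
    (J : Fin (p + 2) ↪o Fin (r + 1)) :
    altSum (insertion i e) J + insertion i (altSum e) J = e J := by
  by_cases hi : i ∈ Set.range J
  · rw [insertion_of_mem _ hi, add_zero]
    obtain ⟨k₀, rfl⟩ := hi
    -- When i occurs in J, the only face not containing i is the one that omits it, and inserting i
    -- there restores J with the square of a sign.
    rw [altSum, Finset.sum_eq_single k₀]
    · rw [insertion_face, smul_smul, ← mul_pow]; simp
    · intro k _ hk
      rw [insertion_of_mem _ ?_, smul_zero]
      obtain ⟨l, hl⟩ := Fin.exists_succAbove_eq hk.symm
      exact ⟨l, congr(J $hl)⟩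
    · simp
  · obtain ⟨k₀, L, rfl, rfl⟩ := exists_insert J i hi
    rw [insertion_face, altSum, altSum, Fin.sum_univ_succAbove _ k₀, smul_add, smul_smul, ← mul_pow]
    -- Omitting another index and inserting i can be exchanged up to a sign, so all terms other than
    -- the one for J cancel between the two sums.
    have key (k : Fin (p + 2)) : (-1 : ℤ) ^ (k : ℕ) • insertion (L k₀) e (face (face L k₀) k) =
        -((-1 : ℤ) ^ (k₀ : ℕ) • (-1 : ℤ) ^ (k₀.succAbove k : ℕ) • e (face L (k₀.succAbove k))) := by
      have h1 : L k₀ = face L (k₀.succAbove k) (k.predAbove k₀) :=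
        congr(L $(Fin.succAbove_succAbove_predAbove k₀ k)).symm
      have h2 := insertion_face e (face L (k₀.succAbove k)) (k.predAbove k₀)
      rw [← h1, face_face] at h2
      rw [h2, smul_smul, smul_smul, ← neg_smul]
      congr 1
      have h4 := Fin.neg_one_pow_succAbove_add_predAbove (R := ℤ) k₀ k
      rw [pow_add, pow_add] at h4
      have e1 : ((-1 : ℤ) ^ (k₀ : ℕ)) * (-1 : ℤ) ^ (k₀ : ℕ) = 1 := by rw [← mul_pow]; simp
      have e2 : ((-1 : ℤ) ^ (k₀.succAbove k : ℕ)) * (-1 : ℤ) ^ (k₀.succAbove k : ℕ) = 1 := by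
        rw [← mul_pow]; simp
      have e3 : ((-1 : ℤ) ^ (k : ℕ)) * (-1 : ℤ) ^ (k : ℕ) = 1 := by rw [← mul_pow]; simp
      linear_combination ((-1 : ℤ) ^ (k : ℕ) * (-1 : ℤ) ^ (k₀.succAbove k : ℕ)) * h4 -
        ((-1 : ℤ) ^ (k : ℕ) * (-1 : ℤ) ^ (k.predAbove k₀ : ℕ)) * e2 -
        ((-1 : ℤ) ^ (k₀ : ℕ) * (-1 : ℤ) ^ (k₀.succAbove k : ℕ)) * e3
    simp only [key, Finset.sum_neg_distrib, Finset.smul_sum]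
    simp

end

end GrMod
end

/-! ### The Čech complex of sheaves of modules -/

noncomputable section

namespace AlgebraicGeometry.Scheme.Modules

open TopologicalSpace Opposite

variable {X : Scheme.{u}} {r : ℕ} (V : Fin (r + 1) → X.Opens)

/-- The intersection of the members of a family of open subsets indexed by `J`. -/
def cap {p : ℕ} (J : Fin (p + 1) ↪o Fin (r + 1)) : X.Opens := ⨅ k, V (J k)

lemma cap_le {p : ℕ} (J : Fin (p + 1) ↪o Fin (r + 1)) (k : Fin (p + 1)) : cap V J ≤ V (J k) :=
  iInf_le _ k

lemma cap_face {p : ℕ} (J : Fin (p + 2) ↪o Fin (r + 1)) (k : Fin (p + 2)) :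
    cap V J ≤ cap V (GrMod.face J k) := le_iInf fun l ↦ iInf_le _ (k.succAbove l)

lemma res_smul (F : X.Modules) {U W : X.Opens} (h : W ≤ U) (a : Γ(X, U)) (s : Γ(F, U)) :
    F.res h (a • s) = (X.presheaf.map (homOfLE h).op a) • F.res h s :=
  F.map_smul (homOfLE h) a s

section
variable {ι : Type} (W : ι → X.Opens) (F : X.Modules)

/-- Families of sections of `F` over the intersections of an open subset with the `W i`. -/
abbrev Fam (U : X.Opens) : Type u := ∀ i, Γ(F, U ⊓ W i)

/-- The action of functions on families of sections. -/
instance famModule (U : X.Opens) : Module Γ(X, U) (Fam W F U) where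
  smul a s i := (X.presheaf.map (homOfLE (inf_le_left : U ⊓ W i ≤ U)).op a) • s i
  one_smul s := funext fun i ↦ by
    change (X.presheaf.map (homOfLE (inf_le_left : U ⊓ W i ≤ U)).op 1) • s i = s i
    rw [map_one, one_smul]
  mul_smul a b s := funext fun i ↦ by
    change (X.presheaf.map (homOfLE (inf_le_left : U ⊓ W i ≤ U)).op (a * b)) • s i = _
    rw [map_mul, mul_smul]; rfl
  smul_zero a := funext fun i ↦ smul_zero _
  smul_add a s t := funext fun i ↦ smul_add _ _ _
  add_smul a b s := funext fun i ↦ by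
    change (X.presheaf.map (homOfLE (inf_le_left : U ⊓ W i ≤ U)).op (a + b)) • s i = _
    rw [map_add, add_smul]; rfl
  zero_smul s := funext fun i ↦ by
    change (X.presheaf.map (homOfLE (inf_le_left : U ⊓ W i ≤ U)).op 0) • s i = 0
    rw [map_zero, zero_smul]

/-- Restriction of families of sections. -/
def famRes {U U' : X.Opens} (h : U' ≤ U) : Fam W F U →+ Fam W F U' where
  toFun s i := F.res (inf_le_inf_right _ h) (s i)
  map_zero' := funext fun _ ↦ map_zero _
  map_add' _ _ := funext fun _ ↦ map_add _ _ _

/-- The presheaf of families of sections. -/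
def famPresheaf : TopCat.Presheaf Ab.{u} X where
  obj U := AddCommGrpCat.of (Fam W F U.unop)
  map i := AddCommGrpCat.ofHom (famRes W F i.unop.le)
  map_id U := by
    refine AddCommGrpCat.hom_ext (AddMonoidHom.ext fun s ↦ funext fun i ↦ ?_)
    exact F.res_self _ (s i)
  map_comp f g := by
    refine AddCommGrpCat.hom_ext (AddMonoidHom.ext fun s ↦ funext fun i ↦ ?_)
    exact (F.res_res _ _ (s i)).symm

lemma famPresheaf_isSheaf : (famPresheaf W F).IsSheaf := by
  rw [TopCat.Presheaf.isSheaf_iff_isSheaf_comp (CategoryTheory.forget Ab.{u})]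
  apply TopCat.Presheaf.isSheaf_of_isSheafUniqueGluing_types
  intro κ U sf hsf
  have h (i : ι) := TopCat.Sheaf.existsUnique_gluing' ⟨F.presheaf, F.isSheaf⟩
    (fun k ↦ U k ⊓ W i) (iSup U ⊓ W i) (fun k ↦ homOfLE (inf_le_inf_right _ (le_iSup U k)))
    (by rw [iSup_inf_eq]) (fun k ↦ (sf k : Fam W F (U k)) i) (by
      intro k l
      have := congr(F.res (U := U k ⊓ U l ⊓ W i) (V := U k ⊓ W i ⊓ (U l ⊓ W i))
        (le_inf (inf_le_inf inf_le_left inf_le_left) (inf_le_left.trans inf_le_right))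
        ($(hsf k l) i))
      exact (F.res_res _ _ _).symm.trans (this.trans (F.res_res _ _ _)))
  choose s hs hs' using h
  refine ⟨s, fun k ↦ funext fun i ↦ hs i k, fun t ht ↦ funext fun i ↦ hs' i (t i) fun k ↦ ?_⟩
  exact congr($(ht k) i)

instance famPresheafModule (U : X.Opensᵒᵖ) :
    Module (X.ringCatSheaf.obj.obj U) ((famPresheaf W F).obj U) :=
  famModule W F U.unop

/-- The sheaf `U ↦ ∏ i, F(U ∩ W i)`. -/
def fam : X.Modules where
  val := PresheafOfModules.ofPresheaf (R := X.ringCatSheaf.obj) (famPresheaf W F)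
    fun U U' f (a : Γ(X, U.unop)) (s : Fam W F U.unop) ↦ funext fun i ↦ by
      refine (res_smul F _ _ (s i)).trans ?_
      change _ = (X.presheaf.map (homOfLE (inf_le_left : U'.unop ⊓ W i ≤ U'.unop)).op
        (X.presheaf.map f a)) • F.res (inf_le_inf_right (W i) f.unop.le) (s i)
      rw [← CommRingCat.comp_apply, ← CommRingCat.comp_apply, ← X.presheaf.map_comp,
        ← X.presheaf.map_comp]
      rfl
  isSheaf := famPresheaf_isSheaf W F

end

/-- Construct a morphism of sheaves of modules from maps on sections. -/
def homMk {F G : X.Modules} (φ : ∀ U, Γ(F, U) →+ Γ(G, U))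
    (hφ : ∀ (U U' : X.Opens) (h : U' ≤ U) (s : Γ(F, U)), φ U' (F.res h s) = G.res h (φ U s))
    (hs : ∀ U (a : Γ(X, U)) (s : Γ(F, U)), φ U (a • s) = a • φ U s) : F ⟶ G where
  val := PresheafOfModules.homMk (M₁ := F.val) (M₂ := G.val)
    { app := fun U ↦ AddCommGrpCat.ofHom (φ U.unop)
      naturality := fun U U' f ↦ by ext s; exact hφ U.unop U'.unop f.unop.le s }
    fun U a s ↦ hs U.unop a s

lemma sec_smul {F G : X.Modules} (f : F ⟶ G) {U : X.Opens} (a : Γ(X, U)) (s : Γ(F, U)) :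
    sec f U (a • s) = a • sec f U s := f.app_smul a s

/-- The functoriality of `fam`. -/
def famMap {ι : Type} (W : ι → X.Opens) {F G : X.Modules} (f : F ⟶ G) : fam W F ⟶ fam W G :=
  homMk (fun U ↦
    { toFun := fun (s : Fam W F U) ↦ (fun i ↦ sec f _ (s i) : Fam W G U)
      map_zero' := funext fun _ ↦ map_zero _
      map_add' := fun _ _ ↦ funext fun _ ↦ map_add _ _ _ })
    (fun U U' h s ↦ funext fun i ↦ sec_res f _ _)
    (fun U a s ↦ funext fun i ↦ sec_smul f _ _)

/-- The Čech differential on families of sections. -/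
def cechDiffSec (F : X.Modules) (p : ℕ) (U : X.Opens) :
    Fam (cap V (p := p)) F U →+ Fam (cap V (p := p + 1)) F U where
  toFun s J := ∑ k : Fin (p + 2), (-1 : ℤ) ^ (k : ℕ) •
    F.res (inf_le_inf_left U (cap_face V J k)) (s (GrMod.face J k))
  map_zero' := funext fun J ↦ by simp
  map_add' s t := funext fun J ↦ by simp [Finset.sum_add_distrib]

/-- The Čech differential. -/
def cechDiff (F : X.Modules) (p : ℕ) : fam (cap V (p := p)) F ⟶ fam (cap V (p := p + 1)) F :=
  homMk (cechDiffSec V F p)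
    (fun U U' h s ↦ funext fun J ↦ by
      change ∑ k : Fin (p + 2), (-1 : ℤ) ^ (k : ℕ) • F.res _ (F.res _ (s (GrMod.face J k))) =
        F.res _ (∑ k : Fin (p + 2), (-1 : ℤ) ^ (k : ℕ) • F.res _ (s (GrMod.face J k)))
      simp only [map_sum, map_zsmul, res_res])
    (fun U a s ↦ funext fun J ↦ by
      change ∑ k : Fin (p + 2), (-1 : ℤ) ^ (k : ℕ) •
        F.res (inf_le_inf_left U (cap_face V J k))
          ((X.presheaf.map (homOfLE (inf_le_left : U ⊓ cap V (GrMod.face J k) ≤ U)).op a) •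
            (s (GrMod.face J k))) =
        (X.presheaf.map (homOfLE (inf_le_left : U ⊓ cap V J ≤ U)).op a) •
          (∑ k : Fin (p + 2), (-1 : ℤ) ^ (k : ℕ) •
            F.res (inf_le_inf_left U (cap_face V J k)) (s (GrMod.face J k)))
      simp only [Finset.smul_sum, res_smul]
      refine Finset.sum_congr rfl fun k _ ↦ ?_
      rw [smul_comm, ← CommRingCat.comp_apply, ← X.presheaf.map_comp]
      rfl)

open Classical in
/-- The restrictions of the members of a family to `U ∩ W`, extended by zero. -/
def famEval (F : X.Modules) {p : ℕ} {U : X.Opens} (s : Fam (cap V (p := p)) F U) (W : X.Opens)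
    (J : Fin (p + 1) ↪o Fin (r + 1)) : Γ(F, U ⊓ W) :=
  if h : W ≤ cap V J then F.res (inf_le_inf_left U h) (s J) else 0

lemma famEval_of_le (F : X.Modules) {p : ℕ} {U : X.Opens} (s : Fam (cap V (p := p)) F U)
    {W : X.Opens} {J : Fin (p + 1) ↪o Fin (r + 1)} (h : W ≤ cap V J) :
    famEval V F s W J = F.res (inf_le_inf_left U h) (s J) := dif_pos h

/-- Once everything is restricted to one open W, all values lie in the single group Γ(F, U ∩ W), and
the Čech differential becomes the combinatorial `altSum`, to which the identities for `altSum` and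
`insertion` apply. -/
lemma famEval_cechDiffSec (F : X.Modules) {p : ℕ} {U : X.Opens} (s : Fam (cap V (p := p)) F U)
    {W : X.Opens} {J : Fin (p + 2) ↪o Fin (r + 1)} (h : W ≤ cap V J) :
    F.res (inf_le_inf_left U h) (cechDiffSec V F p U s J) =
      GrMod.altSum (famEval V F s W) J := by
  change F.res _ (∑ k : Fin (p + 2), (-1 : ℤ) ^ (k : ℕ) • F.res _ (s (GrMod.face J k))) = _
  simp only [map_sum, map_zsmul, res_res, GrMod.altSum]
  refine Finset.sum_congr rfl fun k _ ↦ ?_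
  rw [famEval_of_le V F s (h.trans (cap_face V J k))]

lemma cechDiff_comp (F : X.Modules) (p : ℕ) : cechDiff V F p ≫ cechDiff V F (p + 1) = 0 :=
  hom_ext_sec fun U s ↦ funext fun J ↦ by
    have h := famEval_cechDiffSec V F (cechDiffSec V F p U s) (le_refl (cap V J))
    rw [res_self] at h
    refine h.trans ?_
    refine Eq.trans ?_ (GrMod.altSum_altSum (famEval V F s (cap V J)) J)
    refine Finset.sum_congr rfl fun k _ ↦ ?_
    rw [famEval_of_le V F _ (cap_face V J k)]
    exact congrArg _ (famEval_cechDiffSec V F s (cap_face V J k))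

/-- The Čech complex of sheaves of modules, as a functor. -/
def cechSheaf : X.Modules ⥤ CochainComplex X.Modules ℕ where
  obj F := CochainComplex.of (fun p ↦ fam (cap V (p := p)) F) (cechDiff V F) (cechDiff_comp V F)
  map {F G} f := CochainComplex.ofHom (fun p ↦ famMap _ f) (fun p ↦ by
      dsimp only [CochainComplex.of]
      rw [CochainComplex.of_d, CochainComplex.of_d]
      exact hom_ext_sec fun U s ↦ funext fun J ↦ by
        change ∑ k : Fin (p + 2), (-1 : ℤ) ^ (k : ℕ) • G.res _ (sec f _ (s (GrMod.face J k))) =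
          sec f _ (∑ k : Fin (p + 2), (-1 : ℤ) ^ (k : ℕ) • F.res _ (s (GrMod.face J k)))
        simp only [map_sum, map_zsmul, sec_res])
  map_id F := HomologicalComplex.hom_ext _ _ fun _ ↦ rfl
  map_comp f g := HomologicalComplex.hom_ext _ _ fun _ ↦ rfl

instance : (cechSheaf V).PreservesZeroMorphisms where
  map_zero _ _ := HomologicalComplex.hom_ext _ _ fun _ ↦ rfl

lemma cechSheaf_d (F : X.Modules) (p : ℕ) :
    ((cechSheaf V).obj F).d p (p + 1) = cechDiff V F p := by
  change CochainComplex.of.d (fun p ↦ fam (cap V (p := p)) F) (cechDiff V F) p (p + 1) = _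
  exact CochainComplex.of_d _ _ _

/-- The augmentation `F ⟶ 𝒞⁰(F)`. -/
def cechAug (F : X.Modules) : F ⟶ fam (cap V (p := 0)) F :=
  homMk (fun U ↦
    { toFun := fun s ↦ (fun _ ↦ F.res inf_le_left s : Fam _ F U)
      map_zero' := funext fun _ ↦ map_zero _
      map_add' := fun _ _ ↦ funext fun _ ↦ map_add _ _ _ })
    (fun U U' h s ↦ funext fun i ↦ (F.res_res _ _ _).trans (F.res_res _ _ _).symm)
    (fun U a s ↦ funext fun i ↦ res_smul _ _ _ _)

lemma cechAug_naturality {F G : X.Modules} (f : F ⟶ G) :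
    cechAug V F ≫ famMap (cap V (p := 0)) f = f ≫ cechAug V G :=
  hom_ext_sec fun U s ↦ funext fun J ↦ sec_res f _ _

lemma cechAug_d (F : X.Modules) : cechAug V F ≫ cechDiff V F 0 = 0 := by
  refine hom_ext_sec fun U s ↦ funext fun J ↦ ?_
  change ∑ k : Fin 2, (-1 : ℤ) ^ (k : ℕ) • F.res (inf_le_inf_left U (cap_face V J k))
    (F.res inf_le_left s) = 0
  simp only [res_res]
  rw [Fin.sum_univ_two, Fin.val_zero, Fin.val_one, pow_zero, pow_one, one_smul, neg_smul, one_smul]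
  exact add_neg_cancel _

/-- The embedding of a point. -/
def pt (i : Fin (r + 1)) : Fin 1 ↪o Fin (r + 1) :=
  OrderEmbedding.ofStrictMono (fun _ ↦ i) (fun a b h ↦ absurd h (by simp [Subsingleton.elim a b]))

lemma cap_pt (i : Fin (r + 1)) : cap V (pt i) = V i := by
  change ⨅ k : Fin 1, V (pt i k) = _
  rw [iInf_unique]; rfl

lemma mono_cechAug (hV : ⨆ i, V i = ⊤) (F : X.Modules) : Mono (cechAug V F) := by
  rw [mono_iff_injective]
  intro U s t hst
  refine F.eq_of_locally_eq s t fun x hx ↦ ?_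
  obtain ⟨i, hi⟩ := Opens.mem_iSup.1 (show x ∈ ⨆ i, V i by rw [hV]; trivial)
  exact ⟨U ⊓ cap V (pt i), inf_le_left, ⟨hx, by rwa [cap_pt]⟩, congr($hst (pt i))⟩

lemma le_cap_of_face {p : ℕ} {J : Fin (p + 2) ↪o Fin (r + 1)} {k : Fin (p + 2)} :
    V (J k) ⊓ cap V (GrMod.face J k) ≤ cap V J := by
  refine le_iInf fun l ↦ ?_
  rcases eq_or_ne l k with rfl | hl
  · exact inf_le_left
  · obtain ⟨n, rfl⟩ := Fin.exists_succAbove_eq hl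
    exact inf_le_right.trans (cap_le V (GrMod.face J k) n)

lemma famEval_res (F : X.Modules) {p : ℕ} {U : X.Opens} (s : Fam (cap V (p := p)) F U)
    {W W' : X.Opens} (hW : W' ≤ W) (J : Fin (p + 1) ↪o Fin (r + 1)) (h : W ≤ cap V J) :
    F.res (inf_le_inf_left U hW) (famEval V F s W J) = famEval V F s W' J := by
  rw [famEval_of_le V F s h, famEval_of_le V F s (hW.trans h), res_res]

/-- Only the values on tuples obtained from J by inserting i enter, so compatibility is required for
those alone. This matters because `famEval` is compatible with restriction only when the larger open
is contained in the relevant intersection. -/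
lemma insertion_congr {T T' : Type*} [AddCommGroup T] [AddCommGroup T'] {p : ℕ} (i : Fin (r + 1))
    (f : T →+ T') (e : (Fin (p + 2) ↪o Fin (r + 1)) → T) (e' : (Fin (p + 2) ↪o Fin (r + 1)) → T')
    (J : Fin (p + 1) ↪o Fin (r + 1))
    (h : ∀ (L : Fin (p + 2) ↪o Fin (r + 1)) k, GrMod.face L k = J → L k = i → f (e L) = e' L) :
    f (GrMod.insertion i e J) = GrMod.insertion i e' J := by
  by_cases hi : i ∈ Set.range J
  · rw [GrMod.insertion_of_mem _ hi, GrMod.insertion_of_mem _ hi, map_zero]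
  · obtain ⟨k, L, rfl, rfl⟩ := GrMod.exists_insert J i hi
    rw [GrMod.insertion_face, GrMod.insertion_face, map_zsmul, h L k rfl rfl]

/-- Over U ⊆ V i the intersections attached to J and to J with i inserted have the same trace on U.
A value of s on the larger tuple is therefore a legitimate value on J, and insertion of i is a
contracting homotopy. -/
lemma exists_cechDiff_eq (F : X.Modules) {p : ℕ} {U : X.Opens} {i : Fin (r + 1)} (hU : U ≤ V i)
    (s : Fam (cap V (p := p + 1)) F U) (hs : cechDiffSec V F (p + 1) U s = 0) :
    ∃ t : Fam (cap V (p := p)) F U, cechDiffSec V F p U t = s := by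
  have hle {q : ℕ} (L : Fin (q + 2) ↪o Fin (r + 1)) (k : Fin (q + 2)) (h : L k = i) :
      U ⊓ cap V (GrMod.face L k) ≤ cap V L := by
    refine le_trans (inf_le_inf_right _ ?_) (le_cap_of_face V (k := k))
    rwa [h]
  let e (W : X.Opens) : (Fin (p + 2) ↪o Fin (r + 1)) → Γ(F, U ⊓ (U ⊓ W)) := famEval V F s (U ⊓ W)
  have hUW (W : X.Opens) : U ⊓ W ≤ U ⊓ (U ⊓ W) := le_inf inf_le_left le_rfl
  refine ⟨fun J ↦ F.res (hUW _) (GrMod.insertion i (e (cap V J)) J), funext fun J ↦ ?_⟩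
  have h1 := GrMod.altSum_insertion i (e (cap V J)) J
  -- The second term of the homotopy formula only sees tuples L arising from J by inserting i. Their
  -- intersection contains U ∩ V_J, so there `altSum` is a restriction of the coboundary of s, which
  -- is zero.
  have h2 : GrMod.insertion i (GrMod.altSum (e (cap V J))) J = 0 := by
    have := insertion_congr (T' := Γ(F, U ⊓ (U ⊓ cap V J))) i (AddMonoidHom.id _)
      (fun _ ↦ 0) (GrMod.altSum (e (cap V J))) J (fun L k h h' ↦ by
        have hL : U ⊓ cap V J ≤ cap V L := by rw [← h]; exact hle L k h'
        rw [← famEval_cechDiffSec V F s hL, hs]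
        exact (map_zero _).symm)
    rw [← this]
    by_cases hi : i ∈ Set.range J
    · rw [GrMod.insertion_of_mem _ hi, map_zero]
    · obtain ⟨k, L, rfl, rfl⟩ := GrMod.exists_insert J i hi
      rw [GrMod.insertion_face, smul_zero, map_zero]
  rw [h2, add_zero] at h1
  have h3 := congr(F.res (hUW _) $h1)
  have h4 : e (cap V J) J = _ := famEval_of_le V F s inf_le_right
  rw [h4, res_res, res_self] at h3
  rw [← h3]
  change ∑ k : Fin (p + 2), (-1 : ℤ) ^ (k : ℕ) • F.res _ (F.res _ _) = F.res _ (∑ k, _)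
  simp only [map_sum, map_zsmul]
  refine Finset.sum_congr rfl fun k _ ↦ congrArg _ ?_
  rw [← insertion_congr i (F.res (inf_le_inf_left U (inf_le_inf_left U (cap_face V J k))))
    (e (cap V (GrMod.face J k))), res_res, res_res]
  intro L l hL hl
  exact famEval_res V F s (inf_le_inf_left U (cap_face V J k)) L (by rw [← hL]; exact hle L l hl)

/-- Since U ⊆ V i, the component of s at i is already a section over U. The cocycle condition for
the pair formed by i and another index j says that it restricts to the component at j. -/
lemma exists_cechAug_eq (F : X.Modules) {U : X.Opens} {i : Fin (r + 1)} (hU : U ≤ V i)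
    (s : Fam (cap V (p := 0)) F U) (hs : cechDiffSec V F 0 U s = 0) :
    ∃ t : Γ(F, U), sec (cechAug V F) U t = s := by
  have hU' : U ≤ U ⊓ cap V (pt i) := le_inf le_rfl (by rwa [cap_pt])
  refine ⟨F.res hU' (s (pt i)), funext fun J ↦ ?_⟩
  refine (F.res_res _ _ _).trans ?_
  by_cases hi : i ∈ Set.range J
  · obtain ⟨k, hk⟩ := hi
    obtain rfl : J = pt i := by
      ext l; rw [← hk]; exact congr((J $(Subsingleton.elim (α := Fin 1) l k) : ℕ))
    exact F.res_self _ _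
  · obtain ⟨k, L, rfl, rfl⟩ := GrMod.exists_insert J i hi
    have hl : V (L k) ⊓ cap V (GrMod.face L k) ≤ cap V L := le_cap_of_face V
    have hle : U ⊓ cap V (GrMod.face L k) ≤ U ⊓ cap V L :=
      le_inf inf_le_left ((inf_le_inf_right _ hU).trans hl)
    have h := congr(F.res hle ($hs L))
    change F.res _ (∑ k : Fin 2, (-1 : ℤ) ^ (k : ℕ) • F.res _ (s (GrMod.face L k))) = F.res _ 0 at h
    rw [map_zero, Fin.sum_univ_two, Fin.val_zero, Fin.val_one, pow_zero, pow_one, one_smul,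
      neg_smul, one_smul, map_add, map_neg, add_neg_eq_zero, res_res, res_res] at h
    have key (l : Fin 2) (hlk : l ≠ k) : GrMod.face L l = pt (L k) := by
      ext n
      have h1 : (l.succAbove n : ℕ) ≠ l := fun h ↦ Fin.succAbove_ne l n (Fin.ext h)
      have h2 : (l : ℕ) ≠ k := fun h ↦ hlk (Fin.ext h)
      have : l.succAbove n = k := by omega
      exact congr((L $this : ℕ))
    have aux {J J' : Fin 1 ↪o Fin (r + 1)} (e : J = J') {W : X.Opens} (h : W ≤ U ⊓ cap V J)
        (h' : W ≤ U ⊓ cap V J') : F.res h (s J) = F.res h' (s J') := by subst e; rfl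
    rw [← F.res_self le_rfl (s (GrMod.face L k))]
    match k with
    | 0 => exact (aux (key 1 (by simp)).symm _ _).trans h.symm
    | 1 => exact (aux (key 0 (by simp)).symm _ _).trans h

end AlgebraicGeometry.Scheme.Modules
end

/-! ### The Čech bicomplex resolves a complex of sheaves -/

noncomputable section

namespace HomologicalComplex₂
variable {C : Type*} [Category* C] [Abelian C]

/-- The morphism from a complex, seen as a bicomplex, given by an augmentation. -/
def ofAug {F : CochainComplex C ℤ} {L : HomologicalComplex₂ C (ComplexShape.up ℕ) (ComplexShape.up ℤ)}
    (ρ : F ⟶ L.X 0) (hρ : ρ ≫ L.d 0 1 = 0) : single₀ F ⟶ L :=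
  HomologicalComplex.mkHomFromSingle ρ (fun k hk ↦ by obtain rfl : 1 = k := hk; exact hρ)

lemma quasiIso_colMap_ofAug {F : CochainComplex C ℤ}
    {L : HomologicalComplex₂ C (ComplexShape.up ℕ) (ComplexShape.up ℤ)}
    (ρ : F ⟶ L.X 0) (hρ : ρ ≫ L.d 0 1 = 0) (q : ℤ) (hm : Mono (ρ.f q))
    (h0 : (ShortComplex.mk (ρ.f q) ((L.d 0 1).f q) (by
      rw [← HomologicalComplex.comp_f, hρ, HomologicalComplex.zero_f])).Exact)
    (h1 : ∀ p, (L.flip.X q).ExactAt (p + 1)) :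
    QuasiIso (colMap (ofAug ρ hρ) q) := by
  rw [quasiIso_iff]
  rintro (_ | p)
  · rw [CochainComplex.quasiIsoAt₀_iff, ShortComplex.quasiIso_iff_of_zeros]
    · have e : (colMap (ofAug ρ hρ) q).f 0 =
          (HomologicalComplex.singleObjXSelf (ComplexShape.up ℕ) 0 F).hom.f q ≫ ρ.f q := by
        rw [← HomologicalComplex.comp_f]
        change ((ofAug ρ hρ).f 0).f q = _
        rw [ofAug, HomologicalComplex.mkHomFromSingle_f]
      let a := HomologicalComplex.singleObjXSelf (ComplexShape.up ℕ) 0 F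
      have hinv : a.inv.f q ≫ a.hom.f q = 𝟙 _ := by
        rw [← HomologicalComplex.comp_f, Iso.inv_hom_id, HomologicalComplex.id_f]
      have hiso : IsIso (a.hom.f q) :=
        inferInstanceAs (IsIso ((HomologicalComplex.eval C (ComplexShape.up ℤ) q).map a.hom))
      constructor
      · refine ShortComplex.exact_of_iso ?_ h0
        refine ShortComplex.isoMk (((HomologicalComplex.eval C (ComplexShape.up ℤ) q).mapIso
          a).symm) (Iso.refl _) (Iso.refl _) ?_ ?_
        · change a.inv.f q ≫ (colMap (ofAug ρ hρ) q).f 0 = ρ.f q ≫ 𝟙 _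
          rw [e]
          exact (Category.assoc _ _ _).symm.trans ((congrArg (· ≫ ρ.f q) hinv).trans
            ((Category.id_comp _).trans (Category.comp_id _).symm))
        · exact (Category.id_comp _).trans (Category.comp_id _).symm
      · change Mono ((colMap (ofAug ρ hρ) q).f 0)
        rw [e]
        have : Mono (a.hom.f q) := inferInstance
        exact @mono_comp _ _ _ _ _ _ this _ hm
    · change ((single₀ F).flip.X q).d 0 0 = 0
      exact HomologicalComplex.shape _ _ _ (by simp)
    · change (((single₀ F).d 0 1).f q) = 0
      rw [HomologicalComplex.single_obj_d, HomologicalComplex.zero_f]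
    · change (L.flip.X q).d 0 0 = 0
      exact HomologicalComplex.shape _ _ _ (by simp)
  · rw [quasiIsoAt_iff_exactAt]
    · exact h1 p
    · apply HomologicalComplex.ExactAt.of_isZero
      exact (HomologicalComplex.eval C (ComplexShape.up ℤ) q).map_isZero
        (HomologicalComplex.isZero_single_obj_X (ComplexShape.up ℕ) 0 F (p + 1) (by omega))

end HomologicalComplex₂

namespace AlgebraicGeometry.Scheme.Modules

open TopologicalSpace Opposite

variable {X : Scheme.{u}} {r : ℕ} (V : Fin (r + 1) → X.Opens)

/-- Exactness is local, and near any point one may shrink to an open set inside some V i, where the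
contraction by i exists. -/
lemma cechSheaf_exactAt (hV : ⨆ i, V i = ⊤) (F : X.Modules) (p : ℕ) :
    ((cechSheaf V).obj F).ExactAt (p + 1) := by
  rw [HomologicalComplex.exactAt_iff' _ p (p + 1) (p + 2) (by simp) (by simp)]
  apply exact_of_locally
  intro U s hs x hx
  obtain ⟨i, hi⟩ := Opens.mem_iSup.1 (show x ∈ ⨆ i, V i by rw [hV]; trivial)
  refine ⟨U ⊓ V i, inf_le_left, ⟨hx, hi⟩, ?_⟩
  change sec (((cechSheaf V).obj F).d (p + 1) (p + 2)) U s = 0 at hs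
  change ∃ t, sec (((cechSheaf V).obj F).d p (p + 1)) _ t = _
  rw [cechSheaf_d] at hs ⊢
  refine exists_cechDiff_eq V F inf_le_right ((fam (cap V (p := p + 1)) F).res inf_le_left s) ?_
  have := sec_res (cechDiff V F (p + 1)) (inf_le_left : U ⊓ V i ≤ U) s
  exact this.trans ((congrArg _ hs).trans (map_zero _))

lemma cechAug_exact (hV : ⨆ i, V i = ⊤) (F : X.Modules) :
    (ShortComplex.mk (cechAug V F) (cechDiff V F 0) (cechAug_d V F)).Exact := by
  apply exact_of_locally
  intro U s hs x hx
  obtain ⟨i, hi⟩ := Opens.mem_iSup.1 (show x ∈ ⨆ i, V i by rw [hV]; trivial)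
  refine ⟨U ⊓ V i, inf_le_left, ⟨hx, hi⟩, ?_⟩
  refine exists_cechAug_eq V F inf_le_right ((fam (cap V (p := 0)) F).res inf_le_left s) ?_
  have := sec_res (cechDiff V F 0) (inf_le_left : U ⊓ V i ≤ U) s
  rw [show sec (cechDiff V F 0) U s = 0 from hs, map_zero] at this
  exact this

/-- The Čech bicomplex of a complex of sheaves of modules. -/
def cechBicomplex (F : CochainComplex X.Modules ℤ) :
    HomologicalComplex₂ X.Modules (ComplexShape.up ℕ) (ComplexShape.up ℤ) :=
  HomologicalComplex₂.flip (((cechSheaf V).mapHomologicalComplex (ComplexShape.up ℤ)).obj F)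

/-- The augmentation of the Čech bicomplex. -/
def cechBicomplexAug (F : CochainComplex X.Modules ℤ) : F ⟶ (cechBicomplex V F).X 0 where
  f q := cechAug V (F.X q)
  comm' q q' _ := cechAug_naturality V (F.d q q')

lemma cechBicomplexAug_d (F : CochainComplex X.Modules ℤ) :
    cechBicomplexAug V F ≫ (cechBicomplex V F).d 0 1 = 0 := by
  ext q : 1
  change cechAug V (F.X q) ≫ ((cechSheaf V).obj (F.X q)).d 0 1 = 0
  rw [cechSheaf_d]
  exact cechAug_d V (F.X q)

lemma cechBicomplex_bddBy (F : CochainComplex X.Modules ℤ) : (cechBicomplex V F).BddBy r := by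
  intro p hp q
  change IsZero (fam (cap V (p := p)) (F.X q))
  have : IsEmpty (Fin (p + 1) ↪o Fin (r + 1)) := ⟨fun J ↦ by
    have := Fintype.card_le_of_injective J J.injective
    simp at this; omega⟩
  rw [IsZero.iff_id_eq_zero]
  exact hom_ext_sec fun U s ↦ funext fun J ↦ isEmptyElim J

/-- The total complex of the Čech bicomplex is quasi-isomorphic to the original complex. -/
lemma quasiIso_toTotal (hV : ⨆ i, V i = ⊤) (F : CochainComplex X.Modules ℤ) :
    QuasiIso (HomologicalComplex₂.toTotalSingle₀ F ≫ HomologicalComplex₂.total.map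
      (HomologicalComplex₂.ofAug (cechBicomplexAug V F) (cechBicomplexAug_d V F))
        (ComplexShape.up ℤ)) := by
  have : QuasiIso (HomologicalComplex₂.total.map
      (HomologicalComplex₂.ofAug (cechBicomplexAug V F) (cechBicomplexAug_d V F))
        (ComplexShape.up ℤ)) := by
    refine HomologicalComplex₂.quasiIso_total_map (r := r)
      (fun p hp ↦ HomologicalComplex₂.single₀_bddBy F p (by omega)) (cechBicomplex_bddBy V F) _
      fun q ↦ HomologicalComplex₂.quasiIso_colMap_ofAug _ _ q (mono_cechAug V hV _) ?_
        (fun p ↦ cechSheaf_exactAt V hV (F.X q) p)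
    have h := cechAug_exact V hV (F.X q)
    simp only [← cechSheaf_d] at h
    exact h
  infer_instance

end AlgebraicGeometry.Scheme.Modules
end

/-! ### Sections of associated sheaves over basic open subsets -/

noncomputable section

namespace GrMod

open TopologicalSpace TopCat Opposite

variable {A : Type u} [CommRing A] {r : ℕ}

/-- The basic open subset `D₊(f)`. -/
abbrev D (f : PolyRing A r) : (projSpace A r).Opens := Proj.basicOpen (stdGrading A r) f

lemma mem_D {f : PolyRing A r} {x : projSpace A r} :
    x ∈ D f ↔ f ∉ x.asHomogeneousIdeal.toIdeal := Iff.rfl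

lemma D_mul (f g : PolyRing A r) : D (f * g) = D f ⊓ D g := Proj.basicOpen_mul ..

lemma D_add_le (f g : PolyRing A r) : D (f + g) ≤ D f ⊔ D g := by
  intro x hx
  by_contra h
  have h' : ¬ (x ∈ D f ∨ x ∈ D g) := h
  rw [mem_D, mem_D] at h'
  push Not at h'
  exact hx (Ideal.add_mem _ h'.1 h'.2)

lemma mem_irrelevant {f : PolyRing A r} {n : ℕ} (hn : 0 < n) (hf : f ∈ stdGrading A r n) :
    f ∈ HomogeneousIdeal.irrelevant (stdGrading A r) := by
  rw [HomogeneousIdeal.mem_irrelevant_iff, GradedRing.proj_apply,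
    DirectSum.decompose_of_mem_ne _ hf hn.ne']

/-- A homogeneous property which holds locally on `D₊(f)` holds for a power of `f`. -/
lemma exists_pow_of_locally {f : PolyRing A r} {n : ℕ} (hn : 0 < n) (hf : f ∈ stdGrading A r n)
    (T : PolyRing A r → Prop) (h0 : T 0)
    (hadd : ∀ (e : ℕ) (a b : PolyRing A r), a ∈ stdGrading A r e → b ∈ stdGrading A r e →
      T a → T b → T (a + b))
    (hmul : ∀ (e e' : ℕ) (a b : PolyRing A r), a ∈ stdGrading A r e → b ∈ stdGrading A r e' →
      T b → T (a * b))
    (hloc : ∀ x ∈ D f, ∃ (e : ℕ) (h : PolyRing A r), h ∈ stdGrading A r e ∧ x ∈ D h ∧ T h) :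
    ∃ k, T (f ^ k) := by
  classical
  have hsum {ι : Type} (s : Finset ι) (a : ι → PolyRing A r) (e : ℕ)
      (ha : ∀ i ∈ s, a i ∈ stdGrading A r e ∧ T (a i)) :
      (∑ i ∈ s, a i) ∈ stdGrading A r e ∧ T (∑ i ∈ s, a i) := by
    induction s using Finset.induction_on with
    | empty => exact ⟨by simp, by simpa using h0⟩
    | insert i s hi ih =>
      have h1 := ha i (Finset.mem_insert_self _ _)
      have h2 := ih fun j hj ↦ ha j (Finset.mem_insert_of_mem hj)
      rw [Finset.sum_insert hi]
      exact ⟨Submodule.add_mem _ h1.1 h2.1, hadd e _ _ h1.1 h2.1 h1.2 h2.2⟩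
  let pr (n : ℕ) (a : PolyRing A r) : PolyRing A r := DirectSum.decompose (stdGrading A r) a n
  have hpr (n : ℕ) (a : PolyRing A r) : pr n a ∈ stdGrading A r n := SetLike.coe_mem _
  -- The closure properties of T concern homogeneous elements only. Asking T for all homogeneous
  -- components turns them into a homogeneous ideal, and the claim becomes that f lies in its
  -- radical.
  let I : Ideal (PolyRing A r) :=
    { carrier := {a | ∀ n, T (pr n a)}
      zero_mem' := fun n ↦ by simpa [pr] using h0
      add_mem' := fun {a b} ha hb n ↦ by
        have : pr n (a + b) = pr n a + pr n b := by simp [pr]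
        rw [this]; exact hadd n _ _ (hpr _ _) (hpr _ _) (ha n) (hb n)
      smul_mem' := fun c a ha n ↦ by
        change T (pr n (c * a))
        have : pr n (c * a) = ∑ i ∈ Finset.HasAntidiagonal.antidiagonal n, pr i.1 c * pr i.2 a := by
          change (((DirectSum.decompose (stdGrading A r)) (c * a)) n : PolyRing A r) = _
          rw [DirectSum.decompose_mul, DirectSum.coe_mul_apply_eq_sum_antidiagonal]
        rw [this]
        refine (hsum _ _ n fun i hi ↦ ?_).2
        rw [← Finset.HasAntidiagonal.mem_antidiagonal.1 hi]
        exact ⟨SetLike.mul_mem_graded (hpr _ _) (hpr _ _), hmul _ _ _ _ (hpr _ _) (hpr _ _) (ha _)⟩ }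
  have hI : I.IsHomogeneous (stdGrading A r) := by
    intro i a ha j
    change T (pr j (pr i a))
    rcases eq_or_ne i j with rfl | hij
    · have : pr i (pr i a) = pr i a := DirectSum.decompose_of_mem_same _ (hpr i a)
      rw [this]; exact ha i
    · have : pr j (pr i a) = 0 := DirectSum.decompose_of_mem_ne _ (hpr i a) hij
      rw [this]; exact h0
  have hfI : f ∈ I.radical := by
    rw [hI.radical_eq]
    refine Ideal.mem_sInf.2 fun {P} hP ↦ ?_
    obtain ⟨hPh, hIP, hPp⟩ := hP
    by_contra hfP
    -- A homogeneous prime over I that avoids f is a point of D₊(f): it does not contain the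
    -- irrelevant ideal because f has positive degree. The local hypothesis at this point puts into
    -- I an element outside the prime.
    let x : projSpace A r := ⟨⟨P, hPh⟩, hPp, fun h ↦ hfP (h (mem_irrelevant hn hf))⟩
    obtain ⟨e, h, he, hx, hT⟩ := hloc x hfP
    refine hx (hIP fun j ↦ ?_)
    rcases eq_or_ne e j with rfl | hij
    · have : pr e h = h := DirectSum.decompose_of_mem_same _ he
      rw [this]; exact hT
    · have : pr j h = 0 := DirectSum.decompose_of_mem_ne _ he hij
      rw [this]; exact h0
  obtain ⟨k, hk⟩ := hfI
  refine ⟨k, ?_⟩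
  have h1 := hk (k • n)
  have : pr (k • n) (f ^ k) = f ^ k :=
    DirectSum.decompose_of_mem_same _ (SetLike.pow_mem_graded k hf)
  rwa [this] at h1

variable (M : GrMod A r)

lemma smul_mem' {n : ℕ} {j k : ℤ} {f : PolyRing A r} {m : M}
    (hf : f ∈ stdGrading A r n) (hm : m ∈ M.deg j) (hk : n + j = k) : f • m ∈ M.deg k :=
  hk ▸ M.smul_mem hf hm

/-- The fraction `m / s`, as a section of `M~`. -/
def fracSec {U : (projSpace A r).Opens} {e : ℕ} {m : M} {s : PolyRing A r} (hm : m ∈ M.deg e)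
    (hs : s ∈ stdGrading A r e) (hU : U ≤ D s) : M.sections U :=
  ⟨fun x ↦ LocalizedModule.mk m ⟨s, hU x.2⟩,
    fun x ↦ ⟨U, x.2, 𝟙 _, e, m, s, hm, hs, fun y ↦ ⟨hU y.2, rfl⟩⟩⟩

variable {M}

lemma mk_eq_mk_of {x : projSpace A r} {m m' : M} {s s' : PolyRing A r}
    (hs : s ∉ x.asHomogeneousIdeal.toIdeal) (hs' : s' ∉ x.asHomogeneousIdeal.toIdeal)
    (t : PolyRing A r) (ht : t ∉ x.asHomogeneousIdeal.toIdeal) (h : t • s' • m = t • s • m') :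
    (LocalizedModule.mk m ⟨s, hs⟩ : M.locAt x) = LocalizedModule.mk m' ⟨s', hs'⟩ :=
  LocalizedModule.mk_eq.2 ⟨⟨t, ht⟩, h⟩

/-- A homogeneous element whose class vanishes on `D₊(f)` is killed by a power of `f`. -/
lemma exists_pow_smul_eq_zero {f : PolyRing A r} {n : ℕ} (hn : 0 < n) (hf : f ∈ stdGrading A r n)
    {e : ℤ} {m : M} (hm : m ∈ M.deg e)
    (h : ∀ x ∈ D f, ∃ t : PolyRing A r, x ∈ D t ∧ t • m = 0) : ∃ k, f ^ k • m = 0 := by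
  refine exists_pow_of_locally hn hf (fun t ↦ t • m = 0) (zero_smul _ _)
    (fun e a b _ _ ha hb ↦ by rw [add_smul, ha, hb, add_zero])
    (fun e e' a b _ _ hb ↦ by rw [mul_smul, hb, smul_zero]) fun x hx ↦ ?_
  classical
  obtain ⟨t, ht, htm⟩ := h x hx
  -- The annihilator t is not assumed homogeneous, but one of its components does not vanish at x,
  -- and since m is homogeneous each component of t kills m separately.
  have h1 : ∃ i, (DirectSum.decompose (stdGrading A r) t i : PolyRing A r) ∉
      x.asHomogeneousIdeal.toIdeal := by
    by_contra! h'
    apply ht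
    rw [← DirectSum.sum_support_decompose (stdGrading A r) t]
    exact Ideal.sum_mem _ fun i _ ↦ h' i
  obtain ⟨i, hi⟩ := h1
  refine ⟨i, _, SetLike.coe_mem _, hi, ?_⟩
  -- The homogeneous decomposition of t • m, with the component of degree j of t contributing in
  -- degree j + e. Its sum is zero, hence so is every component.
  let y : ℤ →₀ M := ∑ j ∈ (DirectSum.decompose (stdGrading A r) t).support,
    Finsupp.single ((j : ℤ) + e) ((DirectSum.decompose (stdGrading A r) t j : PolyRing A r) • m)
  have hy (j : ℕ) : y (j + e) =
      (DirectSum.decompose (stdGrading A r) t j : PolyRing A r) • m := by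
    rw [Finsupp.finsetSum_apply, Finset.sum_eq_single j, Finsupp.single_eq_same]
    · intro l _ hl
      exact Finsupp.single_eq_of_ne (by simpa using hl.symm)
    · intro hj
      simp [DFinsupp.notMem_support_iff.1 hj]
  have hy0 : y = 0 := by
    refine (exists_of_isInternal M.isInternal).2 y (fun l ↦ ?_) ?_
    · rw [Finsupp.finsetSum_apply]
      refine AddSubgroup.sum_mem _ fun j _ ↦ ?_
      rw [Finsupp.single_apply]
      split_ifs with hl
      · exact M.smul_mem' (SetLike.coe_mem _) hm hl
      · exact AddSubgroup.zero_mem _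
    · have h2 : ∀ y : ℤ →₀ M, (y.sum fun _ z ↦ z) =
          Finsupp.liftAddHom (fun _ ↦ AddMonoidHom.id M) y := fun _ ↦ rfl
      rw [h2, map_sum]
      simp only [Finsupp.liftAddHom_apply_single, AddMonoidHom.id_apply]
      rw [← Finset.sum_smul, DirectSum.sum_support_decompose, htm]
  rw [← hy, hy0]; rfl

lemma exists_pow_smul_eq {f : PolyRing A r} {n : ℕ} (hn : 0 < n) (hf : f ∈ stdGrading A r n)
    {e e' : ℕ} {m m' : M} {s s' : PolyRing A r} (hm : m ∈ M.deg e) (hs : s ∈ stdGrading A r e)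
    (hm' : m' ∈ M.deg e') (hs' : s' ∈ stdGrading A r e')
    (h : ∀ x ∈ D f, ∃ (hx : x ∈ D s) (hx' : x ∈ D s'),
      (LocalizedModule.mk m ⟨s, hx⟩ : M.locAt x) = LocalizedModule.mk m' ⟨s', hx'⟩) :
    ∃ k, f ^ k • s' • m = f ^ k • s • m' := by
  obtain ⟨k, hk⟩ := exists_pow_smul_eq_zero (m := s' • m - s • m') hn hf
    (AddSubgroup.sub_mem _ (M.smul_mem' hs' hm rfl) (M.smul_mem' hs hm' (add_comm _ _))) fun x hx ↦ by
      obtain ⟨h1, h2, h3⟩ := h x hx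
      obtain ⟨t, ht⟩ := LocalizedModule.mk_eq.1 h3
      exact ⟨t.1, t.2, by rw [smul_sub, sub_eq_zero]; exact ht⟩
  exact ⟨k, by rwa [smul_sub, sub_eq_zero] at hk⟩

/-- Every term in the binomial expansion of the power 2K contains h or h' to the power at least K.
Homogeneous coefficients are obtained by taking components of degree K * e, which is the
complementary degree. -/
lemma exists_add_pow {h h' : PolyRing A r} {e : ℕ} (hh : h ∈ stdGrading A r e)
    (hh' : h' ∈ stdGrading A r e) (K : ℕ) : ∃ a b : PolyRing A r, a ∈ stdGrading A r (K * e) ∧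
      b ∈ stdGrading A r (K * e) ∧ (h + h') ^ (2 * K) = a * h ^ K + b * h' ^ K := by
  have h1 : (h + h') ^ (2 * K) ∈ Ideal.span {h ^ K, h' ^ K} :=
    Ideal.add_pow_mem_of_pow_mem_of_le (m := K) (n := K) _ (Ideal.subset_span (by simp))
      (Ideal.subset_span (by simp)) (by omega)
  obtain ⟨a, b, hab⟩ := Ideal.mem_span_pair.1 h1
  have hd : (h + h') ^ (2 * K) ∈ stdGrading A r (K * e + K * e) := by
    have := SetLike.pow_mem_graded (2 * K) (Submodule.add_mem _ hh hh')
    convert this using 2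
    rw [smul_eq_mul]; ring
  have hhK : h ^ K ∈ stdGrading A r (K * e) := SetLike.pow_mem_graded K hh
  have hhK' : h' ^ K ∈ stdGrading A r (K * e) := SetLike.pow_mem_graded K hh'
  refine ⟨DirectSum.decompose (stdGrading A r) a (K * e),
    DirectSum.decompose (stdGrading A r) b (K * e), SetLike.coe_mem _, SetLike.coe_mem _, ?_⟩
  rw [← DirectSum.decompose_of_mem_same _ hd, ← hab, DirectSum.decompose_add, DirectSum.add_apply,
    Submodule.coe_add, DirectSum.coe_decompose_mul_add_of_right_mem _ hhK,
    DirectSum.coe_decompose_mul_add_of_right_mem _ hhK']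

instance (x : projSpace A r) : x.asHomogeneousIdeal.toIdeal.IsPrime := x.isPrime

lemma pow_mem_D {f : PolyRing A r} {x : projSpace A r} (hx : x ∈ D f) (k : ℕ) :
    f ^ k ∉ x.asHomogeneousIdeal.toIdeal :=
  x.asHomogeneousIdeal.toIdeal.primeCompl.pow_mem hx k

/-- The section `σ` is a fraction with a power of `g` as its denominator on `D₊(g)`. -/
def FracOn {U : (projSpace A r).Opens} (σ : M.sections U) (g : PolyRing A r) (n k : ℕ) : Prop :=
  ∃ m : M, m ∈ M.deg (k * n : ℕ) ∧ ∀ (x : U) (hx : x.1 ∈ D g),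
    σ.1 x = LocalizedModule.mk m ⟨g ^ k, pow_mem_D hx k⟩

namespace FracOn

variable {U : (projSpace A r).Opens} {σ : M.sections U} {f g : PolyRing A r} {n k e : ℕ}

lemma mul (h : FracOn σ g n k) (hg : f ∈ stdGrading A r e) : FracOn σ (f * g) (e + n) k := by
  obtain ⟨m, hm, h⟩ := h
  refine ⟨f ^ k • m, M.smul_mem' (SetLike.pow_mem_graded k hg) hm
    (by push_cast [smul_eq_mul]; ring), fun x hx ↦ ?_⟩
  have hx' := hx
  rw [D_mul] at hx'
  rw [h x hx'.2]
  exact mk_eq_mk_of _ _ 1 (one_mem x.1.asHomogeneousIdeal.toIdeal.primeCompl)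
    (by simp only [one_smul, smul_smul]; congr 1; ring)

lemma raise (h : FracOn σ g n k) (hg : g ∈ stdGrading A r n) (j : ℕ) :
    FracOn σ g n (j + k) := by
  obtain ⟨m, hm, h⟩ := h
  refine ⟨g ^ j • m, M.smul_mem' (SetLike.pow_mem_graded j hg) hm
    (by push_cast [smul_eq_mul]; ring), fun x hx ↦ ?_⟩
  rw [h x hx]
  exact mk_eq_mk_of _ _ 1 (one_mem x.1.asHomogeneousIdeal.toIdeal.primeCompl)
    (by simp only [one_smul, smul_smul]; congr 1; ring)

lemma congr_pow {l : ℕ} (h : FracOn σ (g ^ l) (l * n) k) (hl : l ≠ 0) : FracOn σ g n (l * k) := by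
  obtain ⟨m, hm, h⟩ := h
  refine ⟨m, by convert hm using 3; ring, fun x hx ↦ ?_⟩
  rw [h x (pow_mem_D hx l)]
  congr 2
  exact (pow_mul _ _ _).symm

/-- A partition of unity. After raising exponents to K, σ is M₁/(fh)^K and M₁'/(fh')^K with (fh')^K
M₁ = (fh)^K M₁' exactly. Writing (h+h')^{2K} = a h^K + b h'^K, the numerator f^K(a M₁ + b M₁') over
(f(h+h'))^{2K} represents σ on both pieces. -/
lemma add {h h' : PolyRing A r} (hn : 0 < n) (hf : f ∈ stdGrading A r n)
    (hh : h ∈ stdGrading A r e) (hh' : h' ∈ stdGrading A r e) (hU : D f ≤ U)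
    (H : FracOn σ (f * h) (n + e) k) (H' : FracOn σ (f * h') (n + e) k) :
    ∃ k', FracOn σ (f * (h + h')) (n + e) k' := by
  have hG := SetLike.mul_mem_graded hf hh
  have hG' := SetLike.mul_mem_graded hf hh'
  obtain ⟨m, hm, H⟩ := H
  obtain ⟨m', hm', H'⟩ := H'
  obtain ⟨j, hj⟩ := exists_pow_smul_eq (f := (f * h) * (f * h')) (by omega)
    (SetLike.mul_mem_graded hG hG') hm (SetLike.pow_mem_graded k hG) hm'
    (SetLike.pow_mem_graded k hG') fun x hx ↦ by
      rw [D_mul] at hx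
      have hx2 := hx.1
      rw [D_mul] at hx2
      exact ⟨pow_mem_D hx.1 k, pow_mem_D hx.2 k,
        (H ⟨x, hU hx2.1⟩ hx.1).symm.trans (H' ⟨x, hU hx2.1⟩ hx.2)⟩
  obtain ⟨a, b, ha, hb, hab⟩ := exists_add_pow hh hh' (k + j)
  -- `σ = M₁ / (f h) ^ K = M₁' / (f h') ^ K` where `K = k + j`
  have key : (f * h') ^ (k + j) • (f * h) ^ j • m = (f * h) ^ (k + j) • (f * h') ^ j • m' := by
    have h1 := hj
    simp only [smul_smul] at h1 ⊢
    convert h1 using 2 <;> ring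
  refine ⟨2 * (k + j), f ^ (k + j) • (a • (f * h) ^ j • m + b • (f * h') ^ j • m'), ?_, ?_⟩
  · have hd (c : PolyRing A r) (hc : c ∈ stdGrading A r ((k + j) * e)) (l : PolyRing A r)
        (hl : l ∈ stdGrading A r (n + e)) (z : M) (hz : z ∈ M.deg (k * (n + e) : ℕ)) :
        c • l ^ j • z ∈ M.deg (((k + j) * e + j * (n + e) + k * (n + e) : ℕ)) := by
      refine M.smul_mem' hc (M.smul_mem' (SetLike.pow_mem_graded j hl) hz rfl) ?_
      push_cast [smul_eq_mul]; ring
    refine M.smul_mem' (SetLike.pow_mem_graded _ hf)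
      (AddSubgroup.add_mem _ (hd a ha _ hG m hm) (hd b hb _ hG' m' hm')) ?_
    push_cast [smul_eq_mul]; ring
  · intro x hx
    have hx' := hx
    rw [D_mul] at hx'
    rcases D_add_le h h' hx'.2 with hy | hy
    · have hz : x.1 ∈ D (f * h) := by rw [D_mul]; exact ⟨hx'.1, hy⟩
      rw [H x hz]
      refine mk_eq_mk_of _ _ ((f * h) ^ j) (pow_mem_D hz j) ?_
      have e1 : (f * h) ^ (k + j) • (a • (f * h) ^ j • m + b • (f * h') ^ j • m') =
          (f ^ (k + j) * (h + h') ^ (2 * (k + j))) • (f * h) ^ j • m := by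
        rw [smul_add, smul_comm _ b, ← key, hab]
        simp only [smul_smul, ← add_smul]
        congr 1
        ring
      have e2 : ((f * h) ^ j) • (f * h) ^ k •
          f ^ (k + j) • (a • (f * h) ^ j • m + b • (f * h') ^ j • m') =
          (f ^ (k + j)) •
          (f * h) ^ (k + j) • (a • (f * h) ^ j • m + b • (f * h') ^ j • m') := by
        simp only [smul_smul]
        congr 1
        ring
      rw [e2, e1, mul_pow f (h + h')]
      simp only [smul_smul]
      congr 1
      ring
    · have hz : x.1 ∈ D (f * h') := by rw [D_mul]; exact ⟨hx'.1, hy⟩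
      rw [H' x hz]
      refine mk_eq_mk_of _ _ ((f * h') ^ j) (pow_mem_D hz j) ?_
      have e1 : (f * h') ^ (k + j) • (a • (f * h) ^ j • m + b • (f * h') ^ j • m') =
          (f ^ (k + j) * (h + h') ^ (2 * (k + j))) • (f * h') ^ j • m' := by
        rw [smul_add, smul_comm _ a, key, hab]
        simp only [smul_smul, ← add_smul]
        congr 1
        ring
      have e2 : ((f * h') ^ j) • (f * h') ^ k •
          f ^ (k + j) • (a • (f * h) ^ j • m + b • (f * h') ^ j • m') =
          (f ^ (k + j)) •
          (f * h') ^ (k + j) • (a • (f * h) ^ j • m + b • (f * h') ^ j • m') := by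
        simp only [smul_smul]
        congr 1
        ring
      rw [e2, e1, mul_pow f (h + h')]
      simp only [smul_smul]
      congr 1
      ring

end FracOn

lemma exists_D_le {V : (projSpace A r).Opens} {x : projSpace A r} (hx : x ∈ V) :
    ∃ (t : PolyRing A r) (l : ℕ), t ∈ stdGrading A r l ∧ x ∈ D t ∧ D t ≤ V := by
  obtain ⟨_, ⟨f, rfl⟩, hxf, hf⟩ := (ProjectiveSpectrum.isTopologicalBasis_basic_opens
    (stdGrading A r)).exists_subset_of_mem_open hx V.isOpen
  have h1 : x ∈ ProjectiveSpectrum.basicOpen (stdGrading A r) f := hxf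
  rw [ProjectiveSpectrum.basicOpen_eq_union_of_projection] at h1
  obtain ⟨i, hi⟩ := Opens.mem_iSup.1 h1
  refine ⟨_, i, SetLike.coe_mem (DirectSum.decompose (stdGrading A r) f i), hi, ?_⟩
  refine le_trans ?_ (show D f ≤ V from hf)
  change ProjectiveSpectrum.basicOpen _ _ ≤ ProjectiveSpectrum.basicOpen _ _
  rw [ProjectiveSpectrum.basicOpen_eq_union_of_projection (stdGrading A r) f]
  exact le_iSup (fun i ↦ ProjectiveSpectrum.basicOpen (stdGrading A r) (GradedRing.proj (stdGrading A r) i f)) i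

/-- Sections of `M~` over `D₊(f)` are fractions with a power of `f` as their denominator. -/
lemma exists_fracOn {U : (projSpace A r).Opens} (σ : M.sections U) {f : PolyRing A r} {n : ℕ}
    (hn : 0 < n) (hf : f ∈ stdGrading A r n) (hU : D f ≤ U) : ∃ k, FracOn σ f n k := by
  have h0 (e : ℕ) : ∃ k, FracOn σ (f * 0) (n + e) k :=
    ⟨0, 0, AddSubgroup.zero_mem _, fun x hx ↦ by
      rw [mul_zero, mem_D] at hx; exact absurd (Ideal.zero_mem _) hx⟩
  -- The property of h to which `exists_pow_of_locally` applies is that σ is a fraction over D₊(fh)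
  -- with a power of fh below. It is stated for every degree e of h, because 0 is homogeneous of
  -- every degree; nonzero elements have only one.
  suffices h : ∃ l, ∀ e, f ^ l ∈ stdGrading A r e → ∃ k, FracOn σ (f * f ^ l) (n + e) k by
    obtain ⟨l, hl⟩ := h
    obtain ⟨k, hk⟩ := hl _ (SetLike.pow_mem_graded l hf)
    refine ⟨_, FracOn.congr_pow (l := l + 1) (n := n) (k := k) ?_ (by omega)⟩
    convert hk using 1
    · ring
    · rw [smul_eq_mul]; ring
  refine exists_pow_of_locally hn hf
    (fun h ↦ ∀ e, h ∈ stdGrading A r e → ∃ k, FracOn σ (f * h) (n + e) k) (fun e _ ↦ h0 e) ?_ ?_ ?_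
  · intro e a b ha hb h1 h2 e' hab
    by_cases hz : a + b = 0
    · rw [hz]; exact h0 e'
    obtain rfl := DirectSum.degree_eq_of_mem_mem _ (Submodule.add_mem _ ha hb) hab hz
    obtain ⟨k, hk⟩ := h1 e ha
    obtain ⟨k', hk'⟩ := h2 e hb
    have hk2 := hk.raise (SetLike.mul_mem_graded hf ha) k'
    have hk2' := hk'.raise (SetLike.mul_mem_graded hf hb) k
    rw [add_comm k k'] at hk2'
    exact FracOn.add hn hf ha hb hU hk2 hk2'
  · intro e e' a b ha hb h1 e'' hab
    by_cases hz : a * b = 0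
    · rw [hz]; exact h0 e''
    obtain rfl := DirectSum.degree_eq_of_mem_mem _ (SetLike.mul_mem_graded ha hb) hab hz
    obtain ⟨k, hk⟩ := h1 e' hb
    refine ⟨k, ?_⟩
    convert hk.mul ha using 1 <;> ring
  · intro x hx
    obtain ⟨V, hV, i, e, m, s, hm, hs, h⟩ := σ.2 ⟨x, hU hx⟩
    obtain ⟨t, l, htl, hxt, htV⟩ : ∃ (t : PolyRing A r) (l : ℕ), t ∈ stdGrading A r l ∧ x ∈ D t ∧
        D t ≤ V := exists_D_le hV
    -- Near x the section is m/s on V, and t cuts V down to a basic open. On D₊(fts) the first power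
    -- suffices, with numerator ftm.
    refine ⟨l + e, t * s, SetLike.mul_mem_graded htl hs, ?_, fun e' he' ↦ ⟨1, ?_⟩⟩
    · rw [D_mul]; exact ⟨hxt, (h ⟨x, hV⟩).1⟩
    have hz : t * s ≠ 0 := by
      intro h0
      have : x ∈ D (t * s) := by rw [D_mul]; exact ⟨hxt, (h ⟨x, hV⟩).1⟩
      rw [h0, mem_D] at this
      exact this (Ideal.zero_mem _)
    obtain rfl := DirectSum.degree_eq_of_mem_mem _ (SetLike.mul_mem_graded htl hs) he' hz
    refine ⟨(f * t) • m, M.smul_mem' (SetLike.mul_mem_graded hf htl) hm (by push_cast; ring),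
      fun y hy ↦ ?_⟩
    rw [D_mul, D_mul] at hy
    obtain ⟨h1, h2⟩ := h ⟨y.1, htV hy.2.1⟩
    refine h2.trans (mk_eq_mk_of _ _ 1 (one_mem y.1.asHomogeneousIdeal.toIdeal.primeCompl) ?_)
    simp only [one_smul, smul_smul]; congr 1; ring

end GrMod
end

/-! ### Vanishing of cohomology on basic open subsets and their unions -/

noncomputable section

namespace GrMod

open TopologicalSpace TopCat Opposite

variable {A : Type u} [CommRing A] {r : ℕ}

open Scheme.Modules in
/-- Sections of `M~` over `D₊(f h h')` are sums of sections over `D₊(f h)` and `D₊(f h')` if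
`D₊(f) ⊆ D₊(h + h')`. -/
lemma exists_res_sub_res (M : GrMod A r) {n e : ℕ} {f h h' : PolyRing A r} (hn : 0 < n)
    (hf : f ∈ stdGrading A r n) (hh : h ∈ stdGrading A r e) (hh' : h' ∈ stdGrading A r e)
    (hD : D f ≤ D (h + h')) {U U' W : (projSpace A r).Opens} (hU : U ≤ D (f * h))
    (hU' : U' ≤ D (f * h')) (hW : D (f * h) ⊓ D (f * h') ≤ W) (hWU : W ≤ U) (hWU' : W ≤ U')
    (s : Γ(M.tildeObj, W)) : ∃ (a : Γ(M.tildeObj, U)) (b : Γ(M.tildeObj, U')),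
      M.tildeObj.res hWU a - M.tildeObj.res hWU' b = s := by
  have hle : D (f * h * h') ≤ W := by
    refine le_trans (le_of_eq ?_) hW
    rw [D_mul, D_mul, D_mul, ← inf_inf_distrib_left, inf_assoc]
  have hG : f * h * h' ∈ stdGrading A r (n + e + e) :=
    SetLike.mul_mem_graded (SetLike.mul_mem_graded hf hh) hh'
  obtain ⟨k, m, hm, hs⟩ := exists_fracOn (M := M) (U := W) s (by omega) hG hle
  -- With (h+h')^{2k} = a h^k + b h'^k, a unit on D₊(f), the fraction m/(fhh')^k splits as
  -- bm/((h+h')^{2k}(fh)^k) + am/((h+h')^{2k}(fh')^k), whose terms extend to U and U'.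
  obtain ⟨a, b, ha, hb, hab⟩ := exists_add_pow hh hh' k
  have hd (t : PolyRing A r) (ht : t ∈ stdGrading A r e) :
      (h + h') ^ (2 * k) * (f * t) ^ k ∈ stdGrading A r (k * e + k * (n + e + e)) := by
    have := SetLike.mul_mem_graded (SetLike.pow_mem_graded (2 * k) (Submodule.add_mem _ hh hh'))
      (SetLike.pow_mem_graded k (SetLike.mul_mem_graded hf ht))
    convert this using 2
    simp only [smul_eq_mul]; ring
  have hdm (c : PolyRing A r) (hc : c ∈ stdGrading A r (k * e)) :
      c • m ∈ M.deg ((k * e + k * (n + e + e) : ℕ)) := M.smul_mem' hc hm (by push_cast; ring)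
  have hV {V : (projSpace A r).Opens} {t : PolyRing A r} (hVt : V ≤ D (f * t)) :
      V ≤ D ((h + h') ^ (2 * k) * (f * t) ^ k) := by
    intro x hx
    have h1 := hVt hx
    have h2 := h1
    rw [D_mul] at h1
    exact x.asHomogeneousIdeal.toIdeal.primeCompl.mul_mem (pow_mem_D (hD h1.1) _) (pow_mem_D h2 _)
  let S : Γ(M.tildeObj, U') := M.fracSec (hdm a ha) (hd h' hh') (hV hU')
  refine ⟨M.fracSec (hdm b hb) (hd h hh) (hV hU), -S, ?_⟩
  rw [map_neg, sub_neg_eq_add]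
  refine Subtype.ext (funext fun x ↦ ?_)
  have hx : x.1 ∈ D (f * h * h') := by
    have h1 := hU (hWU x.2)
    have h2 := hU' (hWU' x.2)
    rw [D_mul] at h2 ⊢
    exact ⟨h1, h2.2⟩
  refine Eq.trans (LocalizedModule.mk_add_mk ..) (Eq.trans ?_ (hs x hx).symm)
  refine mk_eq_mk_of _ _ 1 (one_mem x.1.asHomogeneousIdeal.toIdeal.primeCompl) ?_
  simp only [one_smul, Submonoid.smul_def, smul_smul, ← add_smul]
  congr 1
  linear_combination (-(h + h') ^ (2 * k) * f ^ (2 * k) * h ^ k * h' ^ k) * hab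

end GrMod

namespace AlgebraicGeometry.Scheme.Modules

open TopologicalSpace TopCat Opposite GrMod Abelian

section
variable {X : Scheme.{u}}

lemma H_bot_eq_zero (F : X.Modules) {n : ℕ} (α : F.H ⊥ n) : α = 0 := by
  have : 𝟙 ((extZero X).obj ⊥) = 0 := (extZeroEquiv _ _).injective
    (eq_of_locally_eq _ _ _ fun x hx ↦ hx.elim)
  rw [← Ext.mk₀_id_comp α, this, Ext.mk₀_zero, Ext.zero_comp]
end

variable {A : Type u} [CommRing A] {r : ℕ}

/-- Čech-type criterion for the vanishing of the cohomology on `D₊(g)`. -/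
lemma H_D_eq_zero (F : (projSpace A r).Modules)
    (hF : ∀ (n e : ℕ) (f h h' : PolyRing A r), 0 < n → f ∈ stdGrading A r n →
      h ∈ stdGrading A r e → h' ∈ stdGrading A r e → D f ≤ D (h + h') →
      ∀ s : Γ(F, D (f * h) ⊓ D (f * h')), ∃ (a : Γ(F, D (f * h))) (b : Γ(F, D (f * h'))),
        F.res inf_le_left a - F.res inf_le_right b = s) (k : ℕ) {n : ℕ} (hn : 0 < n)
    {g : PolyRing A r} (hg : g ∈ stdGrading A r n) {U : (projSpace A r).Opens} (hU : U = D g)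
    (α : F.H U (k + 1)) : α = 0 := by
  subst hU
  induction k using Nat.strong_induction_on generalizing n g with
  | _ k ih =>
  have hle (h : PolyRing A r) : D (g * h) ≤ D g := by rw [D_mul]; exact inf_le_left
  -- The homogeneous h for which α dies on D₊(gh) are stable under sums and multiples, and they
  -- exist near each point because classes of positive degree die locally. So some power of g is one
  -- of them, and D₊(g · g^l) is D₊(g).
  obtain ⟨l, hl⟩ := exists_pow_of_locally hn hg (fun h ↦ F.resH (hle h) α = 0) (by
      have : D (g * 0) = ⊥ := by rw [mul_zero]; exact Proj.basicOpen_zero _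
      generalize_proofs h
      revert h
      rw [this]
      exact fun h ↦ H_bot_eq_zero F _)
    (fun e h h' hh hh' h1 h2 ↦ by
      have hgh := SetLike.mul_mem_graded hg (Submodule.add_mem _ hh hh')
      -- The factor h + h' is kept in both pieces: it makes D₊(g(h+h')) their union and supplies the
      -- hypothesis needed to split sections. In higher degrees the intersection of the pieces is
      -- again a basic open, handled by induction.
      have hU : D (g * (h + h') * h) ≤ D (g * h) := by
        simp only [D_mul]; exact inf_le_inf_right _ inf_le_left
      have hU' : D (g * (h + h') * h') ≤ D (g * h') := by
        simp only [D_mul]; exact inf_le_inf_right _ inf_le_left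
      have hsup : D (g * (h + h')) ≤ D (g * (h + h') * h) ⊔ D (g * (h + h') * h') := by
        rw [D_mul (g * (h + h')), D_mul (g * (h + h')), ← inf_sup_left]
        refine le_inf le_rfl (le_trans ?_ (D_add_le h h'))
        rw [D_mul]; exact inf_le_right
      have key : F.resH (sup_le (hU.trans (hle h)) (hU'.trans (hle h'))) α = 0 := by
        apply eq_zero_of_resH_eq_zero
        · rw [resH_resH, ← F.resH_resH (hle h) hU, h1, resH_zero]
        · rw [resH_resH, ← F.resH_resH (hle h') hU', h2, resH_zero]
        · exact fun _ s ↦ hF _ e _ h h' (Nat.add_pos_left hn e) hgh hh hh'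
            (by rw [D_mul]; exact inf_le_right) s
        · intro hk
          obtain ⟨k, rfl⟩ := Nat.exists_eq_succ_of_ne_zero hk
          have e1 : D (g * (h + h') * h) ⊓ D (g * (h + h') * h') =
              D ((g * (h + h') * h) * (g * (h + h') * h')) := (D_mul _ _).symm
          rw [e1]
          exact ih k (by omega) (by omega)
            (SetLike.mul_mem_graded (SetLike.mul_mem_graded hgh hh)
              (SetLike.mul_mem_graded hgh hh'))
      rw [← F.resH_resH (sup_le (hU.trans (hle h)) (hU'.trans (hle h'))) hsup, key, resH_zero])
    (fun e e' h h' _ _ h2 ↦ by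
      have hU : D (g * (h * h')) ≤ D (g * h') := by
        simp only [D_mul]; exact inf_le_inf_left _ inf_le_right
      rw [← F.resH_resH (hle h') hU, h2, resH_zero])
    (fun x hx ↦ by
      obtain ⟨V, hV, hxV, h⟩ := exists_resH_eq_zero F α x hx
      obtain ⟨t, l, ht, hxt, htV⟩ := exists_D_le hxV
      refine ⟨l, t, ht, hxt, ?_⟩
      have hU : D (g * t) ≤ V := by rw [D_mul]; exact inf_le_right.trans htV
      rw [← F.resH_resH hV hU, h, resH_zero])
  have hgl : D g ≤ D (g * g ^ l) := by
    intro x hx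
    rw [D_mul]
    exact ⟨hx, pow_mem_D hx l⟩
  rw [← resH_self F le_rfl α, ← F.resH_resH (hle (g ^ l)) hgl, hl, resH_zero]

/-- The sheaf `U ↦ M~(U ∩ V)` has no higher cohomology on a finite union of basic open
subsets `D₊(g₀) ∪ D₊(g₁) ∪ ⋯` if the intersections of `V` with all of them are contained in
`D₊(g₀)`. -/
lemma H_fam_iSup_eq_zero (M : GrMod A r) {v : PolyRing A r} {l : ℕ} (hv : v ∈ stdGrading A r l)
    (N : ℕ) (k : ℕ) {g : PolyRing A r} {n : ℕ} (hn : 0 < n) (hg : g ∈ stdGrading A r n)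
    (f : Fin N → PolyRing A r) (m : Fin N → ℕ) (hm : ∀ i, 0 < m i)
    (hf : ∀ i, f i ∈ stdGrading A r (m i))
    (hD : ∀ i, D (f i) ⊓ D v ≤ D g)
    {U : (projSpace A r).Opens} (hU : U = D g ⊔ ⨆ i, D (f i))
    (α : (fam (fun _ : Unit ↦ D v) M.tildeObj).H U (k + 1)) : α = 0 := by
  have h0 {n : ℕ} {g : PolyRing A r} (hn : 0 < n) (hg : g ∈ stdGrading A r n) (k : ℕ)
      {U : (projSpace A r).Opens} (hU : U = D g)
      (α : (fam (fun _ : Unit ↦ D v) M.tildeObj).H U (k + 1)) : α = 0 := by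
    refine H_D_eq_zero _ (fun n e f h h' hn hf hh hh' hD s ↦ ?_) k hn hg hU α
    obtain ⟨a, b, hab⟩ := exists_res_sub_res M (f := f * v) (h := h) (h' := h')
      (U := D (f * h) ⊓ D v) (U' := D (f * h') ⊓ D v) (W := D (f * h) ⊓ D (f * h') ⊓ D v)
      (Nat.add_pos_left hn l)
      (SetLike.mul_mem_graded hf hv) hh hh' (le_trans (by rw [D_mul]; exact inf_le_left) hD)
      (by simp only [D_mul]; exact le_inf (inf_le_inf_right _ inf_le_left)
            (inf_le_left.trans inf_le_right))
      (by simp only [D_mul]; exact le_inf (inf_le_inf_right _ inf_le_left)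
            (inf_le_left.trans inf_le_right))
      (by
        simp only [D_mul]
        refine le_inf (inf_le_inf ?_ ?_) (inf_le_left.trans (inf_le_left.trans inf_le_right)) <;>
        exact inf_le_inf_right _ inf_le_left)
      (inf_le_inf_right _ inf_le_left) (inf_le_inf_right _ inf_le_right) (s ())
    exact ⟨fun _ ↦ a, fun _ ↦ b, funext fun _ ↦ hab⟩
  subst hU
  induction N generalizing k n g with
  | zero => exact h0 hn hg k (by simp) α
  | succ N ih =>
    have hW : D g ⊔ ⨆ i, D (f i) = (D g ⊔ ⨆ i : Fin N, D (f i.castSucc)) ⊔ D (f (Fin.last N)) := by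
      rw [sup_assoc]
      congr 1
      refine le_antisymm (iSup_le fun i ↦ ?_) (sup_le (iSup_le fun i ↦ le_iSup (fun i ↦ D (f i)) _)
        (le_iSup (fun i ↦ D (f i)) _))
      induction i using Fin.lastCases with
      | last => exact le_sup_right
      | cast i => exact le_sup_of_le_left (le_iSup (fun i : Fin N ↦ D (f i.castSucc)) i)
    revert α
    rw [hW]
    intro α
    apply eq_zero_of_resH_eq_zero
    · exact ih k hn hg (fun i ↦ f i.castSucc) (fun i ↦ m i.castSucc) (fun i ↦ hm _)
        (fun i ↦ hf _) (fun i ↦ hD _) _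
    · exact h0 (hm _) (hf _) k rfl _
    -- Since D₊(f_N) ∩ D₊(v) ⊆ D₊(g), restricting to the intersection of the two pieces does not
    -- change the part of D₊(f_N) that the sheaf sees. A section there is already a section over
    -- D₊(f_N).
    · intro _ s
      have hle : D (f (Fin.last N)) ⊓ D v ≤
          (D g ⊔ ⨆ i : Fin N, D (f i.castSucc)) ⊓ D (f (Fin.last N)) ⊓ D v :=
        le_inf (le_inf ((hD _).trans le_sup_left) inf_le_left) inf_le_right
      let t : Γ(fam (fun _ : Unit ↦ D v) M.tildeObj, D (f (Fin.last N))) :=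
        fun _ ↦ M.tildeObj.res hle (s ())
      refine ⟨0, -t, ?_⟩
      rw [map_zero, map_neg, zero_sub, neg_neg]
      refine funext fun _ ↦ ?_
      exact (M.tildeObj.res_res _ _ _).trans (M.tildeObj.res_self _ _)
    · intro hk
      obtain ⟨k, rfl⟩ := Nat.exists_eq_succ_of_ne_zero hk
      -- The intersection is a union of the same kind, with one basic open fewer and all elements
      -- multiplied by the last one, so the induction on N applies to it, in one cohomological
      -- degree less.
      have e1 : (D g ⊔ ⨆ i : Fin N, D (f i.castSucc)) ⊓ D (f (Fin.last N)) =
          D (g * f (Fin.last N)) ⊔ ⨆ i : Fin N, D (f i.castSucc * f (Fin.last N)) := by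
        simp only [D_mul]
        rw [inf_sup_right, iSup_inf_eq]
      rw [e1]
      refine ih k (Nat.add_pos_left hn _) (SetLike.mul_mem_graded hg (hf (Fin.last N)))
        (fun i ↦ f i.castSucc * f (Fin.last N)) (fun i ↦ m i.castSucc + m (Fin.last N))
        (fun i ↦ Nat.add_pos_left (hm _) _)
        (fun i ↦ SetLike.mul_mem_graded (hf _) (hf _)) (fun i ↦ ?_)
      simp only [D_mul]
      exact le_inf ((inf_le_inf_right _ inf_le_left).trans (hD _))
        (inf_le_left.trans inf_le_right)

end AlgebraicGeometry.Scheme.Modules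
end

/-! ### Acyclic sheaves for the direct image, and the projection to Spec A -/

noncomputable section

namespace AlgebraicGeometry.Scheme.Modules

open TopologicalSpace TopCat Opposite GrMod Abelian

section
variable {X Y : Scheme.{u}}

/-- The sheaves of modules without higher cohomology on the members of a family of open subsets. -/
def acyclicOn {ι : Type*} (B : ι → X.Opens) : ObjectProperty X.Modules :=
  fun F ↦ ∀ (i : ι) (n : ℕ) (α : F.H (B i) (n + 1)), α = 0

/-- Sheaves that are acyclic on the preimages of the members of a basis are adapted to the
pushforward. -/
lemma isAdaptedTo_pushforward (f : X ⟶ Y) {ι : Type*} (B : ι → Y.Opens)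
    (hB : ∀ (U : Y.Opens) (x : Y), x ∈ U → ∃ i, x ∈ B i ∧ B i ≤ U) :
    (acyclicOn fun i ↦ f ⁻¹ᵁ B i).IsAdaptedTo (pushforward f) where
  of_injective I _ i n α := Ext.eq_zero_of_injective α
  of_iso {F G} e hF i n α := by
    have h := hF i n (α.comp (Ext.mk₀ e.inv) (add_zero _))
    have h2 := congr(($h).comp (Ext.mk₀ e.hom) (add_zero _))
    rwa [Ext.zero_comp, Ext.comp_assoc_of_third_deg_zero, Ext.mk₀_comp_mk₀, e.inv_hom_id,
      Ext.comp_mk₀_id] at h2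
  biprod {F G} hF hG i n α := by
    have h : α.comp (Ext.mk₀ (𝟙 (F ⊞ G))) (add_zero _) = 0 := by
      rw [← biprod.total, Ext.mk₀_add, Ext.comp_add, ← Ext.mk₀_comp_mk₀, ← Ext.mk₀_comp_mk₀,
        ← Ext.comp_assoc_of_third_deg_zero, ← Ext.comp_assoc_of_third_deg_zero,
        hF i n (α.comp _ _), hG i n (α.comp _ _), Ext.zero_comp, Ext.zero_comp, add_zero]
    rwa [Ext.comp_mk₀_id] at h
  shortExact_map S hS h1 := by
    have := hS.mono_f
    have hmono : Mono ((pushforward f).map S.f) := inferInstance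
    have hex := hS.exact.map_of_mono_of_preservesKernel (pushforward f) hS.mono_f inferInstance
    refine { exact := hex, mono_f := hmono, epi_g := ?_ }
    change Epi ((pushforward f).map S.g)
    rw [epi_iff_locally_surjective]
    intro U s x hx
    obtain ⟨i, hxi, hi⟩ := hB U x hx
    refine ⟨B i, hi, hxi, ?_⟩
    let s' : Γ(S.X₃, f ⁻¹ᵁ B i) := S.X₃.res (show f ⁻¹ᵁ B i ≤ f ⁻¹ᵁ U from fun y hy ↦ hi hy) s
    -- The obstruction to lifting s' lies in the first cohomology of the subobject over the preimage
    -- of B i, which vanishes.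
    obtain ⟨β, hβ⟩ := Ext.covariant_sequence_exact₃ _ hS (S.X₃.secClass s') rfl (h1 i 0 _)
    obtain ⟨t, rfl⟩ := exists_secClass _ β
    rw [secClass_comp] at hβ
    exact ⟨t, S.X₃.secClass_injective hβ⟩
  of_shortExact S hS h1 h2 i n α := by
    obtain ⟨β, rfl⟩ := Ext.covariant_sequence_exact₃ _ hS α rfl (h1 i (n + 1) _)
    rw [h2 i n β, Ext.zero_comp]

/-- The inclusion of one component in `fam W F`. -/
def famSingle {ι : Type} (W : ι → X.Opens) (F : X.Modules) [DecidableEq ι] (i : ι) :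
    fam (fun _ : Unit ↦ W i) F ⟶ fam W F :=
  homMk (fun U ↦
    { toFun := fun (s : Fam (fun _ : Unit ↦ W i) F U) ↦
        (Pi.single (M := fun i ↦ Γ(F, U ⊓ W i)) i (s ()) : Fam W F U)
      map_zero' := Pi.single_zero _
      map_add' := fun _ _ ↦ Pi.single_add _ _ _ })
    (fun U U' h s ↦ funext fun j ↦ by
      change Pi.single (M := fun i ↦ Γ(F, U' ⊓ W i)) i (F.res _ (s ())) j =
        F.res _ (Pi.single (M := fun i ↦ Γ(F, U ⊓ W i)) i (s ()) j)
      rcases eq_or_ne j i with rfl | hj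
      · rw [Pi.single_eq_same, Pi.single_eq_same]
      · rw [Pi.single_eq_of_ne hj, Pi.single_eq_of_ne hj, map_zero])
    (fun U a s ↦ funext fun j ↦ by
      change Pi.single (M := fun i ↦ Γ(F, U ⊓ W i)) i
        ((X.presheaf.map (homOfLE (inf_le_left : U ⊓ W i ≤ U)).op a) • (s ())) j =
        (X.presheaf.map (homOfLE (inf_le_left : U ⊓ W j ≤ U)).op a) •
          (Pi.single (M := fun i ↦ Γ(F, U ⊓ W i)) i (s ()) j)
      rcases eq_or_ne j i with rfl | hj
      · rw [Pi.single_eq_same, Pi.single_eq_same]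
      · rw [Pi.single_eq_of_ne hj, Pi.single_eq_of_ne hj, smul_zero])

/-- The projection to one component of `fam W F`. -/
def famProj {ι : Type} (W : ι → X.Opens) (F : X.Modules) (i : ι) :
    fam W F ⟶ fam (fun _ : Unit ↦ W i) F :=
  homMk (fun U ↦
    { toFun := fun (s : Fam W F U) ↦ ((fun _ ↦ s i) : Fam (fun _ : Unit ↦ W i) F U)
      map_zero' := rfl
      map_add' := fun _ _ ↦ rfl })
    (fun _ _ _ _ ↦ rfl) (fun _ _ _ ↦ rfl)

lemma sec_sum {F G : X.Modules} {κ : Type*} (s : Finset κ) (f : κ → (F ⟶ G)) {U : X.Opens}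
    (t : Γ(F, U)) : sec (∑ i ∈ s, f i) U t = ∑ i ∈ s, sec (f i) U t := by
  classical
  induction s using Finset.induction_on with
  | empty => simp only [Finset.sum_empty]; exact sec_zero ..
  | insert i s hi ih => rw [Finset.sum_insert hi, Finset.sum_insert hi, sec_add, ih]

lemma sum_famProj_famSingle {ι : Type} [Fintype ι] [DecidableEq ι] (W : ι → X.Opens)
    (F : X.Modules) : ∑ i, famProj W F i ≫ famSingle W F i = 𝟙 _ := by
  refine hom_ext_sec fun U s ↦ ?_
  rw [sec_sum, sec_id]
  exact Finset.univ_sum_single (M := fun i ↦ Γ(F, U ⊓ W i)) s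

lemma acyclicOn_fam {ι : Type*} (B : ι → X.Opens) {κ : Type} [Finite κ] (W : κ → X.Opens)
    (F : X.Modules) (h : ∀ k, acyclicOn B (fam (fun _ : Unit ↦ W k) F)) :
    acyclicOn B (fam W F) := by
  classical
  have := Fintype.ofFinite κ
  intro i n α
  have h1 : α.comp (Ext.mk₀ (𝟙 (fam W F))) (add_zero _) = 0 := by
    rw [← sum_famProj_famSingle, Ext.mk₀_sum, Ext.comp_sum]
    refine Finset.sum_eq_zero fun k _ ↦ ?_
    rw [← Ext.mk₀_comp_mk₀, ← Ext.comp_assoc_of_third_deg_zero, h k i n (α.comp _ _), Ext.zero_comp]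
  rwa [Ext.comp_mk₀_id] at h1

end

variable {A : Type u} [CommRing A] {r : ℕ}

lemma iSup_D_X : ⨆ i : Fin (r + 1), D (MvPolynomial.X i : PolyRing A r) = ⊤ := by
  refine Proj.iSup_basicOpen_eq_top' (stdGrading A r) _
    (fun i ↦ ⟨1, MvPolynomial.isHomogeneous_X _ i⟩) (top_le_iff.1 fun x _ ↦ ?_)
  have hx : x ∈ Algebra.adjoin A (Set.range (MvPolynomial.X : Fin (r + 1) → PolyRing A r)) := by
    rw [MvPolynomial.adjoin_range_X]; trivial
  induction hx using Algebra.adjoin_induction with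
  | mem x hx => exact Algebra.subset_adjoin hx
  | algebraMap a =>
    exact Subalgebra.algebraMap_mem (Algebra.adjoin (stdGrading A r 0) _)
      (algebraMap A (stdGrading A r 0) a)
  | add x y _ _ hx hy => exact add_mem (hx trivial) (hy trivial)
  | mul x y _ _ hx hy => exact mul_mem (hx trivial) (hy trivial)

/-- The function on projective space defined by `a ∈ A`. -/
def scalar (A : Type u) [CommRing A] (r : ℕ) (a : A) : Γ(projSpace A r, ⊤) :=
  (projSpaceToSpec A r).appTop ((Scheme.ΓSpecIso (.of A)).inv a)

/-- The structure morphism to the spectrum of the degree zero ring is constructed on D₊(1), which is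
everything. Unwinding this identifies the function pulled back from a with the fraction a/1, so that
its values can be computed. -/
lemma scalar_eq (a : A) : scalar A r a = (projSpace A r).presheaf.map
    (homOfLE (show (⊤ : (projSpace A r).Opens) ≤ D 1 from (Proj.basicOpen_one _).ge)).op
      (Proj.awayToSection (stdGrading A r) 1
        (HomogeneousLocalization.fromZeroRingHom (stdGrading A r) _
          (algebraMap A (stdGrading A r 0) a))) := by
  have h : (Scheme.ΓSpecIso (.of A)).inv ≫ (projSpaceToSpec A r).appTop =
      CommRingCat.ofHom (algebraMap A (stdGrading A r 0)) ≫
      CommRingCat.ofHom (HomogeneousLocalization.fromZeroRingHom (stdGrading A r) _) ≫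
      Proj.awayToSection (stdGrading A r) 1 ≫ (projSpace A r).presheaf.map
        (homOfLE (show (⊤ : (projSpace A r).Opens) ≤ D 1 from (Proj.basicOpen_one _).ge)).op := by
    rw [projSpaceToSpec, Proj.toSpecZero]
    simp only [Scheme.Hom.comp_appTop, Category.assoc]
    rw [← Scheme.ΓSpecIso_inv_naturality_assoc, ← Scheme.ΓSpecIso_inv_naturality_assoc]
    have h1 : (Proj.basicOpenToSpec (stdGrading A r) 1).appTop = _ := Proj.basicOpenToSpec_app_top _ 1
    rw [h1, Category.assoc, Category.assoc, Iso.inv_hom_id_assoc]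
    have h2 : (Scheme.Opens.ι (⊤ : (projSpace A r).Opens)).appTop ≫
        (projSpace A r).topIso.inv.appTop = 𝟙 _ := by
      rw [← Scheme.Hom.comp_appTop, Scheme.toIso_inv_ι, Scheme.Hom.id_appTop]
    have h3 : (Proj.basicOpen (stdGrading A r) 1).topIso.inv ≫
        ((projSpace A r).isoOfEq (Proj.basicOpen_one (stdGrading A r))).inv.appTop =
        (projSpace A r).presheaf.map
          (homOfLE (show (⊤ : (projSpace A r).Opens) ≤ D 1 from (Proj.basicOpen_one _).ge)).op ≫
        (Scheme.Opens.ι (⊤ : (projSpace A r).Opens)).appTop := by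
      rw [Scheme.isoOfEq_inv, Scheme.homOfLE_appTop, Scheme.Opens.topIso_inv, Scheme.Opens.ι_appTop]
      erw [← Functor.map_comp]
    rw [reassoc_of% h3, h2, Category.comp_id]
  exact congr($h a)

lemma val_scalar (a : A) (x : projSpace A r) :
    ((scalar A r a).1 ⟨x, trivial⟩).val = algebraMap _ _ (MvPolynomial.C a : PolyRing A r) := by
  rw [scalar_eq]
  change ((Proj.awayToSection (stdGrading A r) 1 _).1 ⟨x, _⟩).val = _
  refine (ProjectiveSpectrum.Proj.awayToSection_apply _ _ _ _).trans ?_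
  have hv : (HomogeneousLocalization.fromZeroRingHom (stdGrading A r) (Submonoid.powers 1)
      (algebraMap A (stdGrading A r 0) a)).val =
      algebraMap _ _ (MvPolynomial.C a : PolyRing A r) := Localization.mk_one_eq_algebraMap _
  rw [hv, IsLocalization.map_eq]
  rfl

lemma projSpaceToSpec_preimage (a : A) :
    projSpaceToSpec A r ⁻¹ᵁ PrimeSpectrum.basicOpen a = D (MvPolynomial.C a) := by
  have h1 : PrimeSpectrum.basicOpen a =
      (Spec (.of A)).basicOpen ((Scheme.ΓSpecIso (.of A)).inv a) :=
    (basicOpen_eq_of_affine (R := .of A) a).symm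
  rw [h1, Scheme.preimage_basicOpen_top]
  ext x
  refine ((projSpace A r).mem_basicOpen (scalar A r a) x (show x ∈ (⊤ : (projSpace A r).Opens) from True.intro)).trans ?_
  have h2 := MulEquiv.isUnit_map (Proj.stalkIso' (stdGrading A r) x)
    (x := (projSpace A r).presheaf.germ ⊤ x True.intro (scalar A r a))
  refine h2.symm.trans ?_
  have h3 : (Proj.stalkIso' (stdGrading A r) x)
    ((projSpace A r).presheaf.germ ⊤ x True.intro (scalar A r a)) = (scalar A r a).1 ⟨x, True.intro⟩ :=
    Proj.stalkIso'_germ (stdGrading A r) ⊤ x True.intro (scalar A r a)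
  change IsUnit (Proj.stalkIso' (stdGrading A r) x _) ↔ _
  rw [h3, ← HomogeneousLocalization.isUnit_iff_isUnit_val, val_scalar]
  exact IsLocalization.AtPrime.isUnit_to_map_iff _ x.asHomogeneousIdeal.toIdeal _

/-- The element `C a` has degree 0, so the vanishing on basic opens of positive degree does not
apply to it directly. Instead D₊(a) is covered by the D₊(a s_i), with D₊(a v_k) added as the
distinguished member; intersected with D₊(v_k), each D₊(a s_i) lies in the latter. -/
lemma acyclicOn_fam_tilde {κ : Type} [Finite κ] (v : κ → PolyRing A r) (l : κ → ℕ)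
    (hl : ∀ k, 0 < l k) (hv : ∀ k, v k ∈ stdGrading A r (l k)) (M : GrMod A r) :
    acyclicOn (fun a : A ↦ D (MvPolynomial.C a : PolyRing A r)) (fam (fun k ↦ D (v k)) M.tildeObj) := by
  refine acyclicOn_fam _ _ _ fun k a n α ↦ ?_
  have hC : MvPolynomial.C a ∈ stdGrading A r 0 := MvPolynomial.isHomogeneous_C _ _
  have hX (i : Fin (r + 1)) : MvPolynomial.X i ∈ stdGrading A r 1 := MvPolynomial.isHomogeneous_X _ _
  refine H_fam_iSup_eq_zero M (hv k) (r + 1) n (g := MvPolynomial.C a * v k) (n := 0 + l k)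
    (by simpa using hl k) (SetLike.mul_mem_graded hC (hv k))
    (fun i ↦ MvPolynomial.C a * MvPolynomial.X i) (fun _ ↦ 0 + 1) (by simp)
    (fun i ↦ SetLike.mul_mem_graded hC (hX i)) (fun i ↦ ?_) ?_ α
  · simp only [D_mul]; exact inf_le_inf_right _ inf_le_left
  · simp only [D_mul]
    rw [← inf_iSup_eq, iSup_D_X, inf_top_eq, sup_eq_right.2 inf_le_left]

end AlgebraicGeometry.Scheme.Modules
end

/-! ### Elementwise quasi-isomorphisms and Laurent coefficients -/

noncomputable section

namespace CochainComplex
variable {R : Type u} [Ring R] {K L : CochainComplex (ModuleCat.{u} R) ℕ}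

lemma homologyπ_eq_zero_iff {p : ℕ} (c : K.cycles p) :
    K.homologyπ p c = 0 ↔ ∃ (i : ℕ) (z : K.X i), K.iCycles p c = K.d i p z := by
  constructor
  · intro h
    have h1 : (ShortComplex.mk (K.toCycles ((ComplexShape.up ℕ).prev p) p) (K.homologyπ p)
        (K.toCycles_comp_homologyπ _ _)).Exact :=
      ShortComplex.exact_of_g_is_cokernel _ (K.homologyIsCokernel _ _ rfl)
    obtain ⟨z, hz⟩ := (ShortComplex.moduleCat_exact_iff _).1 h1 c h
    refine ⟨_, z, ?_⟩
    rw [← hz]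
    exact congr($(K.toCycles_i _ _) z)
  · rintro ⟨i, z, hz⟩
    have h1 : c = K.toCycles i p z := by
      apply (ModuleCat.mono_iff_injective (K.iCycles p)).1 inferInstance
      rw [hz]
      exact congr($(K.toCycles_i _ _) z).symm
    rw [h1]
    exact congr($(K.toCycles_comp_homologyπ i p) z)

lemma d_iCycles {p : ℕ} (c : K.cycles p) : K.d p (p + 1) (K.iCycles p c) = 0 :=
  congr($(K.iCycles_d p (p + 1)) c)

lemma exists_iCycles_eq {p : ℕ} (x : K.X p) (hx : K.d p (p + 1) x = 0) :
    ∃ c : K.cycles p, K.iCycles p c = x := by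
  have h1 : (ShortComplex.mk (K.iCycles p) (K.d p (p + 1)) (K.iCycles_d _ _)).Exact :=
    ShortComplex.exact_of_f_is_kernel _ (K.cyclesIsKernel p (p + 1) (by simp))
  exact (ShortComplex.moduleCat_exact_iff _).1 h1 x hx

lemma iCycles_cyclesMap (φ : K ⟶ L) {p : ℕ} (c : K.cycles p) :
    L.iCycles p (HomologicalComplex.cyclesMap φ p c) = φ.f p (K.iCycles p c) :=
  congr($(HomologicalComplex.cyclesMap_i φ p) c)

lemma homologyMap_homologyπ (φ : K ⟶ L) {p : ℕ} (c : K.cycles p) :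
    HomologicalComplex.homologyMap φ p (K.homologyπ p c) =
      L.homologyπ p (HomologicalComplex.cyclesMap φ p c) :=
  congr($(HomologicalComplex.homologyπ_naturality φ p) c)

lemma homologyπ_surjective (K : CochainComplex (ModuleCat.{u} R) ℕ) (p : ℕ) :
    Function.Surjective (K.homologyπ p) :=
  (ModuleCat.epi_iff_surjective _).1 inferInstance

/-- An elementwise criterion for a morphism of cochain complexes of modules to be a
quasi-isomorphism. -/
lemma quasiIso_of_elements (φ : K ⟶ L)
    (hs : ∀ (p : ℕ) (y : L.X p), L.d p (p + 1) y = 0 →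
      ∃ x : K.X p, K.d p (p + 1) x = 0 ∧ ∃ (i : ℕ) (z : L.X i), y = φ.f p x + L.d i p z)
    (hi : ∀ (p : ℕ) (x : K.X p), K.d p (p + 1) x = 0 → ∀ (i : ℕ) (z : L.X i), φ.f p x = L.d i p z →
      ∃ (j : ℕ) (z : K.X j), x = K.d j p z) : QuasiIso φ where
  quasiIsoAt p := by
    rw [quasiIsoAt_iff_isIso_homologyMap]
    have hm : Mono (HomologicalComplex.homologyMap φ p) := by
      rw [ModuleCat.mono_iff_injective]
      refine (injective_iff_map_eq_zero _).2 fun z hz ↦ ?_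
      obtain ⟨c, rfl⟩ := K.homologyπ_surjective p z
      rw [homologyMap_homologyπ, homologyπ_eq_zero_iff] at hz
      obtain ⟨i, z, hz⟩ := hz
      rw [iCycles_cyclesMap] at hz
      exact (homologyπ_eq_zero_iff c).2 (hi p _ (d_iCycles c) i z hz)
    have he : Epi (HomologicalComplex.homologyMap φ p) := by
      rw [ModuleCat.epi_iff_surjective]
      intro y
      obtain ⟨c, rfl⟩ := L.homologyπ_surjective p y
      obtain ⟨x, hx, i, z, hz⟩ := hs p _ (d_iCycles c)
      obtain ⟨c', rfl⟩ := exists_iCycles_eq x hx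
      refine ⟨K.homologyπ p c', ?_⟩
      rw [homologyMap_homologyπ, ← sub_eq_zero, ← map_sub, homologyπ_eq_zero_iff]
      refine ⟨i, -z, ?_⟩
      rw [map_sub, iCycles_cyclesMap, map_neg, hz]
      abel
    exact isIso_of_mono_of_epi _

lemma exists_cocycle_of_quasiIso (φ : K ⟶ L) [QuasiIso φ] {p : ℕ} (y : L.X p)
    (hy : L.d p (p + 1) y = 0) :
    ∃ x : K.X p, K.d p (p + 1) x = 0 ∧ ∃ (i : ℕ) (z : L.X i), y = φ.f p x + L.d i p z := by
  obtain ⟨c, rfl⟩ := exists_iCycles_eq y hy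
  obtain ⟨b, hb⟩ := (ModuleCat.epi_iff_surjective (HomologicalComplex.homologyMap φ p)).1
    inferInstance (L.homologyπ p c)
  obtain ⟨c', rfl⟩ := K.homologyπ_surjective p b
  refine ⟨K.iCycles p c', d_iCycles c', ?_⟩
  rw [homologyMap_homologyπ, eq_comm, ← sub_eq_zero, ← map_sub, homologyπ_eq_zero_iff] at hb
  obtain ⟨i, z, hz⟩ := hb
  refine ⟨i, z, ?_⟩
  rw [← hz, map_sub, iCycles_cyclesMap]
  abel

lemma exists_eq_d_of_quasiIso (φ : K ⟶ L) [QuasiIso φ] {p : ℕ} (x : K.X p)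
    (hx : K.d p (p + 1) x = 0) (i : ℕ) (z : L.X i) (h : φ.f p x = L.d i p z) :
    ∃ (j : ℕ) (z : K.X j), x = K.d j p z := by
  obtain ⟨c, rfl⟩ := exists_iCycles_eq x hx
  refine (homologyπ_eq_zero_iff c).1
    ((ModuleCat.mono_iff_injective (HomologicalComplex.homologyMap φ p)).1 inferInstance ?_)
  rw [map_zero, homologyMap_homologyπ, homologyπ_eq_zero_iff]
  exact ⟨i, z, by rw [iCycles_cyclesMap, h]⟩

end CochainComplex

namespace GrMod

variable {A : Type u} [CommRing A] {r : ℕ}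

/-! ### Coefficients of Laurent polynomials -/

/-- The coefficient of a polynomial at an integral exponent. -/
def zcoeff (f : PolyRing A r) (w : Fin (r + 1) → ℤ) : A :=
  if ∀ j, 0 ≤ w j then f.coeff (Finsupp.equivFunOnFinite.symm fun j ↦ (w j).toNat) else 0

lemma zcoeff_natCast (f : PolyRing A r) (u : Fin (r + 1) →₀ ℕ) :
    zcoeff f (fun j ↦ u j) = f.coeff u := by
  rw [zcoeff, if_pos (fun j ↦ by positivity)]
  congr 1
  ext j; simp

lemma zcoeff_nonneg {f : PolyRing A r} {w : Fin (r + 1) → ℤ} (h : zcoeff f w ≠ 0) (j) : 0 ≤ w j := by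
  by_contra h'
  exact h (if_neg fun h ↦ h' (h j))

lemma eq_natCast_of_nonneg {w : Fin (r + 1) → ℤ} (h : ∀ j, 0 ≤ w j) :
    ∃ u : Fin (r + 1) →₀ ℕ, w = fun j ↦ (u j : ℤ) :=
  ⟨Finsupp.equivFunOnFinite.symm fun j ↦ (w j).toNat, funext fun j ↦ by simp [h j]⟩

lemma zcoeff_ext {f g : PolyRing A r} (h : ∀ w, zcoeff f w = zcoeff g w) : f = g := by
  ext u
  rw [← zcoeff_natCast, ← zcoeff_natCast, h]

lemma zcoeff_add (f g : PolyRing A r) (w : Fin (r + 1) → ℤ) :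
    zcoeff (f + g) w = zcoeff f w + zcoeff g w := by
  unfold zcoeff; split_ifs <;> simp

/-- `zcoeff` as an additive map. -/
def zcoeffHom (w : Fin (r + 1) → ℤ) : PolyRing A r →+ A :=
  AddMonoidHom.mk' (fun f ↦ zcoeff f w) fun f g ↦ zcoeff_add f g w

lemma zcoeff_X_pow_mul (f : PolyRing A r) (i : Fin (r + 1)) (e : ℕ) (w : Fin (r + 1) → ℤ) :
    zcoeff (MvPolynomial.X i ^ e * f) w = zcoeff f (w - Pi.single i (e : ℤ)) := by
  classical
  by_cases h : ∀ j, 0 ≤ w j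
  · obtain ⟨u, rfl⟩ := eq_natCast_of_nonneg h
    rw [zcoeff_natCast, MvPolynomial.X_pow_eq_monomial, MvPolynomial.coeff_monomial_mul', one_mul]
    split_ifs with hu
    · rw [← zcoeff_natCast]
      congr 1
      ext j
      have := hu j
      simp only [Finsupp.tsub_apply, Pi.sub_apply, Pi.single_apply, Finsupp.single_apply] at this ⊢
      rw [Nat.cast_sub this]
      simp [eq_comm]
    · by_contra hne
      refine hu fun j ↦ ?_
      have := zcoeff_nonneg (Ne.symm hne) j
      simp only [Pi.sub_apply, Pi.single_apply, Finsupp.single_apply] at this ⊢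
      split_ifs with hj
      · subst hj; simp at this; omega
      · positivity
  · rw [zcoeff, if_neg h]
    by_contra hne
    refine h fun j ↦ ?_
    have := zcoeff_nonneg (Ne.symm hne) j
    simp only [Pi.sub_apply, Pi.single_apply] at this
    split_ifs at this <;> omega

lemma zcoeff_prod_pow_mul {κ : Type} (s : Finset κ) (g : κ → Fin (r + 1)) (f : PolyRing A r) (e : ℕ)
    (w : Fin (r + 1) → ℤ) : zcoeff ((∏ k ∈ s, MvPolynomial.X (g k)) ^ e * f) w =
      zcoeff f (w - ∑ k ∈ s, Pi.single (g k) (e : ℤ)) := by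
  classical
  induction s using Finset.induction_on generalizing w with
  | empty => simp
  | insert k s hk ih =>
    rw [Finset.prod_insert hk, mul_pow, mul_assoc, zcoeff_X_pow_mul, ih, Finset.sum_insert hk,
      sub_sub]

lemma mem_polyDeg_iff {f : PolyRing A r} {n : ℤ} :
    f ∈ polyDeg (σ := Fin (r + 1)) (A := A) n ↔ ∀ w, zcoeff f w ≠ 0 → ∑ j, w j = n := by
  constructor
  · intro h w hw
    obtain ⟨u, rfl⟩ := eq_natCast_of_nonneg (zcoeff_nonneg hw)
    rw [zcoeff_natCast] at hw
    rw [← h u (by simpa using hw), Finsupp.degree_eq_sum]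
    simp
  · intro h u hu
    rw [← h (fun j ↦ u j) (by rw [zcoeff_natCast]; simpa using hu), Finsupp.degree_eq_sum]
    simp

lemma finite_zcoeff (f : PolyRing A r) : {w | zcoeff f w ≠ 0}.Finite := by
  refine (f.support.finite_toSet.image fun u j ↦ (u j : ℤ)).subset fun w hw ↦ ?_
  obtain ⟨u, rfl⟩ := eq_natCast_of_nonneg (zcoeff_nonneg hw)
  exact ⟨u, by simpa [zcoeff_natCast] using hw, rfl⟩

lemma exists_zcoeff_eq (c : (Fin (r + 1) → ℤ) → A) (hc : {w | c w ≠ 0}.Finite)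
    (h : ∀ w, c w ≠ 0 → ∀ j, 0 ≤ w j) : ∃ f : PolyRing A r, ∀ w, zcoeff f w = c w := by
  let g : (Fin (r + 1) →₀ ℕ) → A := fun u ↦ c fun j ↦ u j
  have hg : g.support.Finite := by
    refine hc.preimage (f := fun u : Fin (r + 1) →₀ ℕ ↦ fun j ↦ (u j : ℤ)) ?_
    intro u _ v _ huv
    ext j
    exact Nat.cast_injective (R := ℤ) (congr_fun huv j)
  refine ⟨.ofCoeff (Finsupp.ofSupportFinite g hg), fun w ↦ ?_⟩
  by_cases hw : ∀ j, 0 ≤ w j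
  · obtain ⟨u, rfl⟩ := eq_natCast_of_nonneg hw
    rw [zcoeff_natCast]; rfl
  · rw [zcoeff, if_neg hw]
    by_contra hne
    exact hw (h w (Ne.symm hne))

/-! ### Laurent coefficients of Čech cochains -/

/-- The indicator function of the indices in `J`. -/
def ind {p : ℕ} (J : Fin (p + 1) ↪o Fin (r + 1)) : Fin (r + 1) → ℤ := ∑ k, Pi.single (J k) 1

lemma ind_face {p : ℕ} (J : Fin (p + 2) ↪o Fin (r + 1)) (k : Fin (p + 2)) :
    ind J = Pi.single (J k) 1 + ind (face J k) := Fin.sum_univ_succAbove _ k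

lemma ind_apply {p : ℕ} (J : Fin (p + 1) ↪o Fin (r + 1)) (j : Fin (r + 1)) [Decidable (j ∈ Set.range J)] :
    ind J j = if j ∈ Set.range J then 1 else 0 := by
  rw [ind, Finset.sum_apply]
  split_ifs with h
  · obtain ⟨k, rfl⟩ := h
    rw [Finset.sum_eq_single k]
    · simp
    · intro l _ hl
      exact Pi.single_eq_of_ne (fun h ↦ hl (J.injective h).symm) _
    · simp
  · refine Finset.sum_eq_zero fun k _ ↦ Pi.single_eq_of_ne (fun h' ↦ h ⟨k, h'.symm⟩) _

lemma sum_ind {p : ℕ} (J : Fin (p + 1) ↪o Fin (r + 1)) : ∑ j, ind J j = p + 1 := by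
  simp only [ind, Finset.sum_apply]
  rw [Finset.sum_comm]
  simp

/-- The product of the variables indexed by `J`. -/
def sProd (A : Type u) [CommRing A] {p : ℕ} (J : Fin (p + 1) ↪o Fin (r + 1)) : PolyRing A r :=
  ∏ k, MvPolynomial.X (J k)

/-- The coefficients of the Laurent polynomials `a J / s_J ^ d`. -/
def lc {p : ℕ} (d : ℕ) (a : (Fin (p + 1) ↪o Fin (r + 1)) → PolyRing A r) (v : Fin (r + 1) → ℤ)
    (J : Fin (p + 1) ↪o Fin (r + 1)) : A := zcoeff (a J) (v + (d : ℤ) • ind J)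

/-- A fraction and its expansion by s_J^e are the same Laurent polynomial. In terms of coefficients,
the transition maps are thus inclusions. -/
lemma lc_sProd_pow_mul {p : ℕ} (d e : ℕ) (a : (Fin (p + 1) ↪o Fin (r + 1)) → PolyRing A r) :
    lc (d + e) (fun J ↦ sProd A J ^ e * a J) = lc d a := by
  ext v J
  change zcoeff ((∏ k, MvPolynomial.X (J k)) ^ e * a J) (v + ((d + e : ℕ) : ℤ) • ind J) =
    zcoeff (a J) (v + (d : ℤ) • ind J)
  rw [zcoeff_prod_pow_mul]
  congr 1
  have : ∑ k, Pi.single (J k) (e : ℤ) = (e : ℤ) • ind J := by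
    rw [ind, Finset.smul_sum]
    refine Finset.sum_congr rfl fun k _ ↦ ?_
    rw [← Pi.single_smul]; simp
  rw [this]
  push_cast
  rw [add_smul]
  abel

/-- The factor s_{J k}^d only adjusts the denominator from the face to J. On Laurent coefficients
the differential therefore acts on each exponent v separately, by the combinatorial alternating sum.
-/
lemma lc_cechLin {p : ℕ} (d : ℕ) (a : (Fin (p + 1) ↪o Fin (r + 1)) → PolyRing A r)
    (v : Fin (r + 1) → ℤ) : lc d (cechLin d (self A r) p a) v = altSum (lc d a v) := by
  ext J
  change zcoeffHom (v + (d : ℤ) • ind J) (cechLin d (self A r) p a J) = _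
  rw [altSum]
  refine (congrArg (zcoeffHom (v + (d : ℤ) • ind J)) (cechLin_apply d (self A r) p a J)).trans ?_
  refine (map_sum (zcoeffHom (v + (d : ℤ) • ind J)) _ _).trans ?_
  refine Finset.sum_congr rfl fun k _ ↦ ?_
  have : ((-1) ^ (k : ℕ) * MvPolynomial.X (J k) ^ d : PolyRing A r) • a (face J k) =
      (-1 : ℤ) ^ (k : ℕ) • (MvPolynomial.X (J k) ^ d * a (face J k)) := by
    rw [smul_eq_mul, zsmul_eq_mul, mul_assoc]; push_cast; rfl
  refine (congrArg (zcoeffHom (v + (d : ℤ) • ind J)) this).trans ?_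
  rw [map_zsmul]
  congr 1
  change zcoeff _ _ = _
  rw [zcoeff_X_pow_mul, lc]
  congr 1
  rw [ind_face J k, smul_add, ← Pi.single_smul]
  simp only [smul_eq_mul, mul_one]
  abel

lemma lc_ext {p d : ℕ} {a b : (Fin (p + 1) ↪o Fin (r + 1)) → PolyRing A r}
    (h : lc d a = lc d b) : a = b := by
  ext1 J
  refine zcoeff_ext fun w ↦ ?_
  have := congr_fun (congr_fun h (w - (d : ℤ) • ind J)) J
  simpa [lc] using this

lemma lc_add {p d : ℕ} (a b : (Fin (p + 1) ↪o Fin (r + 1)) → PolyRing A r) (v) (J) :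
    lc d (a + b) v J = lc d a v J + lc d b v J := zcoeff_add _ _ _

/-- The conditions on coefficients for a Čech cochain of degree `n`. -/
structure IsLC {p : ℕ} (d : ℕ) (n : ℤ) (e : (Fin (r + 1) → ℤ) → (Fin (p + 1) ↪o Fin (r + 1)) → A) :
    Prop where
  finite : ∀ J, {v | e v J ≠ 0}.Finite
  nonneg : ∀ v J, e v J ≠ 0 → ∀ j, 0 ≤ v j + d * ind J j
  deg : ∀ v J, e v J ≠ 0 → ∑ j, v j = n

lemma isLC_lc {p : ℕ} {d : ℕ} {n : ℤ} {a : (Fin (p + 1) ↪o Fin (r + 1)) → PolyRing A r}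
    (ha : ∀ J, a J ∈ polyDeg (σ := Fin (r + 1)) (A := A) (n + d * (p + 1))) :
    IsLC d n (lc d a) where
  finite J := by
    refine ((finite_zcoeff (a J)).preimage (f := fun v ↦ v + (d : ℤ) • ind J) ?_)
    exact fun v _ w _ h ↦ add_right_cancel h
  nonneg v J h j := by simpa using zcoeff_nonneg h j
  deg v J h := by
    have := mem_polyDeg_iff.1 (ha J) _ h
    simp only [Pi.add_apply, Pi.smul_apply, smul_eq_mul, Finset.sum_add_distrib] at this
    rw [← Finset.mul_sum, sum_ind] at this
    linarith

lemma exists_lc_eq {p : ℕ} {d : ℕ} {n : ℤ}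
    {e : (Fin (r + 1) → ℤ) → (Fin (p + 1) ↪o Fin (r + 1)) → A} (he : IsLC d n e) :
    ∃ a : (Fin (p + 1) ↪o Fin (r + 1)) → PolyRing A r,
      (∀ J, a J ∈ polyDeg (σ := Fin (r + 1)) (A := A) (n + d * (p + 1))) ∧ lc d a = e := by
  have h (J : Fin (p + 1) ↪o Fin (r + 1)) : ∃ f : PolyRing A r, ∀ w, zcoeff f w =
      e (w - (d : ℤ) • ind J) J := by
    refine exists_zcoeff_eq _ ?_ fun w hw j ↦ ?_
    · exact (he.finite J).preimage (f := fun w ↦ w - (d : ℤ) • ind J) fun v _ w _ h ↦ sub_left_injective h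
    · simpa using he.nonneg _ _ hw j
  choose a ha using h
  refine ⟨a, fun J ↦ mem_polyDeg_iff.2 fun w hw ↦ ?_, ?_⟩
  · rw [ha] at hw
    have := he.deg _ _ hw
    simp only [Pi.sub_apply, Pi.smul_apply, smul_eq_mul, Finset.sum_sub_distrib] at this
    rw [← Finset.mul_sum, sum_ind] at this
    linarith
  · ext v J
    rw [lc, ha, add_sub_cancel_right]

end GrMod
end

/-! ### Contracting the discarded monomials of a free module -/

noncomputable section

namespace GrMod

variable {A : Type u} [CommRing A] {r : ℕ}

/-! ### The truncated Čech complexes of a free module -/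

lemma insertion_zero {T : Type*} [AddCommGroup T] {p : ℕ} (i : Fin (r + 1))
    (J : Fin (p + 1) ↪o Fin (r + 1)) :
    insertion i (0 : (Fin (p + 2) ↪o Fin (r + 1)) → T) J = 0 := by
  unfold insertion; split_ifs <;> simp

lemma altSum_zero {T : Type*} [AddCommGroup T] {p : ℕ} :
    altSum (0 : (Fin (p + 1) ↪o Fin (r + 1)) → T) = 0 := by
  ext J; simp [altSum]

lemma exists_of_insertion_ne_zero {T : Type*} [AddCommGroup T] {p : ℕ} {i : Fin (r + 1)}
    {e : (Fin (p + 2) ↪o Fin (r + 1)) → T} {J : Fin (p + 1) ↪o Fin (r + 1)}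
    (h : insertion i e J ≠ 0) : ∃ k L, face L k = J ∧ L k = i ∧ e L ≠ 0 := by
  by_cases hi : i ∈ Set.range J
  · exact absurd (insertion_of_mem e hi) h
  · obtain ⟨k, L, rfl, rfl⟩ := exists_insert J i hi
    refine ⟨k, L, rfl, rfl, fun h0 ↦ h ?_⟩
    rw [insertion_face, h0, smul_zero]

open Classical in
/-- An index of a nonnegative entry of `v`, if there is any. -/
def nonnegIdx (v : Fin (r + 1) → ℤ) : Fin (r + 1) := if h : ∃ i, 0 ≤ v i then h.choose else 0

/-- The bound on d enters here. If all entries were negative, one of them being at most -d-1 and the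
r others at most -1, the sum would be at most -d-1-r, whereas n ≥ -d-r. -/
lemma nonnegIdx_spec {v : Fin (r + 1) → ℤ} {n : ℤ} {d : ℕ} (hn : -n - r ≤ d) (hv : ∑ j, v j = n)
    (hb : ∃ j, v j < -d) : 0 ≤ v (nonnegIdx v) := by
  classical
  have h : ∃ i, 0 ≤ v i := by
    by_contra! h
    obtain ⟨j, hj⟩ := hb
    rw [← Finset.add_sum_erase _ _ (Finset.mem_univ j)] at hv
    have h1 : ∑ i ∈ Finset.univ.erase j, v i ≤ ∑ i ∈ Finset.univ.erase j, (-1) :=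
      Finset.sum_le_sum fun i _ ↦ by have := h i; omega
    rw [Finset.sum_const, Finset.card_erase_of_mem (Finset.mem_univ j), Finset.card_univ,
      Fintype.card_fin] at h1
    rw [nsmul_eq_mul, Nat.add_sub_cancel] at h1
    omega
  rw [nonnegIdx, dif_pos h]
  exact h.choose_spec

section

variable {p d d' : ℕ} {n : ℤ}

open Classical in
/-- Discard the monomials with an exponent less than `-d`. -/
def trunc (d : ℕ) {T : Type*} [Zero T] (e : (Fin (r + 1) → ℤ) → T) (v : Fin (r + 1) → ℤ) : T :=
  if ∃ j, v j < -d then 0 else e v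

lemma trunc_of_bad {T : Type*} [Zero T] (e : (Fin (r + 1) → ℤ) → T) {v : Fin (r + 1) → ℤ}
    (h : ∃ j, v j < -d) : trunc d e v = 0 := if_pos h

lemma trunc_of_not_bad {T : Type*} [Zero T] (e : (Fin (r + 1) → ℤ) → T) {v : Fin (r + 1) → ℤ}
    (h : ¬ ∃ j, v j < -d) : trunc d e v = e v := if_neg h

/-- Exponents at indices outside J were nonnegative already, and those at indices of J are now at
least -d. What is left thus has denominators dividing s_J^d. -/
lemma isLC_trunc {e : (Fin (r + 1) → ℤ) → (Fin (p + 1) ↪o Fin (r + 1)) → A} (he : IsLC d' n e) :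
    IsLC d n (trunc d e) := by
  classical
  have key {v J} (h : trunc d e v J ≠ 0) : (¬ ∃ j, v j < -d) ∧ e v J ≠ 0 := by
    by_cases hb : ∃ j, v j < -d
    · rw [trunc_of_bad e hb] at h; exact absurd rfl h
    · rw [trunc_of_not_bad e hb] at h; exact ⟨hb, h⟩
  refine ⟨fun J ↦ (he.finite J).subset fun v hv ↦ (key hv).2, fun v J h j ↦ ?_,
    fun v J h ↦ he.deg v J (key h).2⟩
  have h1 := he.nonneg v J (key h).2 j
  have h2 := (key h).1
  push Not at h2
  have h3 := h2 j
  rw [ind_apply] at h1 ⊢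
  split_ifs at h1 ⊢ <;> simp at h1 ⊢ <;> omega

lemma altSum_trunc (e : (Fin (r + 1) → ℤ) → (Fin (p + 1) ↪o Fin (r + 1)) → A) (v) :
    altSum (trunc d e v) = trunc d (fun v ↦ altSum (e v)) v := by
  by_cases hb : ∃ j, v j < -d
  · rw [trunc_of_bad e hb, trunc_of_bad _ hb, altSum_zero]
  · rw [trunc_of_not_bad e hb, trunc_of_not_bad _ hb]

open Classical in
/-- The contracting homotopy on the monomials with an exponent less than `-d`. -/
def contr (d : ℕ) (e : (Fin (r + 1) → ℤ) → (Fin (p + 2) ↪o Fin (r + 1)) → A)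
    (v : Fin (r + 1) → ℤ) (J : Fin (p + 1) ↪o Fin (r + 1)) : A :=
  if ∃ j, v j < -d then insertion (nonnegIdx v) (e v) J else 0

/-- The value on J comes from J with i inserted, where the exponent at i was allowed to be negative.
It is a legitimate coefficient on J because i was chosen with v_i ≥ 0. -/
lemma isLC_contr (hn : -n - r ≤ d)
    {e : (Fin (r + 1) → ℤ) → (Fin (p + 2) ↪o Fin (r + 1)) → A} (he : IsLC d' n e) :
    IsLC d' n (contr d e) := by
  classical
  have key {v J} (h : contr d e v J ≠ 0) : (∃ j, v j < -d) ∧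
      ∃ k L, face L k = J ∧ L k = nonnegIdx v ∧ e v L ≠ 0 := by
    unfold contr at h
    split_ifs at h with hb
    · exact ⟨hb, exists_of_insertion_ne_zero h⟩
    · exact absurd rfl h
  refine ⟨fun J ↦ (Set.finite_iUnion fun L ↦ he.finite L).subset fun v hv ↦ ?_, fun v J h j ↦ ?_,
    fun v J h ↦ ?_⟩
  · obtain ⟨-, k, L, -, -, h⟩ := key hv
    exact Set.mem_iUnion.2 ⟨L, h⟩
  · obtain ⟨hb, k, L, rfl, hk, h⟩ := key h
    have h1 := he.nonneg v L h j
    rw [ind_face L k, hk] at h1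
    rcases eq_or_ne j (nonnegIdx v) with rfl | hj
    · have h2 := nonnegIdx_spec hn (he.deg v L h) hb
      have h3 : 0 ≤ ind (face L k) (nonnegIdx v) := by rw [ind_apply]; split_ifs <;> simp
      positivity
    · simpa [Pi.single_eq_of_ne hj] using h1
  · obtain ⟨-, k, L, -, -, h⟩ := key h
    exact he.deg v L h

variable (e : ℕ)

/-- The differential of the truncated Čech complex of the polynomial ring. -/
def cechPoly (d p : ℕ) (a : (Fin (p + 1) ↪o Fin (r + 1)) → PolyRing A r) :
    (Fin (p + 2) ↪o Fin (r + 1)) → PolyRing A r := cechLin d (self A r) p a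

lemma lc_cechPoly (d : ℕ) (a : (Fin (p + 1) ↪o Fin (r + 1)) → PolyRing A r)
    (v : Fin (r + 1) → ℤ) : lc d (cechPoly d p a) v = altSum (lc d a v) := lc_cechLin d a v

lemma trunc_lc {a : (Fin (p + 1) ↪o Fin (r + 1)) → PolyRing A r}
    (ha : IsLC d n (lc d a)) : trunc d (lc d a) = lc d a := by
  classical
  ext v J
  by_cases hb : ∃ j, v j < -d
  · rw [trunc_of_bad _ hb]
    by_contra hne
    obtain ⟨j, hj⟩ := hb
    have := ha.nonneg v J (Ne.symm hne) j
    rw [ind_apply] at this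
    split_ifs at this <;> simp at this <;> omega
  · rw [trunc_of_not_bad _ hb]

/-- Split b into the monomials kept by the truncation and the others. The differential respects
exponents, so both parts are cocycles; the first comes from level d, and the second is the
coboundary of its contraction. -/
lemma cocycle_surj_succ (hn : -n - r ≤ d) (b : (Fin (p + 2) ↪o Fin (r + 1)) → PolyRing A r)
    (hb : ∀ J, b J ∈ polyDeg (σ := Fin (r + 1)) (A := A) (n + (d + e : ℕ) * ((p + 1 : ℕ) + 1)))
    (hδ : cechPoly (d + e) (p + 1) b = 0) :
    ∃ a : (Fin (p + 2) ↪o Fin (r + 1)) → PolyRing A r,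
      (∀ J, a J ∈ polyDeg (σ := Fin (r + 1)) (A := A) (n + d * ((p + 1 : ℕ) + 1))) ∧
      cechPoly d (p + 1) a = 0 ∧
      ∃ c : (Fin (p + 1) ↪o Fin (r + 1)) → PolyRing A r,
      (∀ J, c J ∈ polyDeg (σ := Fin (r + 1)) (A := A) (n + (d + e : ℕ) * (p + 1))) ∧
      b = (fun J ↦ sProd A J ^ e * a J) + cechPoly (d + e) p c := by
  have he := isLC_lc hb
  obtain ⟨a, ha, hae⟩ := exists_lc_eq (isLC_trunc (d := d) he)
  obtain ⟨c, hc, hce⟩ := exists_lc_eq (isLC_contr hn he)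
  have h0 (v) : altSum (lc (d + e) b v) = 0 := by
    rw [← lc_cechPoly, hδ]
    ext J
    exact (zcoeffHom _).map_zero
  refine ⟨a, ha, ?_, c, hc, ?_⟩
  · refine lc_ext (d := d) (funext fun v ↦ ?_)
    rw [lc_cechPoly, hae, altSum_trunc]
    have h1 : (fun v ↦ altSum (lc (d + e) b v)) = 0 := funext h0
    rw [h1]
    ext J
    refine Eq.trans ?_ (zcoeffHom _).map_zero.symm
    unfold trunc
    split_ifs <;> rfl
  · refine lc_ext (d := d + e) (funext fun v ↦ funext fun J ↦ ?_)
    rw [lc_add, lc_sProd_pow_mul, hae]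
    refine Eq.trans ?_ (congrArg _ (congr_fun (lc_cechPoly (d + e) c v) J).symm)
    rw [hce]
    by_cases hbad : ∃ j, v j < -d
    · rw [trunc_of_bad _ hbad]
      have h1 : contr d (lc (d + e) b) v = insertion (nonnegIdx v) (lc (d + e) b v) :=
        funext fun _ ↦ if_pos hbad
      rw [h1]
      have h2 := altSum_insertion (nonnegIdx v) (lc (d + e) b v) J
      rw [h0, insertion_zero, add_zero] at h2
      rw [h2]; exact (zero_add _).symm
    · rw [trunc_of_not_bad _ hbad]
      have h1 : contr d (lc (d + e) b) v = 0 := funext fun _ ↦ if_neg hbad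
      rw [h1, altSum_zero]
      exact (add_zero _).symm

/-- There are no coboundaries in degree 0, so the discarded part of the cocycle must vanish
outright. Take v with v_j < -d and an index i with v_i ≥ 0. The component at i vanishes because j
differs from i and only v_i could be negative there; the cocycle condition on pairs containing i
then kills the other components. -/
lemma cocycle_surj_zero (hn : -n - r ≤ d) (b : (Fin 1 ↪o Fin (r + 1)) → PolyRing A r)
    (hb : ∀ J, b J ∈ polyDeg (σ := Fin (r + 1)) (A := A) (n + (d + e : ℕ) * ((0 : ℕ) + 1)))
    (hδ : cechPoly (d + e) 0 b = 0) :
    ∃ a : (Fin 1 ↪o Fin (r + 1)) → PolyRing A r,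
      (∀ J, a J ∈ polyDeg (σ := Fin (r + 1)) (A := A) (n + d * ((0 : ℕ) + 1))) ∧
      cechPoly d 0 a = 0 ∧ b = (fun J ↦ sProd A J ^ e * a J) := by
  classical
  have he := isLC_lc hb
  have h0 (v) : altSum (lc (d + e) b v) = 0 := by
    rw [← lc_cechPoly, hδ]
    ext J
    exact (zcoeffHom _).map_zero
  have hbad (v : Fin (r + 1) → ℤ) (hv : ∃ j, v j < -(d : ℤ)) : lc (d + e) b v = 0 := by
    have h1 (J : Fin 1 ↪o Fin (r + 1)) (hJ : J 0 = nonnegIdx v) : lc (d + e) b v J = 0 := by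
      by_contra hne
      obtain ⟨j, hj⟩ := hv
      have h2 := nonnegIdx_spec hn (he.deg v J hne) ⟨j, hj⟩
      have h3 := he.nonneg v J hne j
      rw [ind_apply, if_neg] at h3
      · simp at h3; omega
      · rintro ⟨k, rfl⟩
        rw [Fin.fin_one_eq_zero k, hJ] at hj
        omega
    ext J
    by_cases hi : nonnegIdx v ∈ Set.range J
    · obtain ⟨k, hk⟩ := hi
      exact h1 J (by rw [← hk, Fin.fin_one_eq_zero k])
    · obtain ⟨k, L, rfl, hk⟩ := exists_insert J _ hi
      have h2 := congr_fun (h0 v) L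
      rw [altSum, Fin.sum_univ_succAbove _ k, Fin.sum_univ_one, h1 (face L (k.succAbove 0)),
        smul_zero, add_zero] at h2
      · have h3 := congr((-1 : ℤ) ^ (k : ℕ) • $h2)
        rw [smul_smul, ← mul_pow] at h3
        simpa using h3
      · rw [← hk]
        change L ((k.succAbove 0).succAbove 0) = L k
        congr 1
        fin_cases k <;> rfl
  obtain ⟨a, ha, hae⟩ := exists_lc_eq (isLC_trunc (d := d) he)
  have htr : trunc d (lc (d + e) b) = lc (d + e) b := by
    ext1 v
    by_cases hv : ∃ j, v j < -(d : ℤ)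
    · rw [trunc_of_bad _ hv, hbad v hv]
    · rw [trunc_of_not_bad _ hv]
  rw [htr] at hae
  refine ⟨a, ha, ?_, ?_⟩
  · refine lc_ext (d := d) (funext fun v ↦ ?_)
    rw [lc_cechPoly, hae, h0]
    ext J
    exact (zcoeffHom _).map_zero.symm
  · refine lc_ext (d := d + e) ?_
    rw [lc_sProd_pow_mul, hae]

/-- Truncation commutes with the differential and fixes a, so a primitive of a can be truncated to
level d. No bound on the degree is needed. -/
lemma cocycle_inj_succ (a : (Fin (p + 2) ↪o Fin (r + 1)) → PolyRing A r)
    (ha : ∀ J, a J ∈ polyDeg (σ := Fin (r + 1)) (A := A) (n + d * ((p + 1 : ℕ) + 1)))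
    (b : (Fin (p + 1) ↪o Fin (r + 1)) → PolyRing A r)
    (hb : ∀ J, b J ∈ polyDeg (σ := Fin (r + 1)) (A := A) (n + (d + e : ℕ) * (p + 1)))
    (hab : (fun J ↦ sProd A J ^ e * a J) = cechPoly (d + e) p b) :
    ∃ c : (Fin (p + 1) ↪o Fin (r + 1)) → PolyRing A r,
      (∀ J, c J ∈ polyDeg (σ := Fin (r + 1)) (A := A) (n + d * (p + 1))) ∧
      a = cechPoly d p c := by
  obtain ⟨c, hc, hce⟩ := exists_lc_eq (isLC_trunc (d := d) (isLC_lc hb))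
  refine ⟨c, hc, lc_ext (d := d) (funext fun v ↦ ?_)⟩
  rw [lc_cechPoly, hce, altSum_trunc]
  have h1 : (fun v ↦ altSum (lc (d + e) b v)) = lc d a := by
    ext1 v
    rw [← lc_cechPoly, ← hab, lc_sProd_pow_mul]
  rw [h1, trunc_lc (isLC_lc ha)]

lemma cocycle_inj_zero (a : (Fin (p + 1) ↪o Fin (r + 1)) → PolyRing A r)
    (hab : (fun J ↦ sProd A J ^ e * a J) = 0) : a = 0 := by
  refine lc_ext (d := 0) ?_
  rw [← lc_sProd_pow_mul 0 e, hab]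
  ext v J
  exact (zcoeffHom _).map_zero.trans (zcoeffHom _).map_zero.symm

end

end GrMod
end

/-! ### Syzygies and transition maps between truncated Čech complexes -/

noncomputable section

namespace GrMod

variable {A : Type u} [CommRing A] {r : ℕ}

/-! ### Kernels of morphisms of graded modules -/

lemma eq_of_sum_eq {M : GrMod A r} {x y : ℤ →₀ M} (hx : ∀ n, x n ∈ M.deg n)
    (hy : ∀ n, y n ∈ M.deg n) (h : (x.sum fun _ z ↦ z) = y.sum fun _ z ↦ z) : x = y := by
  have h1 : ∀ x : ℤ →₀ M, (x.sum fun _ y ↦ y) = Finsupp.liftAddHom (fun _ ↦ AddMonoidHom.id M) x :=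
    fun x ↦ rfl
  refine sub_eq_zero.1 ((exists_of_isInternal M.isInternal).2 (x - y)
    (fun n ↦ AddSubgroup.sub_mem _ (hx n) (hy n)) ?_)
  rw [h1] at h ⊢
  rw [h1] at h
  rw [map_sub, h, sub_self]

lemma sum_mapRange {M N : GrMod A r} (f : M ⟶ N) (x : ℤ →₀ M) :
    ((x.mapRange (lin f) (map_zero _)).sum fun _ z ↦ z) = lin f (x.sum fun _ z ↦ z) := by
  rw [Finsupp.sum_mapRange_index (by simp), Finsupp.sum, Finsupp.sum, map_sum]

/-- The kernel of a morphism of graded modules. -/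
def ker {M N : GrMod A r} (f : M ⟶ N) : GrMod A r where
  carrier := LinearMap.ker (lin f)
  deg n := (M.deg n).comap (LinearMap.ker (lin f)).subtype.toAddMonoidHom
  isInternal := by
    apply isInternal_of
    · rintro ⟨m, hm⟩
      obtain ⟨x, hx, rfl⟩ := (exists_of_isInternal M.isInternal).1 m
      -- The image under f of the homogeneous decomposition of a kernel element decomposes 0, so
      -- every component lies in the kernel.
      have h0 : x.mapRange (lin f) (map_zero _) = 0 := by
        refine (exists_of_isInternal N.isInternal).2 _ (fun n ↦ ?_) ?_
        · rw [Finsupp.mapRange_apply]; exact lin_deg f (hx n)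
        · rw [sum_mapRange]; exact hm
      have h1 (n : ℤ) : lin f (x n) = 0 := by
        have := congr($h0 n); simpa using this
      refine ⟨Finsupp.onFinset x.support (fun n ↦ ⟨x n, h1 n⟩) (fun n hn ↦ ?_), fun n ↦ hx n, ?_⟩
      · rw [Finsupp.mem_support_iff]
        rintro h
        exact hn (Subtype.ext h)
      · rw [Finsupp.onFinset_sum _ (by simp)]
        exact Subtype.ext (Submodule.coe_sum _ _ _)
    · intro x hx h
      have h1 := (exists_of_isInternal M.isInternal).2
        (x.mapRange (LinearMap.ker (lin f)).subtype (map_zero _))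
        (fun n ↦ by rw [Finsupp.mapRange_apply]; exact hx n) (by
          rw [Finsupp.sum_mapRange_index (by simp)]
          have := congr((LinearMap.ker (lin f)).subtype $h)
          rw [Finsupp.sum, map_sum] at this
          simpa [Finsupp.sum] using this)
      ext n
      have := congr($h1 n)
      simpa using this
  smul_mem hf hm := M.smul_mem hf hm

/-- The inclusion of the kernel. -/
def kerι {M N : GrMod A r} (f : M ⟶ N) : ker f ⟶ M where
  toLin := (LinearMap.ker (lin f)).subtype
  map_deg _ _ h := h

lemma exists_homogeneous_lift {M N : GrMod A r} (f : M ⟶ N) (hf : Function.Surjective (lin f))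
    {j : ℤ} {n : N} (hn : n ∈ N.deg j) : ∃ m ∈ M.deg j, lin f m = n := by
  obtain ⟨m, rfl⟩ := hf n
  obtain ⟨x, hx, rfl⟩ := (exists_of_isInternal M.isInternal).1 m
  refine ⟨x j, hx j, ?_⟩
  have := eq_of_sum_eq (x := x.mapRange (lin f) (map_zero _))
    (y := Finsupp.single j (lin f (x.sum fun _ z ↦ z)))
    (fun n ↦ by rw [Finsupp.mapRange_apply]; exact lin_deg f (hx n))
    (fun n ↦ by
      rw [Finsupp.single_apply]
      split_ifs with h
      · exact h ▸ hn
      · exact AddSubgroup.zero_mem _)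
    (by rw [sum_mapRange, Finsupp.sum_single_index rfl])
  have := congr($this j)
  simpa using this

/-! ### The degree zero part of the truncated Čech complex -/

/-- The degree zero part of the truncated Čech complex, as a functor. -/
def cechZero (A : Type u) [CommRing A] (r d : ℕ) : GrMod A r ⥤ CochainComplex (ModuleCat.{u} A) ℕ :=
  cech A r d ⋙ (degreeZero A r).mapHomologicalComplex (ComplexShape.up ℕ)

/-- The element of the truncated Čech complex defined by a family. -/
def cechMk {d : ℕ} {M : GrMod A r} {p : ℕ} (a : (Fin (p + 1) ↪o Fin (r + 1)) → M)
    (ha : ∀ J, a J ∈ M.deg (0 + d * (p + 1))) : ((cechZero A r d).obj M).X p :=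
  (⟨a, fun J _ ↦ ha J⟩ : (cechObj d M p).deg 0)

/-- The family defining an element of the truncated Čech complex. -/
def cechVal {d : ℕ} {M : GrMod A r} {p : ℕ} (x : ((cechZero A r d).obj M).X p) :
    (Fin (p + 1) ↪o Fin (r + 1)) → M := (show (cechObj d M p).deg 0 from x).1

lemma cechVal_mem {d : ℕ} {M : GrMod A r} {p : ℕ} (x : ((cechZero A r d).obj M).X p)
    (J : Fin (p + 1) ↪o Fin (r + 1)) : cechVal x J ∈ M.deg (0 + d * (p + 1)) :=
  (show (cechObj d M p).deg 0 from x).2 J trivial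

lemma cechVal_injective {d : ℕ} {M : GrMod A r} {p : ℕ} :
    Function.Injective (cechVal (d := d) (M := M) (p := p)) := fun _ _ h ↦ Subtype.ext h

lemma cechVal_add {d : ℕ} {M : GrMod A r} {p : ℕ} (x y : ((cechZero A r d).obj M).X p) :
    cechVal (x + y) = cechVal x + cechVal y := rfl

lemma cechVal_d {d : ℕ} {M : GrMod A r} {p : ℕ} (x : ((cechZero A r d).obj M).X p) :
    cechVal (((cechZero A r d).obj M).d p (p + 1) x) = cechLin d M p (cechVal x) := by
  have h : ((cech A r d).obj M).d p (p + 1) = cechD d M p := CochainComplex.of_d _ _ _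
  exact congr((lin $h) (cechVal x))

lemma cechVal_map {d : ℕ} {M N : GrMod A r} (f : M ⟶ N) {p : ℕ}
    (x : ((cechZero A r d).obj M).X p) (J) :
    cechVal (((cechZero A r d).map f).f p x) J = lin f (cechVal x J) := rfl

lemma sProd_face {p : ℕ} (J : Fin (p + 2) ↪o Fin (r + 1)) (k : Fin (p + 2)) :
    sProd A J = MvPolynomial.X (J k) * sProd A (face J k) := Fin.prod_univ_succAbove _ k

lemma sProd_mem {p : ℕ} (J : Fin (p + 1) ↪o Fin (r + 1)) : sProd A J ∈ stdGrading A r (p + 1) := by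
  have := MvPolynomial.IsHomogeneous.prod Finset.univ (fun k ↦ (MvPolynomial.X (J k) : PolyRing A r))
    (fun _ ↦ 1) (fun k _ ↦ MvPolynomial.isHomogeneous_X _ _)
  rw [Finset.sum_const, Finset.card_univ, Fintype.card_fin, smul_eq_mul, mul_one] at this
  exact this

/-- Multiplication by the powers of the denominators. -/
def cechShift (d e : ℕ) (M : GrMod A r) (p : ℕ) : cechObj d M p ⟶ cechObj (d + e) M p where
  toLin := LinearMap.pi fun J ↦ (sProd A J ^ e) • LinearMap.proj J
  map_deg n a ha J _ := by
    have := M.smul_mem' (SetLike.pow_mem_graded e (sProd_mem (A := A) J)) (ha J trivial)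
      (k := n + (d + e : ℕ) * (p + 1)) (by push_cast [smul_eq_mul]; ring)
    exact this

lemma cechLin_shift (d e : ℕ) (M : GrMod A r) (p : ℕ) (a : (Fin (p + 1) ↪o Fin (r + 1)) → M)
    (J : Fin (p + 2) ↪o Fin (r + 1)) :
    cechLin (d + e) M p (fun J ↦ sProd A J ^ e • a J) J = sProd A J ^ e • cechLin d M p a J := by
  rw [cechLin_apply, cechLin_apply, Finset.smul_sum]
  refine Finset.sum_congr rfl fun k _ ↦ ?_
  rw [smul_smul, smul_smul]
  congr 1
  rw [sProd_face J k]
  ring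

/-- The transition maps between the truncated Čech complexes. -/
def cechTransition (A : Type u) [CommRing A] (r d e : ℕ) : cech A r d ⟶ cech A r (d + e) where
  app M := CochainComplex.ofHom (fun p ↦ cechShift d e M p) (fun p ↦ by
    have h (d : ℕ) : ((cech A r d).obj M).d p (p + 1) = cechD d M p := CochainComplex.of_d _ _ _
    refine (congrArg (cechShift d e M p ≫ ·) (h (d + e))).trans
      (Eq.trans ?_ (congrArg (· ≫ cechShift d e M (p + 1)) (h d).symm))
    exact hom_ext fun a ↦ funext fun J ↦ cechLin_shift d e M p a J)
  naturality M N f := HomologicalComplex.hom_ext _ _ fun p ↦ hom_ext fun a ↦ funext fun J ↦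
    ((lin f).map_smul (sProd A J ^ e) (a J)).symm

/-- The transition maps on the degree zero parts. -/
def cechZeroTransition (A : Type u) [CommRing A] (r d e : ℕ) :
    cechZero A r d ⟶ cechZero A r (d + e) :=
  Functor.whiskerRight (cechTransition A r d e) _

lemma cechVal_transition {d e : ℕ} {M : GrMod A r} {p : ℕ} (x : ((cechZero A r d).obj M).X p) (J) :
    cechVal (((cechZeroTransition A r d e).app M).f p x) J = sProd A J ^ e • cechVal x J := rfl

section

variable {d p β : ℕ} {w : Fin β → ℤ}

/-- The components of an element of the truncated Čech complex of a free module. -/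
def freeVal (x : ((cechZero A r d).obj (free A r w)).X p) (i : Fin β)
    (J : Fin (p + 1) ↪o Fin (r + 1)) : PolyRing A r := cechVal x J i

lemma freeVal_ext {x y : ((cechZero A r d).obj (free A r w)).X p}
    (h : ∀ i, freeVal x i = freeVal y i) : x = y :=
  cechVal_injective (funext fun J ↦ funext fun i ↦ congr_fun (h i) J)

lemma freeVal_mem (x : ((cechZero A r d).obj (free A r w)).X p) (i : Fin β) (J) :
    freeVal x i J ∈ polyDeg (σ := Fin (r + 1)) (A := A) (-w i + d * (p + 1)) := by
  have : freeVal x i J ∈ polyDeg (σ := Fin (r + 1)) (A := A) (0 + d * (p + 1) + -w i) :=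
    cechVal_mem x J i trivial
  convert this using 1
  ring_nf

lemma exists_freeVal_eq (a : Fin β → (Fin (p + 1) ↪o Fin (r + 1)) → PolyRing A r)
    (ha : ∀ i J, a i J ∈ polyDeg (σ := Fin (r + 1)) (A := A) (-w i + d * (p + 1))) :
    ∃ x : ((cechZero A r d).obj (free A r w)).X p, ∀ i, freeVal x i = a i := by
  refine ⟨cechMk (M := free A r w) (fun J (i : Fin β) ↦ a i J) fun J i _ ↦ ?_, fun i ↦ rfl⟩
  have := ha i J
  change a i J ∈ polyDeg (σ := Fin (r + 1)) (A := A) (0 + d * (p + 1) + -w i)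
  convert this using 1
  ring_nf

lemma freeVal_d (x : ((cechZero A r d).obj (free A r w)).X p) (i : Fin β) :
    freeVal (((cechZero A r d).obj (free A r w)).d p (p + 1) x) i = cechPoly d p (freeVal x i) := by
  ext1 J
  refine (congrArg (fun z ↦ (z J : Fin β → PolyRing A r) i) (cechVal_d x)).trans ?_
  exact (cechLin_map d (M := free A r w) (N := self A r)
      (LinearMap.proj (φ := fun _ : Fin β ↦ PolyRing A r) i) p (cechVal x) J).symm

lemma freeVal_transition (e : ℕ) (x : ((cechZero A r d).obj (free A r w)).X p) (i : Fin β) :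
    freeVal (((cechZeroTransition A r d e).app (free A r w)).f p x) i =
      fun J ↦ sProd A J ^ e * freeVal x i J := rfl

lemma freeVal_add (x y : ((cechZero A r d).obj (free A r w)).X p) (i : Fin β) :
    freeVal (x + y) i = freeVal x i + freeVal y i := rfl

lemma freeVal_zero (i : Fin β) :
    freeVal (0 : ((cechZero A r d).obj (free A r w)).X p) i = 0 := rfl

end

/-- The complex of ⨁ S(-w i) splits into those of the summands. Degree zero in S(-w i) means Laurent
polynomials of degree n = -w i, for which the condition -n - r ≤ d reads w i - r ≤ d. -/
lemma quasiIso_cechZeroTransition_free {d : ℕ} (e : ℕ) {β : ℕ} (w : Fin β → ℤ)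
    (hw : ∀ i, w i - r ≤ d) : QuasiIso ((cechZeroTransition A r d e).app (free A r w)) := by
  have hn (i) : - -w i - r ≤ d := by rw [neg_neg]; exact hw i
  apply CochainComplex.quasiIso_of_elements
  · intro p y hy
    have hy' (i : Fin β) : cechPoly (d + e) p (freeVal y i) = 0 := by
      rw [← freeVal_d, hy, freeVal_zero]
    obtain _ | p := p
    · choose a ha ha0 hab using fun i ↦ cocycle_surj_zero (n := -w i) e (hn i)
        (freeVal y i) (freeVal_mem y i) (hy' i)
      obtain ⟨x, hx⟩ := exists_freeVal_eq a ha
      refine ⟨x, ?_, 0, 0, ?_⟩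
      · exact freeVal_ext fun i ↦ by rw [freeVal_d, hx, ha0, freeVal_zero]
      · rw [map_zero, add_zero]
        exact freeVal_ext fun i ↦ by rw [freeVal_transition, hx, hab]
    · choose a ha ha0 c hc hab using fun i ↦ cocycle_surj_succ (n := -w i) e (hn i)
        (freeVal y i) (freeVal_mem y i) (hy' i)
      obtain ⟨x, hx⟩ := exists_freeVal_eq a ha
      obtain ⟨z, hz⟩ := exists_freeVal_eq c hc
      refine ⟨x, ?_, p, z, ?_⟩
      · exact freeVal_ext fun i ↦ by rw [freeVal_d, hx, ha0, freeVal_zero]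
      · exact freeVal_ext fun i ↦ by
          rw [freeVal_add, freeVal_d, hz, freeVal_transition, hx, hab]
  · intro p x hx i z hz
    by_cases hip : i + 1 = p
    · subst hip
      have hxz (j : Fin β) : (fun J ↦ sProd A J ^ e * freeVal x j J) =
          cechPoly (d + e) i (freeVal z j) := by
        rw [← freeVal_d, ← hz, freeVal_transition]
      choose c hc hac using fun j ↦ cocycle_inj_succ (n := -w j) e
        (freeVal x j) (freeVal_mem x j) (freeVal z j) (freeVal_mem z j) (hxz j)
      obtain ⟨y, hy⟩ := exists_freeVal_eq c hc
      exact ⟨i, y, freeVal_ext fun j ↦ by rw [freeVal_d, hy, hac]⟩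
    -- Here the differential into degree p from the given index is zero, so x is killed by
    -- multiplication with the powers of the s_J, which is injective on polynomials.
    · rw [HomologicalComplex.shape _ _ _ hip] at hz
      refine ⟨0, 0, ?_⟩
      rw [map_zero]
      refine freeVal_ext fun j ↦ cocycle_inj_zero e _ ?_
      rw [← freeVal_transition, hz]
      rfl

end GrMod
end

/-! ### Dévissage along a free resolution -/

noncomputable section

namespace GrMod

variable {A : Type u} [CommRing A] {r : ℕ}

/-- The short exact sequence of truncated Čech complexes of `0 ⟶ ker f ⟶ M ⟶ N ⟶ 0`. -/
abbrev cechKerSeq (d : ℕ) {M N : GrMod A r} (f : M ⟶ N) :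
    ShortComplex (CochainComplex (ModuleCat.{u} A) ℕ) :=
  ShortComplex.mk ((cechZero A r d).map (kerι f)) ((cechZero A r d).map f) (by
    rw [← Functor.map_comp]
    have h : kerι f ≫ f = 0 := hom_ext fun m ↦ m.2
    rw [h]
    rfl)

/-- The degree zero part of each term is a finite product of homogeneous components of the module,
and taking these is exact: homogeneous elements lift to homogeneous elements of the same degree. -/
lemma cechKerSeq_shortExact (d : ℕ) {M N : GrMod A r} (f : M ⟶ N)
    (hf : Function.Surjective (lin f)) : (cechKerSeq d f).ShortExact := by
  refine HomologicalComplex.shortExact_of_degreewise_shortExact _ fun p ↦ ?_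
  refine { exact := ?_, mono_f := ?_, epi_g := ?_ }
  · rw [ShortComplex.moduleCat_exact_iff]
    intro (x : ((cechZero A r d).obj M).X p) hx
    have hx' : ((cechZero A r d).map f).f p x = 0 := hx
    have h0 (J) : lin f (cechVal x J) = 0 := congr_fun (congrArg cechVal hx') J
    exact ⟨cechMk (M := ker f) (fun J ↦ ⟨cechVal x J, h0 J⟩) (fun J ↦ cechVal_mem x J), rfl⟩
  · refine (ModuleCat.mono_iff_injective _).2 fun x y hxy ↦ ?_
    have hxy' : ((cechZero A r d).map (kerι f)).f p x = ((cechZero A r d).map (kerι f)).f p y := hxy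
    exact cechVal_injective (funext fun J ↦ Subtype.ext (congr_fun (congrArg cechVal hxy') J))
  · refine (ModuleCat.epi_iff_surjective _).2 fun (y : ((cechZero A r d).obj N).X p) ↦ ?_
    choose a ha hay using fun J ↦ exists_homogeneous_lift f hf (cechVal_mem y J)
    exact ⟨cechMk a ha, cechVal_injective (funext hay)⟩

/-- Modules with the beginning of a graded free resolution of length `k` whose generators
have degrees at most `d + r`. -/
def HasFreeSteps (d : ℕ) : ℕ → GrMod A r → Prop
  | 0, _ => True
  | k + 1, M => ∃ (β : ℕ) (w : Fin β → ℤ) (ε : free A r w ⟶ M), (∀ i, w i - r ≤ d) ∧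
      Function.Surjective (lin ε) ∧ HasFreeSteps d k (ker ε)

/-- The resolution of the first syzygy module. -/
def FreeResolution.tail {M : GrMod A r} (K : FreeResolution M) : FreeResolution (ker K.ε) where
  β p := K.β (p + 1)
  w p := K.w (p + 1)
  d p := K.d (p + 1)
  ε := ⟨(lin (K.d 0)).codRestrict _ fun m ↦ (K.exact_zero _).2 ⟨m, rfl⟩, fun n m h ↦ lin_deg (K.d 0) (m := m) h⟩
  exact p := K.exact (p + 1)
  exact_zero m := by
    refine Iff.trans ?_ (K.exact 0 m)
    exact Subtype.ext_iff
  surjective := by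
    rintro ⟨m, hm⟩
    obtain ⟨x, hx⟩ := (K.exact_zero m).1 hm
    exact ⟨x, Subtype.ext hx⟩

lemma FreeResolution.hasFreeSteps {d : ℕ} (k : ℕ) {M : GrMod A r} (K : FreeResolution M)
    (hK : ∀ p < k, ∀ i, K.w p i - r ≤ d) : HasFreeSteps d k M := by
  induction k generalizing M with
  | zero => trivial
  | succ k ih =>
    exact ⟨_, _, K.ε, hK 0 (by omega), K.surjective,
      ih K.tail fun p hp ↦ hK (p + 1) (by omega)⟩

lemma isZero_cechZero_X {d p : ℕ} (hp : r < p) (M : GrMod A r) :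
    IsZero (((cechZero A r d).obj M).X p) := by
  have : IsEmpty (Fin (p + 1) ↪o Fin (r + 1)) := ⟨fun J ↦ by
    have := Fintype.card_le_of_injective J J.injective
    simp at this
    omega⟩
  have : Subsingleton (((cechZero A r d).obj M).X p) :=
    ⟨fun x y ↦ cechVal_injective (Subsingleton.elim _ _)⟩
  exact ModuleCat.isZero_of_subsingleton _

/-- Comparison of short exact sequences of truncated Čech complexes. -/
abbrev cechKerSeqMap (d e : ℕ) {M N : GrMod A r} (f : M ⟶ N) :
    cechKerSeq d f ⟶ cechKerSeq (d + e) f where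
  τ₁ := (cechZeroTransition A r d e).app _
  τ₂ := (cechZeroTransition A r d e).app _
  τ₃ := (cechZeroTransition A r d e).app _
  comm₁₂ := ((cechZeroTransition A r d e).naturality _).symm
  comm₂₃ := ((cechZeroTransition A r d e).naturality _).symm

/-- For k = 0 the complexes vanish above degree r. In the long exact sequences of 0 → ker ε → F → M
→ 0 the maps for F are isomorphisms. So surjectivity for M in degree p needs surjectivity for the
kernel in degree p + 1, and injectivity needs injectivity in degree p + 1 and surjectivity in degree
p. Each step lowers both ranges by one, and injectivity in degree 0 is reached at k = r + 2. -/
lemma HasFreeSteps.epi_mono {d : ℕ} (e k : ℕ) {M : GrMod A r} (hM : HasFreeSteps d k M) (p : ℕ) :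
    (r + 1 ≤ p + k → Epi (HomologicalComplex.homologyMap ((cechZeroTransition A r d e).app M) p)) ∧
    (r + 2 ≤ p + k → Mono (HomologicalComplex.homologyMap ((cechZeroTransition A r d e).app M) p)) := by
  induction k generalizing M p with
  | zero =>
    have hz (d : ℕ) (hp : r + 1 ≤ p) : IsZero (((cechZero A r d).obj M).homology p) :=
      ShortComplex.isZero_homology_of_isZero_X₂ _ (isZero_cechZero_X (by omega) M)
    exact ⟨fun h ↦ ⟨fun _ _ _ ↦ (hz _ h).eq_of_src _ _⟩,
      fun h ↦ ⟨fun _ _ _ ↦ (hz d (by omega)).eq_of_tgt _ _⟩⟩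
  | succ k ih =>
    obtain ⟨β, w, ε, hw, hε, hk⟩ := hM
    have hF : QuasiIso (cechKerSeqMap (A := A) d e ε).τ₂ := quasiIso_cechZeroTransition_free e w hw
    constructor
    · intro h
      exact HomologicalComplex.HomologySequence.epi_homologyMap_τ₃ (cechKerSeqMap d e ε)
        (cechKerSeq_shortExact _ _ hε) (cechKerSeq_shortExact _ _ hε) p inferInstance
        (fun j hj ↦ by
          obtain rfl : p + 1 = j := hj
          exact (ih hk (p + 1)).1 (by omega))
        (fun j _ ↦ inferInstance)
    · intro h
      exact HomologicalComplex.HomologySequence.mono_homologyMap_τ₃ (cechKerSeqMap d e ε)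
        (cechKerSeq_shortExact _ _ hε) (cechKerSeq_shortExact _ _ hε) p
        ((ih hk p).1 (by omega)) inferInstance
        (fun j hj ↦ by
          obtain rfl : p + 1 = j := hj
          exact (ih hk (p + 1)).2 (by omega))

/-- The transition maps between the truncated Čech complexes are quasi-isomorphisms as soon as
`d` is large compared to the degrees of the generators of a free resolution. -/
lemma FreeResolution.quasiIso_cechZeroTransition {d : ℕ} (e : ℕ) {M : GrMod A r}
    (K : FreeResolution M) (hd : Nontrivial M → ∀ p ≤ r + 1, ∀ i, K.w p i - r ≤ d) :
    QuasiIso ((cechZeroTransition A r d e).app M) := by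
  by_cases hM : Nontrivial M
  · have h := K.hasFreeSteps (d := d) (r + 2) fun p hp ↦ hd hM p (by omega)
    refine ⟨fun p ↦ ?_⟩
    rw [quasiIsoAt_iff_isIso_homologyMap]
    have h1 := (h.epi_mono e (r + 2) p).1 (by omega)
    have h2 := (h.epi_mono e (r + 2) p).2 (by omega)
    exact isIso_of_mono_of_epi _
  -- For the zero module nothing is assumed about the degrees of the generators, but both complexes
  -- are zero.
  · have := not_nontrivial_iff_subsingleton.1 hM
    have hs {d p : ℕ} : Subsingleton (((cechZero A r d).obj M).X p) :=
      ⟨fun x y ↦ cechVal_injective (Subsingleton.elim _ _)⟩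
    exact CochainComplex.quasiIso_of_elements _
      (fun p y _ ↦ ⟨0, map_zero _, 0, 0, Subsingleton.elim _ _⟩)
      (fun p x _ _ _ _ ↦ ⟨0, 0, Subsingleton.elim _ _⟩)

end GrMod
end

/-! ### Quasi-coherence of the direct image of the Čech sheaves -/

noncomputable section

namespace AlgebraicGeometry.Scheme.Modules

open TopologicalSpace TopCat Opposite GrMod

variable {A : Type u} [CommRing A] {r : ℕ}

/-- The action of `A` on the sections of a sheaf of modules on `Spec A`. -/
instance specSectionsModule (N : (Spec (.of A)).Modules) (U : (Spec (.of A)).Opens) :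
    Module A Γ(N, U) :=
  let h (R : CommRingCat.{u}) (N : (Spec R).Modules) (U : (Spec R).Opens) : Module R Γ(N, U) :=
    inferInstance
  h (.of A) N U

section
variable {κ : Type} [Finite κ] {W : κ → (projSpace A r).Opens} {M : GrMod A r}

/-- The value at a point of the `k`-th component of a family of sections. -/
def famVal {U : (projSpace A r).Opens} (σ : Fam W M.tildeObj U) (k : κ)
    (x : projSpace A r) (hx : x ∈ U ⊓ W k) : M.locAt x :=
  (show M.sections (U ⊓ W k) from σ k).1 ⟨x, hx⟩

lemma _root_.LocalizedModule.mk_eq_zero_iff {R : Type*} [CommSemiring R] {S : Submonoid R}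
    {M : Type*} [AddCommMonoid M] [Module R M] {m : M} {s : S} :
    LocalizedModule.mk m s = 0 ↔ ∃ t : S, t • m = 0 := by
  rw [← LocalizedModule.zero_mk 1, LocalizedModule.mk_eq]
  simp

lemma famVal_ext {U : (projSpace A r).Opens} {σ τ : Fam W M.tildeObj U}
    (h : ∀ k x hx, famVal σ k x hx = famVal τ k x hx) : σ = τ :=
  funext fun k ↦ Subtype.ext (funext fun x ↦ h k x.1 x.2)

lemma val_restrict_scalar (a : A) {U : (projSpace A r).Opens} (x : U) :
    (((projSpace A r).presheaf.map (homOfLE (le_top : U ≤ ⊤)).op (scalar A r a)).1 x).val =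
      algebraMap _ _ (MvPolynomial.C a : PolyRing A r) := val_scalar a x.1

lemma famVal_smul (U : (Spec (.of A)).Opens) (a : A)
    (σ : Γ((pushforward (projSpaceToSpec A r)).obj (fam W M.tildeObj), U))
    (k : κ) (x : projSpace A r) (hx : x ∈ projSpaceToSpec A r ⁻¹ᵁ U ⊓ W k) :
    famVal (W := W) (M := M) (show Γ((pushforward (projSpaceToSpec A r)).obj (fam W M.tildeObj), U)
      from a • σ) k x hx =
      (MvPolynomial.C a : PolyRing A r) • famVal (W := W) (M := M) σ k x hx := by
  let t : Γ(projSpace A r, projSpaceToSpec A r ⁻¹ᵁ U) := (projSpaceToSpec A r).app U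
    ((Spec (.of A)).presheaf.map U.leTop.op ((Scheme.ΓSpecIso (.of A)).inv a))
  have ht : t = (projSpace A r).presheaf.map (homOfLE (le_top : projSpaceToSpec A r ⁻¹ᵁ U ≤ ⊤)).op
      (scalar A r a) :=
    congr($((projSpaceToSpec A r).naturality U.leTop.op) ((Scheme.ΓSpecIso (.of A)).inv a))
  have h1 : famVal (W := W) (M := M) (show Γ((pushforward (projSpaceToSpec A r)).obj
      (fam W M.tildeObj), U) from a • σ) k x hx =
      (t.1 ⟨x, hx.1⟩) • famVal (W := W) (M := M) (U := projSpaceToSpec A r ⁻¹ᵁ U) σ k x hx := rfl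
  rw [h1]
  change (t.1 ⟨x, hx.1⟩).val • famVal (W := W) (M := M) σ k x hx = _
  rw [ht]
  refine (congrArg (· • famVal (W := W) (M := M) (U := projSpaceToSpec A r ⁻¹ᵁ U) σ k x hx)
    (val_restrict_scalar a (U := projSpaceToSpec A r ⁻¹ᵁ U) ⟨x, hx.1⟩)).trans ?_
  exact algebraMap_smul _ _ _

lemma exists_forall_fracOn (v : κ → PolyRing A r) (l : κ → ℕ) (hl : ∀ k, 0 < l k)
    (hv : ∀ k, v k ∈ stdGrading A r (l k)) {U : (projSpace A r).Opens}
    (hU : ∀ k, D (v k) ≤ U ⊓ W k) (σ : Fam W M.tildeObj U) :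
    ∃ N : ℕ, ∀ n ≥ N, ∀ k, ∃ m ∈ M.deg (n * l k : ℕ), ∀ (x : projSpace A r) (hx : x ∈ U ⊓ W k)
      (hx' : x ∈ D (v k)), famVal σ k x hx = LocalizedModule.mk m ⟨v k ^ n, pow_mem_D hx' n⟩ := by
  have h (k) : ∃ n, FracOn (show M.sections (U ⊓ W k) from σ k) (v k) (l k) n :=
    exists_fracOn _ (hl k) (hv k) (hU k)
  choose n hn using h
  obtain ⟨N, hN⟩ := (Set.finite_range n).bddAbove
  refine ⟨N, fun n' hn' k ↦ ?_⟩
  have h1 := (hn k).raise (hv k) (n' - n k)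
  rw [Nat.sub_add_cancel ((hN ⟨k, rfl⟩).trans hn')] at h1
  obtain ⟨m, hm, h⟩ := h1
  exact ⟨m, hm, fun x hx hx' ↦ h ⟨x, hx⟩ hx'⟩

/-- The sections over D(a) have to be the localization at a of the global sections. Over D(a) the
k-th component is m/(a v_k)^N, so multiplication by a^N makes it extend to m/v_k^N. If a global
section m/v_k^N vanishes over D(a), then (a v_k)^n kills m, so a^n kills the section. Finiteness of
κ gives exponents that do not depend on k. -/
theorem isLocalizing_pushforward_fam (v : κ → PolyRing A r) (l : κ → ℕ) (hl : ∀ k, 0 < l k)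
    (hv : ∀ k, v k ∈ stdGrading A r (l k)) (hW : ∀ k, W k = D (v k)) :
    IsLocalizing (modulesSpecToSheaf.obj
      ((pushforward (projSpaceToSpec A r)).obj (fam W M.tildeObj))) := by
  intro (a : A)
  have hC (n : ℕ) : (MvPolynomial.C a ^ n : PolyRing A r) ∈ stdGrading A r 0 := by
    rw [← map_pow]; exact MvPolynomial.isHomogeneous_C _ _
  have hpre : projSpaceToSpec A r ⁻¹ᵁ PrimeSpectrum.basicOpen a = D (MvPolynomial.C a) :=
    projSpaceToSpec_preimage a
  refine IsLocalizedModule.Away.mk_of_addCommGroup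
    (isUnit_algebraMap_end_of_le_basicOpen (R := .of A)
      (M := (pushforward (projSpaceToSpec A r)).obj (fam W M.tildeObj)) a le_rfl) ?_ ?_
  · intro (σ : Fam W M.tildeObj (projSpaceToSpec A r ⁻¹ᵁ PrimeSpectrum.basicOpen a))
    obtain ⟨N, hN⟩ := exists_forall_fracOn (fun k ↦ MvPolynomial.C a * v k) l hl
      (fun k ↦ by simpa using SetLike.mul_mem_graded (hC 1) (hv k))
      (fun k ↦ by rw [hpre, hW, D_mul]) σ
    choose m hm h using hN N le_rfl
    refine ⟨N, (fun k ↦ fracSec M (hm k) (SetLike.pow_mem_graded N (hv k))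
      (fun x hx ↦ pow_mem_D (by have := hx.2; rwa [hW k] at this) N) : Fam W M.tildeObj _), ?_⟩
    refine famVal_ext (W := W) (M := M) fun k x hx ↦ ?_
    refine (famVal_smul (W := W) (M := M) (PrimeSpectrum.basicOpen a) (a ^ N) σ k x hx).trans ?_
    have hx' : x ∈ D (MvPolynomial.C a * v k) := by
      rw [D_mul, ← hpre, ← hW]; exact hx
    rw [h k x hx hx', LocalizedModule.smul'_mk]
    refine mk_eq_mk_of _ _ 1 (x.asHomogeneousIdeal.toIdeal.primeCompl.one_mem) ?_
    rw [one_smul, one_smul, smul_smul, mul_pow, ← map_pow, mul_comm]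
  · intro (σ : Fam W M.tildeObj (projSpaceToSpec A r ⁻¹ᵁ ⊤)) hσ
    obtain ⟨N, hN⟩ := exists_forall_fracOn v l hl hv
      (fun k ↦ by rw [hW]; exact le_inf le_top le_rfl) σ
    choose m hm h using hN N le_rfl
    have h2 (k) : ∃ n, (MvPolynomial.C a * v k) ^ n • m k = 0 := by
      refine exists_pow_smul_eq_zero (hl k)
        (by simpa using SetLike.mul_mem_graded (hC 1) (hv k)) (hm k) fun x hx ↦ ?_
      have hx' := hx
      rw [D_mul] at hx'
      have h3 := h k x ⟨True.intro, by rw [hW]; exact hx'.2⟩ hx'.2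
      have h4 : famVal (W := W) (M := M) σ k x ⟨True.intro, by rw [hW]; exact hx'.2⟩ = 0 :=
        congr(famVal (W := W) (M := M) (U := projSpaceToSpec A r ⁻¹ᵁ PrimeSpectrum.basicOpen a)
          $hσ k x ⟨by rw [hpre]; exact hx'.1, by rw [hW]; exact hx'.2⟩)
      rw [h3, LocalizedModule.mk_eq_zero_iff] at h4
      obtain ⟨⟨t, ht⟩, h4⟩ := h4
      exact ⟨t, ht, h4⟩
    choose n hn using h2
    obtain ⟨B, hB⟩ := (Set.finite_range n).bddAbove
    refine ⟨B, famVal_ext (W := W) (M := M) fun k x hx ↦ ?_⟩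
    refine (famVal_smul (W := W) (M := M) ⊤ (a ^ B) σ k x hx).trans ?_
    have hx' : x ∈ D (v k) := by rw [← hW]; exact hx.2
    refine (?_ : _ = (0 : M.locAt x))
    rw [h k x hx hx', LocalizedModule.smul'_mk, LocalizedModule.mk_eq_zero_iff]
    refine ⟨⟨v k ^ n k, pow_mem_D hx' _⟩, ?_⟩
    change v k ^ n k • (MvPolynomial.C (a ^ B) : PolyRing A r) • m k = 0
    have h5 : v k ^ n k * MvPolynomial.C (a ^ B) =
        MvPolynomial.C a ^ (B - n k) * (MvPolynomial.C a * v k) ^ n k := by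
      rw [mul_pow, ← mul_assoc, ← pow_add, Nat.sub_add_cancel (hB ⟨k, rfl⟩), mul_comm, map_pow]
    rw [smul_smul, h5, mul_smul, hn, smul_zero]

end

end AlgebraicGeometry.Scheme.Modules
end

/-! ### From the truncated Čech complex to the Čech complex of the sheaf -/

noncomputable section

/-- The functor of global sections of sheaves of modules on `Spec A`. -/
def specΓ (A : Type u) [CommRing A] : (Spec (CommRingCat.of A)).Modules ⥤ ModuleCat.{u} A :=
  moduleSpecΓFunctor (R := CommRingCat.of A)

/-- The functor `specTilde A` is left adjoint to the functor of global sections. -/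
def specAdjunction (A : Type u) [CommRing A] : specTilde A ⊣ specΓ A :=
  AlgebraicGeometry.tilde.adjunction (R := CommRingCat.of A)

instance (A : Type u) [CommRing A] : (specΓ A).Additive :=
  (specAdjunction A).right_adjoint_additive

namespace GrMod

open TopologicalSpace TopCat Opposite AlgebraicGeometry.Scheme.Modules

variable {A : Type u} [CommRing A] {r : ℕ}

/-- The standard covering of projective space. -/
abbrev stdCover (A : Type u) [CommRing A] (r : ℕ) (i : Fin (r + 1)) : (projSpace A r).Opens :=
  D (MvPolynomial.X i : PolyRing A r)

lemma mem_cap {p : ℕ} {J : Fin (p + 1) ↪o Fin (r + 1)} {x : projSpace A r} :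
    x ∈ cap (stdCover A r) J ↔ ∀ k, x ∈ D (MvPolynomial.X (J k) : PolyRing A r) := by
  rw [cap, ← SetLike.mem_coe, Opens.coe_iInf, Set.mem_iInter]
  rfl

lemma cap_stdCover {p : ℕ} (J : Fin (p + 1) ↪o Fin (r + 1)) :
    cap (stdCover A r) J = D (sProd A J) := by
  ext x
  refine mem_cap.trans ?_
  change _ ↔ sProd A J ∉ x.asHomogeneousIdeal.toIdeal
  rw [sProd, Ideal.IsPrime.prod_mem_iff]
  simp [mem_D]

/-- The direct image of the sheaf Čech complex of `M~`, as a functor of `M`. -/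
def pushCech (A : Type u) [CommRing A] (r : ℕ) :
    GrMod A r ⥤ CochainComplex (Spec (CommRingCat.of A)).Modules ℕ :=
  tilde A r ⋙ cechSheaf (stdCover A r) ⋙
    (pushforward (projSpaceToSpec A r)).mapHomologicalComplex (ComplexShape.up ℕ)

/-- The Čech complex of `M~`, as a functor of `M`. -/
def sheafCech (A : Type u) [CommRing A] (r : ℕ) : GrMod A r ⥤ CochainComplex (ModuleCat.{u} A) ℕ :=
  pushCech A r ⋙ (specΓ A).mapHomologicalComplex (ComplexShape.up ℕ)

variable {d : ℕ} {M N : GrMod A r}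

/-- The values of a cochain of the Čech complex of `M~`. -/
def sheafVal {p : ℕ} (y : ((sheafCech A r).obj M).X p) (J : Fin (p + 1) ↪o Fin (r + 1))
    (x : projSpace A r) (hx : x ∈ cap (stdCover A r) J) : M.locAt x :=
  famVal (U := projSpaceToSpec A r ⁻¹ᵁ ⊤) (W := cap (stdCover A r) (p := p))
    (M := M) y J x ⟨True.intro, hx⟩

lemma sheafVal_ext {p : ℕ} {y z : ((sheafCech A r).obj M).X p}
    (h : ∀ J x hx, sheafVal y J x hx = sheafVal z J x hx) : y = z :=
  famVal_ext (U := projSpaceToSpec A r ⁻¹ᵁ ⊤) (W := cap (stdCover A r) (p := p))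
    (M := M) fun J x hx ↦ h J x hx.2

lemma sheafVal_smul {p : ℕ} (a : A) (y : ((sheafCech A r).obj M).X p) (J x hx) :
    sheafVal (a • y) J x hx = (MvPolynomial.C a : PolyRing A r) • sheafVal y J x hx :=
  famVal_smul (W := cap (stdCover A r) (p := p)) (M := M) ⊤ a y J x ⟨True.intro, hx⟩

lemma sheafVal_add {p : ℕ} (y z : ((sheafCech A r).obj M).X p) (J x hx) :
    sheafVal (y + z) J x hx = sheafVal y J x hx + sheafVal z J x hx := rfl

lemma sheafVal_map {p : ℕ} (f : M ⟶ N) (y : ((sheafCech A r).obj M).X p) (J x hx) :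
    sheafVal (((sheafCech A r).map f).f p y) J x hx =
      LocalizedModule.map _ (lin f) (sheafVal y J x hx) := rfl

lemma cap_face' {p : ℕ} {J : Fin (p + 2) ↪o Fin (r + 1)} {x : projSpace A r}
    (hx : x ∈ cap (stdCover A r) J) (k : Fin (p + 2)) : x ∈ cap (stdCover A r) (face J k) :=
  cap_face _ J k hx

lemma sheafVal_d {p : ℕ} (y : ((sheafCech A r).obj M).X p) (J : Fin (p + 2) ↪o Fin (r + 1)) (x hx) :
    sheafVal (((sheafCech A r).obj M).d p (p + 1) y) J x hx =
      ∑ k : Fin (p + 2), (-1 : ℤ) ^ (k : ℕ) • sheafVal y (face J k) x (cap_face' hx k) := by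
  have h := cechSheaf_d (stdCover A r) M.tildeObj p
  have h1 : sheafVal (((sheafCech A r).obj M).d p (p + 1) y) J x hx =
      famVal (U := projSpaceToSpec A r ⁻¹ᵁ ⊤) (W := cap (stdCover A r) (p := p + 1)) (M := M)
        (sec (((cechSheaf (stdCover A r)).obj M.tildeObj).d p (p + 1))
          (projSpaceToSpec A r ⁻¹ᵁ ⊤) y) J x ⟨True.intro, hx⟩ := rfl
  rw [h1, h]
  let ev : M.sections (projSpaceToSpec A r ⁻¹ᵁ ⊤ ⊓ cap (stdCover A r) J) →+ M.locAt x :=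
    { toFun := fun σ ↦ σ.1 ⟨x, True.intro, hx⟩
      map_zero' := rfl
      map_add' := fun _ _ ↦ rfl }
  refine (map_sum ev _ _).trans ?_
  refine Finset.sum_congr rfl fun k _ ↦ ?_
  exact map_zsmul ev _ _

lemma pow_sProd_mem (d : ℕ) {p : ℕ} (J : Fin (p + 1) ↪o Fin (r + 1)) :
    sProd A J ^ d ∈ stdGrading A r (d * (p + 1)) := SetLike.pow_mem_graded d (sProd_mem J)

lemma pow_sProd_notMem (d : ℕ) {p : ℕ} {J : Fin (p + 1) ↪o Fin (r + 1)} {x : projSpace A r}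
    (hx : x ∈ cap (stdCover A r) J) : sProd A J ^ d ∉ x.asHomogeneousIdeal.toIdeal :=
  pow_mem_D (by rwa [cap_stdCover] at hx) d

/-- The family of sections `m / (s_{i₀} ⋯ s_{i_p}) ^ d` defined by a truncated Čech cochain. -/
def fracFam {p : ℕ} (a : ((cechZero A r d).obj M).X p) : ((sheafCech A r).obj M).X p :=
  (fun J ↦ fracSec M (m := cechVal a J) (e := d * (p + 1))
    (by have := cechVal_mem a J; rw [zero_add] at this; exact_mod_cast this)
    (pow_sProd_mem d J) (fun _ hx ↦ pow_sProd_notMem d hx.2) :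
    Fam (cap (stdCover A r) (p := p)) M.tildeObj (projSpaceToSpec A r ⁻¹ᵁ ⊤))

lemma sheafVal_fracFam {p : ℕ} (a : ((cechZero A r d).obj M).X p) (J x hx) :
    sheafVal (fracFam a) J x hx =
      LocalizedModule.mk (cechVal a J) ⟨sProd A J ^ d, pow_sProd_notMem d hx⟩ := rfl

lemma fracFam_add {p : ℕ} (a b : ((cechZero A r d).obj M).X p) :
    fracFam (a + b) = fracFam a + fracFam b :=
  sheafVal_ext fun J x hx ↦ by
    rw [sheafVal_add, sheafVal_fracFam, sheafVal_fracFam, sheafVal_fracFam,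
      LocalizedModule.mk_add_mk, cechVal_add, Pi.add_apply, ← smul_add]
    exact mk_eq_mk_of _ _ 1 (x.asHomogeneousIdeal.toIdeal.primeCompl.one_mem)
      (by simp [mul_smul, Submonoid.smul_def])

lemma fracFam_smul {p : ℕ} (c : A) (a : ((cechZero A r d).obj M).X p) :
    fracFam (c • a) = c • fracFam a :=
  sheafVal_ext fun J x hx ↦ by
    rw [sheafVal_smul, sheafVal_fracFam, sheafVal_fracFam, LocalizedModule.smul'_mk]
    rfl

lemma fracFam_d {p : ℕ} (a : ((cechZero A r d).obj M).X p) :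
    fracFam (((cechZero A r d).obj M).d p (p + 1) a) =
      ((sheafCech A r).obj M).d p (p + 1) (fracFam a) :=
  sheafVal_ext fun J x hx ↦ by
    rw [sheafVal_d, sheafVal_fracFam, cechVal_d, cechLin_apply]
    let f : M →+ M.locAt x :=
      { toFun := fun m ↦ LocalizedModule.mk m ⟨sProd A J ^ d, pow_sProd_notMem d hx⟩
        map_zero' := LocalizedModule.zero_mk _
        map_add' := fun m n ↦ by
          rw [LocalizedModule.mk_add_mk, ← smul_add]
          exact mk_eq_mk_of _ _ 1 (x.asHomogeneousIdeal.toIdeal.primeCompl.one_mem)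
            (by simp [mul_smul, Submonoid.smul_def]) }
    refine (map_sum f _ _).trans (Finset.sum_congr rfl fun k _ ↦ ?_)
    have h1 : ((-1) ^ (k : ℕ) * MvPolynomial.X (J k) ^ d : PolyRing A r) • cechVal a (face J k) =
        (-1 : ℤ) ^ (k : ℕ) • (MvPolynomial.X (J k) ^ d : PolyRing A r) • cechVal a (face J k) := by
      rw [mul_smul, ← Int.cast_smul_eq_zsmul (PolyRing A r)]
      push_cast
      rfl
    rw [h1, map_zsmul]
    congr 1
    refine mk_eq_mk_of _ _ 1 (x.asHomogeneousIdeal.toIdeal.primeCompl.one_mem) ?_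
    rw [one_smul, one_smul, smul_smul, sProd_face J k, mul_pow, mul_comm]

lemma fracFam_map {p : ℕ} (f : M ⟶ N) (a : ((cechZero A r d).obj M).X p) :
    fracFam (((cechZero A r d).map f).f p a) = ((sheafCech A r).map f).f p (fracFam a) :=
  sheafVal_ext fun J x hx ↦ by
    rw [sheafVal_map, sheafVal_fracFam, sheafVal_fracFam, cechVal_map]
    exact (LocalizedModule.map_mk ..).symm

lemma fracFam_transition {p : ℕ} (e : ℕ) (a : ((cechZero A r d).obj M).X p) :
    fracFam (((cechZeroTransition A r d e).app M).f p a) = fracFam a :=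
  sheafVal_ext fun J x hx ↦ by
    rw [sheafVal_fracFam, sheafVal_fracFam, cechVal_transition]
    refine mk_eq_mk_of _ _ 1 (x.asHomogeneousIdeal.toIdeal.primeCompl.one_mem) ?_
    rw [one_smul, one_smul, smul_smul, pow_add]

/-- The linear map underlying `fracFam`. -/
def fracLin (d : ℕ) (M : GrMod A r) (p : ℕ) :
    ((cechZero A r d).obj M).X p →ₗ[A] ((sheafCech A r).obj M).X p where
  toFun := fracFam
  map_add' := fracFam_add
  map_smul' := fracFam_smul

/-- The map from the truncated Čech complex of a graded module to the Čech complex of the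
associated sheaf. -/
def cechFrac (A : Type u) [CommRing A] (r d : ℕ) : cechZero A r d ⟶ sheafCech A r where
  app M :=
    { f := fun p ↦ ConcreteCategory.ofHom (C := ModuleCat.{u} A) (fracLin d M p)
      comm' := by
        rintro p _ rfl
        ext a
        exact (fracFam_d a).symm }
  naturality M N f := by
    ext p a
    exact fracFam_map f a

/-- Together with `exists_transition_eq_zero`, this says that the Čech complex of the sheaf is the
colimit of the truncated complexes: every cochain is reached at some level, and what becomes zero
does so at some level. -/
lemma exists_fracFam_eq {p : ℕ} (y : ((sheafCech A r).obj M).X p) :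
    ∃ (e : ℕ) (a : ((cechZero A r (d + e)).obj M).X p), fracFam a = y := by
  obtain ⟨n, hn⟩ := exists_forall_fracOn (W := cap (stdCover A r) (p := p)) (M := M)
    (fun J ↦ sProd A J) (fun _ ↦ p + 1)
    (fun _ ↦ p.succ_pos) (fun J ↦ sProd_mem J) (U := projSpaceToSpec A r ⁻¹ᵁ ⊤)
    (fun J ↦ le_inf le_top (cap_stdCover J).ge) y
  choose m hm h using hn (d + n) (Nat.le_add_left _ _)
  refine ⟨n, cechMk m fun J ↦ ?_, sheafVal_ext fun J x hx ↦ ?_⟩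
  · rw [zero_add]
    exact_mod_cast hm J
  · exact (h J x ⟨True.intro, hx⟩ (by rwa [cap_stdCover] at hx)).symm

lemma exists_transition_eq_zero {p : ℕ} (a : ((cechZero A r d).obj M).X p) (ha : fracFam a = 0) :
    ∃ e : ℕ, ((cechZeroTransition A r d e).app M).f p a = 0 := by
  have h (J : Fin (p + 1) ↪o Fin (r + 1)) : ∃ n, sProd A J ^ n • cechVal a J = 0 := by
    refine exists_pow_smul_eq_zero p.succ_pos (sProd_mem J) (cechVal_mem a J) fun x hx ↦ ?_
    have hx' : x ∈ cap (stdCover A r) J := by rwa [cap_stdCover]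
    have h1 : sheafVal (fracFam a) J x hx' = 0 := by rw [ha]; rfl
    rw [sheafVal_fracFam, LocalizedModule.mk_eq_zero_iff] at h1
    obtain ⟨⟨t, ht⟩, h1⟩ := h1
    exact ⟨t, ht, h1⟩
  choose n hn using h
  obtain ⟨B, hB⟩ := (Set.finite_range n).bddAbove
  refine ⟨B, cechVal_injective (funext fun J ↦ ?_)⟩
  rw [cechVal_transition, ← Nat.sub_add_cancel (hB ⟨J, rfl⟩), pow_add, mul_smul, hn, smul_zero]
  rfl

/-- The truncated Čech complex of a graded module computes the Čech cohomology of the associated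
sheaf if it agrees with the complexes for larger truncations. -/
theorem quasiIso_cechFrac (h : ∀ d' ≥ d, ∀ e, QuasiIso ((cechZeroTransition A r d' e).app M)) :
    QuasiIso ((cechFrac A r d).app M) := by
  have hfrac (d p) (a : ((cechZero A r d).obj M).X p) :
    ((cechFrac A r d).app M).f p a = fracFam a := rfl
  have hsub {d p} (a b : ((cechZero A r d).obj M).X p) : fracFam (a - b) = fracFam a - fracFam b :=
    map_sub (((cechFrac A r d).app M).f p).hom a b
  -- Two stages are used: e reaches a level where a given cochain of the sheaf has a representative,
  -- and e' one where an equation between representatives, valid for their fractions, becomes true.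
  let T (e e') : (cechZero A r d).obj M ⟶ (cechZero A r (d + e + e')).obj M :=
    (cechZeroTransition A r d e).app M ≫ (cechZeroTransition A r (d + e) e').app M
  have hT (e e') : QuasiIso (T e e') := by
    have := h d le_rfl e
    have := h (d + e) (Nat.le_add_right _ _) e'
    infer_instance
  have hTf (e e') {p} (a : ((cechZero A r d).obj M).X p) : fracFam ((T e e').f p a) = fracFam a :=
    (fracFam_transition e' _).trans (fracFam_transition e a)
  have hd {d} {i p} (a : ((cechZero A r d).obj M).X i) :
      fracFam (((cechZero A r d).obj M).d i p a) = ((sheafCech A r).obj M).d i p (fracFam a) :=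
    congr($(((cechFrac A r d).app M).comm i p) a).symm
  have hcomm {K L : CochainComplex (ModuleCat.{u} A) ℕ} (φ : K ⟶ L) {i p} (a : K.X i) :
      φ.f p (K.d i p a) = L.d i p (φ.f i a) := congr($(φ.comm i p) a).symm
  refine CochainComplex.quasiIso_of_elements _ (fun p y hy ↦ ?_) (fun p x hx i z hz ↦ ?_)
  -- A representative of a cocycle becomes a cocycle at a higher level. There it is homologous to
  -- the image of a cocycle of level d, because T is a quasi-isomorphism.
  · obtain ⟨e, y, rfl⟩ := exists_fracFam_eq (d := d) y
    rw [← hd] at hy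
    obtain ⟨e', he'⟩ := exists_transition_eq_zero _ hy
    rw [hcomm] at he'
    obtain ⟨x, hx, i, z, hz⟩ := CochainComplex.exists_cocycle_of_quasiIso (T e e') _ he'
    refine ⟨x, hx, i, fracFam z, ?_⟩
    rw [← fracFam_transition e', hz, fracFam_add, hd, hTf, hfrac]
  · obtain ⟨e, z, rfl⟩ := exists_fracFam_eq (d := d) z
    rw [hfrac, ← hd, ← sub_eq_zero, ← fracFam_transition e, ← hsub] at hz
    obtain ⟨e', he'⟩ := exists_transition_eq_zero _ hz
    rw [map_sub, sub_eq_zero, hcomm] at he'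
    exact CochainComplex.exists_eq_d_of_quasiIso (T e e') x hx i _ he'

end GrMod
end

/-! ### Comparison of the two bicomplexes on Spec A -/

noncomputable section

open AlgebraicGeometry.Scheme.Modules

lemma mono_tildeMap {R : CommRingCat.{u}} {M N : ModuleCat.{u} R} (f : M ⟶ N) [Mono f] :
    Mono ((AlgebraicGeometry.tilde.functor R).map f) := by
  rw [Scheme.Modules.mono_iff_injective]
  intro U s t hst
  refine Subtype.ext (funext fun y ↦ ?_)
  have : y.1.asIdeal.IsPrime := y.1.isPrime
  exact IsLocalizedModule.map_injective y.1.asIdeal.primeCompl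
    (LocalizedModule.mkLinearMap _ M) (LocalizedModule.mkLinearMap _ N) f.hom
    ((ModuleCat.mono_iff_injective f).1 inferInstance)
    (congr_fun (congrArg Subtype.val hst) y)

instance (A : Type u) [CommRing A] : (specTilde A).PreservesMonomorphisms where
  preserves f _ := mono_tildeMap (R := CommRingCat.of A) f

/-- As a left adjoint the functor preserves cokernels, and it preserves monomorphisms because
localization is exact; together this gives exactness. -/
instance (A : Type u) [CommRing A] : (specTilde A).PreservesHomology :=
  have := (specAdjunction A).leftAdjoint_preservesColimits
  Functor.preservesHomology_of_preservesMonos_and_cokernels _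

namespace GrMod

variable {A : Type u} [CommRing A] {r : ℕ}

/-- The counit of the adjunction, on complexes. -/
def counitComplex (A : Type u) [CommRing A] :
    (specΓ A).mapHomologicalComplex (ComplexShape.up ℕ) ⋙
      (specTilde A).mapHomologicalComplex (ComplexShape.up ℕ) ⟶ 𝟭 _ where
  app K :=
    { f := fun p ↦ (specAdjunction A).counit.app (K.X p)
      comm' := fun p p' _ ↦ ((specAdjunction A).counit.naturality (K.d p p')).symm }
  naturality K L f := by
    ext p : 1
    exact (specAdjunction A).counit.naturality (f.f p)

/-- The comparison of the sheaf associated with the truncated Čech complex and the direct image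
of the sheaf Čech complex. -/
def cechComparison (A : Type u) [CommRing A] (r d : ℕ) :
    cechZero A r d ⋙ (specTilde A).mapHomologicalComplex (ComplexShape.up ℕ) ⟶ pushCech A r :=
  Functor.whiskerRight (cechFrac A r d) _ ≫ Functor.whiskerLeft (pushCech A r) (counitComplex A)

lemma isIso_counit_pushCech (M : GrMod A r) (p : ℕ) :
    IsIso ((specAdjunction A).counit.app (((pushCech A r).obj M).X p)) := by
  have h := isLocalizing_pushforward_fam (W := cap (stdCover A r) (p := p)) (M := M)
    (fun J ↦ sProd A J) (fun _ ↦ p + 1) (fun _ ↦ p.succ_pos) (fun J ↦ sProd_mem J) cap_stdCover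
  exact (isIso_fromTildeΓ_iff_isLocalizing (R := CommRingCat.of A) _).2 h

/-- The comparison is the image of the algebraic quasi-isomorphism under an exact functor, followed
by the counit, which is invertible on the terms of the direct image because these are
quasi-coherent. -/
lemma quasiIso_cechComparison {d : ℕ} {M : GrMod A r}
    (h : ∀ d' ≥ d, ∀ e, QuasiIso ((cechZeroTransition A r d' e).app M)) :
    QuasiIso ((cechComparison A r d).app M) := by
  have h1 := quasiIso_cechFrac h
  have h2 : QuasiIso (((specTilde A).mapHomologicalComplex (ComplexShape.up ℕ)).map
    ((cechFrac A r d).app M)) := inferInstance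
  have h3 (p) : IsIso (((counitComplex A).app ((pushCech A r).obj M)).f p) :=
    isIso_counit_pushCech M p
  have h4 : IsIso ((counitComplex A).app ((pushCech A r).obj M)) :=
    HomologicalComplex.Hom.isIso_of_components _
  have h5 : QuasiIso ((counitComplex A).app ((pushCech A r).obj M)) := quasiIso_of_isIso _
  have h6 {K L L' : CochainComplex (Spec (CommRingCat.of A)).Modules ℕ} (f : K ⟶ L) (g : L ⟶ L')
      (_ : QuasiIso f) (_ : QuasiIso g) : QuasiIso (f ≫ g) := inferInstance
  exact h6 _ _ h2 h5

/-- The comparison of bicomplexes. -/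
def bicomplexComparison (d : ℕ) (M : CochainComplex (GrMod A r) ℤ) :
    HomologicalComplex₂.mapBicomplex (specTilde A) (bicomplexDegreeZero (cechBicomplex d M)) ⟶
      HomologicalComplex₂.mapBicomplex (pushforward (projSpaceToSpec A r))
        (AlgebraicGeometry.Scheme.Modules.cechBicomplex (stdCover A r)
          (((tilde A r).mapHomologicalComplex (ComplexShape.up ℤ)).obj M)) where
  f p :=
    { f := fun q ↦ ((cechComparison A r d).app (M.X q)).f p
      comm' := fun q q' _ ↦ congr(($((cechComparison A r d).naturality (M.d q q'))).f p).symm }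
  comm' p p' _ := by
    ext q : 1
    exact ((cechComparison A r d).app (M.X q)).comm p p'

lemma colMap_bicomplexComparison (d : ℕ) (M : CochainComplex (GrMod A r) ℤ) (q : ℤ)
    (h : QuasiIso ((cechComparison A r d).app (M.X q))) :
    QuasiIso (HomologicalComplex₂.colMap (bicomplexComparison d M) q) := h

end GrMod
end

/-! ### Acyclicity of the total complex and the main theorem -/

noncomputable section

namespace GrMod

open AlgebraicGeometry.Scheme.Modules Abelian

variable {A : Type u} [CommRing A] {r : ℕ}

lemma isAdaptedTo_projSpaceToSpec (A : Type u) [CommRing A] (r : ℕ) :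
    (acyclicOn fun a : A ↦ D (MvPolynomial.C a : PolyRing A r)).IsAdaptedTo
      (pushforward (projSpaceToSpec A r)) := by
  have h := isAdaptedTo_pushforward (projSpaceToSpec A r)
    (fun a : A ↦ (PrimeSpectrum.basicOpen a : (Spec (.of A)).Opens)) fun U x hx ↦ by
      obtain ⟨_, ⟨_, ⟨a, rfl⟩, rfl⟩, hxa, ha⟩ :=
        PrimeSpectrum.isBasis_basic_opens.exists_subset_of_mem_open hx U.isOpen
      exact ⟨a, hxa, ha⟩
  have e : (fun a : A ↦ projSpaceToSpec A r ⁻¹ᵁ (PrimeSpectrum.basicOpen a :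
      (Spec (.of A)).Opens)) = fun a ↦ D (MvPolynomial.C a : PolyRing A r) :=
    funext projSpaceToSpec_preimage
  rwa [e] at h

/-- The Čech bicomplex of the complex of sheaves associated with a complex of graded modules. -/
abbrev tildeBicomplex (M : CochainComplex (GrMod A r) ℤ) :
    HomologicalComplex₂ (projSpace A r).Modules (ComplexShape.up ℕ) (ComplexShape.up ℤ) :=
  AlgebraicGeometry.Scheme.Modules.cechBicomplex (stdCover A r)
    (((tilde A r).mapHomologicalComplex (ComplexShape.up ℤ)).obj M)

lemma tildeBicomplex_bddBy (M : CochainComplex (GrMod A r) ℤ) : (tildeBicomplex M).BddBy r :=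
  cechBicomplex_bddBy _ _

lemma acyclicOn_tildeBicomplex (M : CochainComplex (GrMod A r) ℤ) (p : ℕ) (q : ℤ) :
    acyclicOn (fun a : A ↦ D (MvPolynomial.C a : PolyRing A r)) (((tildeBicomplex M).X p).X q) := by
  have h := acyclicOn_fam_tilde (A := A) (r := r) (fun J : Fin (p + 1) ↪o Fin (r + 1) ↦ sProd A J)
    (fun _ ↦ p + 1) (fun _ ↦ p.succ_pos) (fun J ↦ sProd_mem J) (M.X q)
  have e : (fun J : Fin (p + 1) ↪o Fin (r + 1) ↦ D (sProd A J)) = cap (stdCover A r) (p := p) :=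
    funext fun J ↦ (cap_stdCover J).symm
  rwa [e] at h

lemma acyclicOn_total (M : CochainComplex (GrMod A r) ℤ) (n : ℤ) :
    acyclicOn (fun a : A ↦ D (MvPolynomial.C a : PolyRing A r))
      (((tildeBicomplex M).total (ComplexShape.up ℤ)).X n) := by
  intro a k α
  have h1 : α.comp (Ext.mk₀ (𝟙 _)) (add_zero _) = 0 := by
    rw [← HomologicalComplex₂.sum_proj_inc (tildeBicomplex_bddBy M)]
    refine Finset.sum_induction _ (fun g ↦ α.comp (Ext.mk₀ g) (add_zero _) = 0)
      (fun f g hf hg ↦ by rw [Ext.mk₀_add, Ext.comp_add, hf, hg, add_zero])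
      (by rw [Ext.mk₀_zero, Ext.comp_zero]) fun p _ ↦ ?_
    rw [← Ext.mk₀_comp_mk₀, ← Ext.comp_assoc_of_third_deg_zero,
      acyclicOn_tildeBicomplex M p _ a k (α.comp _ _), Ext.zero_comp]
  rwa [Ext.comp_mk₀_id] at h1

lemma isZero_tildeBicomplex (M : CochainComplex (GrMod A r) ℤ) (p : ℕ) (q : ℤ)
    (h : IsZero (M.X q)) : IsZero (((tildeBicomplex M).X p).X q) := by
  have h1 : IsZero ((cechSheaf (stdCover A r)).obj ((tilde A r).obj (M.X q))) :=
    (cechSheaf _).map_isZero ((tilde A r).map_isZero h)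
  exact (HomologicalComplex.eval _ _ p).map_isZero h1

lemma isStrictlyGE_total (M : CochainComplex (GrMod A r) ℤ) (a : ℤ) [M.IsStrictlyGE a] :
    CochainComplex.IsStrictlyGE ((tildeBicomplex M).total (ComplexShape.up ℤ)) a := by
  rw [CochainComplex.isStrictlyGE_iff]
  intro n hn
  rw [IsZero.iff_id_eq_zero]
  refine HomologicalComplex₂.total_hom_ext fun p q h ↦ ?_
  exact (isZero_tildeBicomplex M p q (M.isZero_of_isStrictlyGE a q (by omega))).eq_of_src _ _

lemma bicomplexDegreeZero_bddBy (d : ℕ) (M : CochainComplex (GrMod A r) ℤ) :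
    (bicomplexDegreeZero (cechBicomplex d M)).BddBy r :=
  fun _ hp q ↦ isZero_cechZero_X hp (M.X q)

end GrMod
end

theorem proposition5p2 {A : Type u} [CommRing A] [IsNoetherianRing A] (r : ℕ)
    [HasDerivedCategory.{w₁} (projSpace A r).Modules]
    [HasDerivedCategory.{w₂} (Spec (CommRingCat.of A)).Modules]
    (M : CochainComplex (GrMod A r) ℤ)
    (hGE : ∃ a, M.IsStrictlyGE a) (hLE : ∃ b, M.IsStrictlyLE b)
    (hfg : ∀ q, Module.Finite (PolyRing A r) (M.X q))
    (K : ∀ q, GrMod.FreeResolution (M.X q)) (d : ℕ)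
    (hd : ∀ q, Nontrivial (M.X q) → ∀ p ≤ r + 1, ∀ i, (K q).w p i - r ≤ d) :
    Nonempty
      (DerivedCategory.Plus.ι.obj
          ((Scheme.Modules.pushforward (projSpaceToSpec A r)).rightDerivedFunctorPlus.obj
            (DerivedCategory.Plus.Q.obj ((GrMod.tilde A r).mapCochainComplexPlus.obj ⟨M, hGE⟩))) ≅
        DerivedCategory.Q.obj
          (((specTilde A).mapHomologicalComplex (ComplexShape.up ℤ)).obj
            (GrMod.totCech d M))) := by
  have hL : ∃ a, CochainComplex.IsStrictlyGE
      ((GrMod.tildeBicomplex M).total (ComplexShape.up ℤ)) a :=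
    let ⟨a, _⟩ := hGE
    ⟨a, GrMod.isStrictlyGE_total M a⟩
  let L : CochainComplex.Plus (projSpace A r).Modules :=
    ⟨(GrMod.tildeBicomplex M).total (ComplexShape.up ℤ), hL⟩
  let f : (GrMod.tilde A r).mapCochainComplexPlus.obj ⟨M, hGE⟩ ⟶ L :=
    ObjectProperty.homMk (HomologicalComplex₂.toTotalSingle₀ _ ≫ HomologicalComplex₂.total.map
      (HomologicalComplex₂.ofAug _ (Scheme.Modules.cechBicomplexAug_d (GrMod.stdCover A r)
        (((GrMod.tilde A r).mapHomologicalComplex (ComplexShape.up ℤ)).obj M)))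
      (ComplexShape.up ℤ))
  have h1 := DerivedCategory.Plus.isIso_Q_map f
    (Scheme.Modules.quasiIso_toTotal (GrMod.stdCover A r) Scheme.Modules.iSup_D_X _)
  -- The terms of the total Čech complex are finite sums of acyclic sheaves, so the derived direct
  -- image is the direct image applied termwise.
  obtain ⟨e⟩ := (GrMod.isAdaptedTo_projSpaceToSpec A r).nonempty_rightDerivedFunctorPlus_iso L
    (GrMod.acyclicOn_total M)
  let e₁ := (Scheme.Modules.pushforward (projSpaceToSpec A r)).rightDerivedFunctorPlus.mapIso
    (asIso (DerivedCategory.Plus.Q.map f)) ≪≫ e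
  -- Passage from the bounded below derived category to the full one.
  let e₂ : DerivedCategory.Plus.ι.obj (DerivedCategory.Plus.Q.obj
      ((Scheme.Modules.pushforward (projSpaceToSpec A r)).mapCochainComplexPlus.obj L)) ≅
      DerivedCategory.Q.obj (((Scheme.Modules.pushforward
        (projSpaceToSpec A r)).mapHomologicalComplex (ComplexShape.up ℤ)).obj L.obj) :=
    (DerivedCategory.quotientCompQhIso _).app _
  have h2 := HomologicalComplex₂.isIso_totalComparison
    (Scheme.Modules.pushforward (projSpaceToSpec A r)) (GrMod.tildeBicomplex M)
    (GrMod.tildeBicomplex_bddBy M)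
  have h3 := HomologicalComplex₂.isIso_totalComparison (specTilde A)
    (GrMod.bicomplexDegreeZero (GrMod.cechBicomplex d M)) (GrMod.bicomplexDegreeZero_bddBy d M)
  -- For fixed q this is the comparison for the single module M^q. The bound on d is inherited by
  -- every d' ≥ d, as required for passing to the colimit.
  have h4 : QuasiIso (HomologicalComplex₂.total.map (GrMod.bicomplexComparison d M)
      (ComplexShape.up ℤ)) :=
    HomologicalComplex₂.quasiIso_total_map (r := r)
      (fun p hp q ↦ (specTilde A).map_isZero (GrMod.bicomplexDegreeZero_bddBy d M p hp q))
      (fun p hp q ↦ (Scheme.Modules.pushforward (projSpaceToSpec A r)).map_isZero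
        (GrMod.tildeBicomplex_bddBy M p hp q)) _
      fun q ↦ GrMod.colMap_bicomplexComparison d M q (GrMod.quasiIso_cechComparison
        fun d' hd' e ↦ (K q).quasiIso_cechZeroTransition e fun hM p hp i ↦
          (hd q hM p hp i).trans (by exact_mod_cast hd'))
  let e₃ := asIso (HomologicalComplex₂.totalComparison (specTilde A)
    (GrMod.bicomplexDegreeZero (GrMod.cechBicomplex d M)))
  exact ⟨DerivedCategory.Plus.ι.mapIso e₁ ≪≫ e₂ ≪≫
    (DerivedCategory.Q.mapIso (asIso (HomologicalComplex₂.totalComparison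
      (Scheme.Modules.pushforward (projSpaceToSpec A r)) (GrMod.tildeBicomplex M)))).symm ≪≫
    (asIso (DerivedCategory.Q.map (HomologicalComplex₂.total.map
      (GrMod.bicomplexComparison d M) (ComplexShape.up ℤ)))).symm ≪≫
    DerivedCategory.Q.mapIso e₃⟩
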